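/- Let $G$ be a weighted graph on $V=\{0,\dots,n-1\}$: symmetric weights $w(u,v)\ge 0$ with $\sum_v w(u,v)=1$ for every $u$ (loops allowed). For nonempty $S\subseteq V$ put $w(S,T)=\sum_{u\in S,v\in T}w(u,v)$, $\phi(S)=w(S,V\setminus S)/|S|$, $N_{1/2}(S)=\min\{|T| : T\subseteq V\setminus S,\ w(S,T)\ge \tfrac12 w(S,V\setminus S)\}$, $\phi^V(G)=\min_{0<|S|\le n/2} N_{1/2}(S)/|S|$, and, for $2\le k\le n$, $\phi_k(G)=\min\max_{i}\phi(S_i)$ over all pairwise disjoint nonempty $S_1,\dots,S_k\subseteq V$. Let $W=\frac12(I+A)$ with $A=(w(u,v))$; the personal pagerank vector $r_{s,\alpha}$ ($s\in V$, $0<\alpha\le1$) is the unique solution of $r=\alpha\chi_s+(1-\alpha)Wr$. A level set of $r$ is a set $\{v: r(v)\ge\theta\}$. Algorithms are programs for a random access machine with exact real arithmetic at unit cost (integer addition and subtraction, the four real field operations, comparisons, random access memory). There are absolute constants $c,C>0$ such that the following holds; put $\alpha=\min\{1,c\,\phi(S)\}$. (a) There is a polynomial time algorithm that is given $n$, $w$,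 a vertex $s$, and the numbers $|S|$ and $\phi(S)$ of a target set $S\subseteq V$ (but not $S$) with $|S|\ge2$, $\phi(S)>0$ and $3|S|\log|S|\le n$. For every $s\in S$ it outputs a level set $S'$ of $r_{s,\alpha}$, and for at least half of the vertices $s\in S$ (so with probability at least $1/2$ for uniformly random $s\in S$) the set $S'$ satisfies all of the following: $0<|S'|\le n/2$, $|S'|\le C|S|\log|S|$, $$\phi(S')\le C\,\frac{\phi(S)\log|S|}{\phi^V(G)}\qquad\text{and}\qquad \phi(S')\le C\,\frac{k\,\phi(S)\log|S|}{\phi_k(G)}\quad\text{for all }2\le k\le n$$ (a bound with denominator $0$ being void). (b) There is a local implementation for unweighted $d$-regular graphs, $d\geq 1$ (each edge has weight $1/d$): given access to arbitrary adjacency lists, $s$, $d$, $|S|$ and $\phi(S)$, where $|S|\ge2$, $\phi(S)>0$ and $6|S|\log|S|\le n$, the algorithm (which is not given $n$) takes, for every $s\in S$, at most $$C\left(\frac{d|S|\log|S|}{\phi(S)}+|S|\log^2|S|\right)$$ steps and outputs a level set $S'$ of an approximate pagerank vector $r'$, i.e. one with $r'=\alpha(\chi_s-q)+(1-\alpha)Wr'$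 for some vector $q$ with $0\le q\le \frac1{6|S|}$; for at least half of the vertices $s\in S$, $S'$ satisfies all the guarantees in (a). -/

import Mathlib

open scoped BigOperators

namespace LocalPartition

noncomputable section

/-! ## Weighted graphs and their expansion parameters -/

/-- A weighted graph on `V`: all pairs carry a symmetric nonnegative weight, and the total weight
at each vertex is one. Loops (a positive weight `w v v`) are allowed. -/
structure WeightedGraph (V : Type*) [Fintype V] where
  w : V → V → ℝ
  symm : ∀ u v, w u v = w v u
  nonneg : ∀ u v, 0 ≤ w u v
  sum_eq_one : ∀ u, ∑ v, w u v = 1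

namespace WeightedGraph

variable {V : Type*} [Fintype V] [DecidableEq V]

/-- The total weight `w(S, T)` of the edges between the disjoint vertex sets `S` and `T`. -/
def cut (G : WeightedGraph V) (S T : Finset V) : ℝ := ∑ u ∈ S, ∑ v ∈ T, G.w u v

/-- The edge expansion `φ(S) = w(S, V \ S) / |S|` (used for nonempty `S`). -/
def edgeExp (G : WeightedGraph V) (S : Finset V) : ℝ := G.cut S Sᶜ / (S.card : ℝ)

/-- `N_{1/2}(S)`: the least size of a set `T ⊆ V \ S` with `w(S, T) ≥ w(S, V \ S) / 2`.
The choice `T = V \ S` shows that there is such a set. -/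
def halfNbr (G : WeightedGraph V) (S : Finset V) : ℕ :=
  sInf {m : ℕ | ∃ T : Finset V, T ⊆ Sᶜ ∧ G.cut S Sᶜ / 2 ≤ G.cut S T ∧ T.card = m}

/-- The robust vertex expansion `N_{1/2}(S) / |S|` of a nonempty set `S`. -/
def vertexExp (G : WeightedGraph V) (S : Finset V) : ℝ := (G.halfNbr S : ℝ) / (S.card : ℝ)

/-- The robust vertex expansion of the graph, a minimum over the nonempty `S` with
`|S| ≤ |V| / 2` (a finite family, nonempty as soon as `|V| ≥ 2`). -/
def graphVertexExp (G : WeightedGraph V) : ℝ :=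
  sInf {x : ℝ | ∃ S : Finset V, S.Nonempty ∧ 2 * S.card ≤ Fintype.card V ∧ x = G.vertexExp S}

/-- The `k`-way expansion: the minimum, over all families of `k` nonempty pairwise disjoint vertex
sets, of the largest edge expansion in the family. There are such families for `k ≤ |V|`. -/
def kWayExp (G : WeightedGraph V) (k : ℕ) : ℝ :=
  sInf {x : ℝ | ∃ F : Fin k → Finset V, (∀ i, (F i).Nonempty) ∧
    (∀ i j, i ≠ j → Disjoint (F i) (F j)) ∧ x = ⨆ i, G.edgeExp (F i)}

/-- The transition matrix `W = (I + A) / 2` of the lazy random walk. -/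
def lazyWalk (G : WeightedGraph V) : Matrix V V ℝ := (1 / 2 : ℝ) • (1 + Matrix.of G.w)

/-- `r` is the personal pagerank vector `r_{s,α}`: the (for `0 < α ≤ 1` unique) solution of
`r = α χ_s + (1 - α) W r`. -/
def IsPageRank (G : WeightedGraph V) (s : V) (α : ℝ) (r : V → ℝ) : Prop :=
  r = α • (Pi.single s 1 : V → ℝ) + (1 - α) • (G.lazyWalk.mulVec r)

/-- `r` is an `ε`-approximate vector for `r_{s,α}`: it solves
`r = α (χ_s - q) + (1 - α) W r` for some vector `q` with `0 ≤ q ≤ ε`. -/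
def IsApproxPageRank (G : WeightedGraph V) (s : V) (α ε : ℝ) (r : V → ℝ) : Prop :=
  ∃ q : V → ℝ, (∀ u, 0 ≤ q u ∧ q u ≤ ε) ∧
    r = α • ((Pi.single s 1 : V → ℝ) - q) + (1 - α) • (G.lazyWalk.mulVec r)

end WeightedGraph

/-- `S` is a level set `{v | θ ≤ r v}` of the vector `r`. -/
def IsLevelSet {V : Type*} (r : V → ℝ) (S : Finset V) : Prop :=
  ∃ θ : ℝ, ∀ v, v ∈ S ↔ θ ≤ r v

/-- The weighted graph of an unweighted `d`-regular graph: every edge gets weight `1 / d`. -/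
def ofRegular {V : Type*} [Fintype V] (H : SimpleGraph V) [DecidableRel H.Adj] (d : ℕ)
    (hd : 0 < d) (hreg : H.IsRegularOfDegree d) : WeightedGraph V where
  w u v := if H.Adj u v then 1 / (d : ℝ) else 0
  symm u v := by simp only [H.adj_comm]
  nonneg u v := by split_ifs <;> positivity
  sum_eq_one u := by
    have h : (d : ℝ) ≠ 0 := by exact_mod_cast hd.ne'
    have h2 : (Finset.univ.filter (fun v => H.Adj u v)).card = d := by
      rw [← hreg u, ← H.card_neighborFinset_eq_degree, H.neighborFinset_eq_filter]
    rw [← Finset.sum_filter, Finset.sum_const, h2, nsmul_eq_mul]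
    field_simp

/-- An adjacency-list representation of a `d`-regular graph: `nbr v` lists the `d` neighbours of
`v` without repetition, in an arbitrary order. -/
def IsAdjacencyList {n d : ℕ} (H : SimpleGraph (Fin n)) (nbr : Fin n → Fin d → Fin n) : Prop :=
  ∀ v, Function.Injective (nbr v) ∧ ∀ u, H.Adj v u ↔ ∃ i, nbr v i = u

/-! ## Random access machines with exact real arithmetic

Programs are finite syntax trees. The memory consists of integer and real registers and of
two-dimensional integer and real arrays with random access. The integer operations are addition
and truncated subtraction, the real ones are the four field operations (there is no rounding);
integers convert to reals, not conversely. -/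

/-- The memory of the machine. -/
structure Store where
  ireg : ℕ → ℕ
  rreg : ℕ → ℝ
  iarr : ℕ → ℕ → ℕ → ℕ
  rarr : ℕ → ℕ → ℕ → ℝ

/-- Integer expressions; `get a i j` is the entry `(i, j)` of the array with the fixed name `a`. -/
inductive IExpr where
  | const (c : ℕ)
  | reg (x : ℕ)
  | get (a : ℕ) (i j : IExpr)
  | add (e f : IExpr)
  | sub (e f : IExpr)

/-- Value of an integer expression. -/
def IExpr.eval (σ : Store) : IExpr → ℕ
  | .const c => c
  | .reg x => σ.ireg x
  | .get a i j => σ.iarr a (i.eval σ) (j.eval σ)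
  | .add e f => e.eval σ + f.eval σ
  | .sub e f => e.eval σ - f.eval σ

/-- Real expressions. -/
inductive RExpr where
  | ofInt (e : IExpr)
  | reg (x : ℕ)
  | get (a : ℕ) (i j : IExpr)
  | add (e f : RExpr)
  | sub (e f : RExpr)
  | mul (e f : RExpr)
  | div (e f : RExpr)

/-- Value of a real expression (a division by zero returns zero). -/
def RExpr.eval (σ : Store) : RExpr → ℝ
  | .ofInt e => (e.eval σ : ℝ)
  | .reg x => σ.rreg x
  | .get a i j => σ.rarr a (i.eval σ) (j.eval σ)
  | .add e f => e.eval σ + f.eval σ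
  | .sub e f => e.eval σ - f.eval σ
  | .mul e f => e.eval σ * f.eval σ
  | .div e f => e.eval σ / f.eval σ

/-- Tests. -/
inductive Test where
  | ltI (e f : IExpr)
  | eqI (e f : IExpr)
  | ltR (e f : RExpr)
  | eqR (e f : RExpr)
  | neg (b : Test)
  | and (b c : Test)

/-- Truth of a test. -/
def Test.holds (σ : Store) : Test → Prop
  | .ltI e f => e.eval σ < f.eval σ
  | .eqI e f => e.eval σ = f.eval σ
  | .ltR e f => e.eval σ < f.eval σ
  | .eqR e f => e.eval σ = f.eval σ
  | .neg b => ¬ b.holds σ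
  | .and b c => b.holds σ ∧ c.holds σ

/-- Programs. -/
inductive Program where
  | skip
  | setI (x : ℕ) (e : IExpr)
  | setR (x : ℕ) (e : RExpr)
  | putI (a : ℕ) (i j : IExpr) (e : IExpr)
  | putR (a : ℕ) (i j : IExpr) (e : RExpr)
  | seq (p q : Program)
  | ite (b : Test) (p q : Program)
  | loop (b : Test) (p : Program)

/-- Overwrite the entry `(i, j)` of the array `a`. -/
def put {β : Type} (A : ℕ → ℕ → ℕ → β) (a i j : ℕ) (y : β) : ℕ → ℕ → ℕ → β :=
  fun a' i' j' => if a' = a ∧ i' = i ∧ j' = j then y else A a' i' j'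

/-- `Exec p σ t τ`: started on the memory `σ`, the program `p` halts after `t` steps with the
memory `τ`. Every assignment and every test costs one step; as the expressions are part of the
program, one step stands for a number of elementary operations bounded by the program alone.
`loop b p` repeats `p` as long as `b` holds. -/
inductive Exec : Program → Store → ℕ → Store → Prop where
  | skip (σ : Store) : Exec .skip σ 1 σ
  | setI (x : ℕ) (e : IExpr) (σ : Store) :
      Exec (.setI x e) σ 1 { σ with ireg := Function.update σ.ireg x (e.eval σ) }
  | setR (x : ℕ) (e : RExpr) (σ : Store) :
      Exec (.setR x e) σ 1 { σ with rreg := Function.update σ.rreg x (e.eval σ) }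
  | putI (a : ℕ) (i j e : IExpr) (σ : Store) :
      Exec (.putI a i j e) σ 1
        { σ with iarr := put σ.iarr a (i.eval σ) (j.eval σ) (e.eval σ) }
  | putR (a : ℕ) (i j : IExpr) (e : RExpr) (σ : Store) :
      Exec (.putR a i j e) σ 1
        { σ with rarr := put σ.rarr a (i.eval σ) (j.eval σ) (e.eval σ) }
  | seq {p q : Program} {σ τ υ : Store} {t t' : ℕ} :
      Exec p σ t τ → Exec q τ t' υ → Exec (.seq p q) σ (t + t') υ
  | ite_true {b : Test} {p q : Program} {σ τ : Store} {t : ℕ} :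
      b.holds σ → Exec p σ t τ → Exec (.ite b p q) σ (t + 1) τ
  | ite_false {b : Test} {p q : Program} {σ τ : Store} {t : ℕ} :
      ¬ b.holds σ → Exec q σ t τ → Exec (.ite b p q) σ (t + 1) τ
  | loop_true {b : Test} {p : Program} {σ τ υ : Store} {t t' : ℕ} :
      b.holds σ → Exec p σ t τ → Exec (.loop b p) τ t' υ →
      Exec (.loop b p) σ (t + t' + 1) υ
  | loop_false {b : Test} {p : Program} {σ : Store} :
      ¬ b.holds σ → Exec (.loop b p) σ 1 σ

/-- The memory holds the vertex set `S` as output: register 0 contains `|S|`, and the first `|S|`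
entries of row 0 of array 1 list the elements of `S`. -/
def Store.Holds {n : ℕ} (σ : Store) (S : Finset (Fin n)) : Prop :=
  σ.ireg 0 = S.card ∧
    S.map Fin.valEmbedding = (Finset.range (σ.ireg 0)).image (σ.iarr 1 0)

/-- `p` halts on `σ` within `T` steps and outputs the vertex set `S`. -/
def Program.Outputs {n : ℕ} (p : Program) (σ : Store) (T : ℝ) (S : Finset (Fin n)) : Prop :=
  ∃ (t : ℕ) (τ : Store), Exec p σ t τ ∧ (t : ℝ) ≤ T ∧ τ.Holds S

/-- The initial memory of the algorithm for weighted graphs: the start vertex `s`, the number `n`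
of vertices, the size `m` and the edge expansion `φ` of the target set, and the weight matrix in
real array 0. All other cells are zero. -/
def weightedInput {n : ℕ} (G : WeightedGraph (Fin n)) (s : Fin n) (m : ℕ) (φ : ℝ) : Store where
  ireg x := if x = 0 then s.val else if x = 1 then n else if x = 2 then m else 0
  rreg x := if x = 0 then φ else 0
  iarr _ _ _ := 0
  rarr a i j := if h : a = 0 ∧ i < n ∧ j < n then G.w ⟨i, h.2.1⟩ ⟨j, h.2.2⟩ else 0

/-- The initial memory of the local algorithm for unweighted `d`-regular graphs: the start vertex
`s`, the degree `d`, the size `m` and the edge expansion `φ` of the target set, and the adjacency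
lists in integer array 0 (row `v` lists the neighbours of `v`). All other cells are zero; the
number of vertices is not given. -/
def localInput {n d : ℕ} (nbr : Fin n → Fin d → Fin n) (s : Fin n) (m : ℕ) (φ : ℝ) : Store where
  ireg x := if x = 0 then s.val else if x = 1 then d else if x = 2 then m else 0
  rreg x := if x = 0 then φ else 0
  iarr a v i := if h : a = 0 ∧ v < n ∧ i < d then (nbr ⟨v, h.2.1⟩ ⟨i, h.2.2⟩).val else 0
  rarr _ _ _ := 0

/-- The guarantee on the set `S'` found for the target set `S`, with constant `C`:
`S'` is nonempty and contains at most half of the vertices, `|S'| ≤ C |S| log |S|`,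
`φ(S') ≤ C φ(S) log |S| / φ^V(G)`, and `φ(S') ≤ C k φ(S) log |S| / φ_k(G)` for every `k ≥ 2` for
which there are `k` disjoint nonempty vertex sets. The denominators are multiplied out, so that a
bound with denominator zero counts as infinite. -/
def Guarantee {V : Type*} [Fintype V] [DecidableEq V] (G : WeightedGraph V) (C : ℝ)
    (S S' : Finset V) : Prop :=
  S'.Nonempty ∧ 2 * S'.card ≤ Fintype.card V ∧
  (S'.card : ℝ) ≤ C * (S.card * Real.log S.card) ∧
  G.edgeExp S' * G.graphVertexExp ≤ C * (G.edgeExp S * Real.log S.card) ∧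
  ∀ k : ℕ, 2 ≤ k → k ≤ Fintype.card V →
    G.edgeExp S' * G.kWayExp k ≤ C * (k * G.edgeExp S * Real.log S.card)

end

end LocalPartition

namespace LocalPartition

noncomputable section

set_option linter.unusedSectionVars false

/-! Both algorithms sweep over the level sets of an exact or approximate pagerank vector `r` and
keep the best small one. What needs proof is that for half of the starts a good small level set
exists. Write m for |S|.

Mass. The sum of the pagerank vectors over all starts in S solves the same equation with the
indicator of S as source. By the maximum principle it lies between 0 and 1, so at most w(S, V \ S)
flows out of S. With α = c φ(S) the average start loses mass at most 1/(2c), and by Markov's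
inequality half of the starts keep 1 - 1/c inside S (`card_le_two_mul_card_mass`).

Starting height. Let θ = 1/(l m log m) and δ = 0.01/log m. If every vertex had a value below θ +
δ/rank, the mass of S would be at most m θ plus δ times a harmonic number, which is too little. So
some level set with m₀ vertices sits at a height of at least θ + δ/m₀ (`exists_large_value`). Level
sets above θ have at most l m log m vertices, because the total mass is at most 1.

Descent. When φ(S) is small, the flow out of every level set is at most κ = O(φ(S)); otherwise the
claimed bounds are trivial. Suppose that all nonempty level sets above θ have expansion at least φ.
Go down from height t by a D with D · boundary ≥ 2κ. Edges that drop by more than D make up at most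
half of the boundary, so the other half ends in the band between t - D and t. For vertex expansion
the band has at least N_{1/2} vertices, the sets grow by the factor 1 + φ^V, and the drops form a
geometric series (`vertexExp_drop`). For k-way expansion the band has at least boundary/2 vertices.
If too many of the nested sets had boundaries within a factor 2 of each other, differences of well
spaced ones would be k disjoint sets of small expansion. So each dyadic scale occurs O(k/φ_k) times,
which bounds the sum of the drops 2κ/boundary (`card_scale_le`, `kWayExp_drop`). Growth cannot
continue forever, so the descent must pass θ; its total drop exceeds δ/m₀, and this bounds φ from
above (`guarantee_of_best`).

Algorithms. In the weighted case the vector is computed by elimination; the system is substochastic,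
so no pivot vanishes. In the local case all pushes move the same amount ε, so the vector is α ε
times integer push counts. Its level sets at positive heights are lists to which a push appends one
vertex, so no sorting is needed. There are at most 1/(α ε) pushes, the lists have as many entries in
total, and each entry costs O(d). The error is at most ε pointwise, hence at most 1/6 on S. -/

namespace WeightedGraph

variable {V : Type*} [Fintype V] [DecidableEq V] (G : WeightedGraph V)

/-! ## Lazy-walk equations -/

/-- `r = α f + (1 - α) W r`, written out coordinatewise. -/
def Solves (α : ℝ) (f r : V → ℝ) : Prop :=
  ∀ v, r v = α * f v + (1 - α) / 2 * (r v + ∑ u, G.w v u * r u)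

lemma lazyWalk_mulVec (r : V → ℝ) (v : V) :
    G.lazyWalk.mulVec r v = 1 / 2 * (r v + ∑ u, G.w v u * r u) := by
  rw [lazyWalk, Matrix.smul_mulVec, Matrix.add_mulVec, Matrix.one_mulVec]
  rfl

lemma isPageRank_iff (s : V) (α : ℝ) (r : V → ℝ) :
    G.IsPageRank s α r ↔ G.Solves α (Pi.single s 1) r := by
  unfold IsPageRank Solves
  rw [funext_iff]
  refine forall_congr' fun v => ?_
  rw [Pi.add_apply, Pi.smul_apply, Pi.smul_apply, lazyWalk_mulVec, smul_eq_mul, smul_eq_mul]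
  constructor <;> intro h <;> linarith

lemma isApproxPageRank_of_solves {s : V} {α ε : ℝ} {q r : V → ℝ}
    (hq : ∀ u, 0 ≤ q u ∧ q u ≤ ε) (h : G.Solves α (Pi.single s 1 - q) r) :
    G.IsApproxPageRank s α ε r := by
  refine ⟨q, hq, funext fun v => ?_⟩
  rw [Pi.add_apply, Pi.smul_apply, Pi.smul_apply, lazyWalk_mulVec, smul_eq_mul, smul_eq_mul]
  linarith [h v]

variable {G}

lemma Solves.sum_right {ι : Type*} (T : Finset ι) {α : ℝ} {f r : ι → V → ℝ}
    (h : ∀ i ∈ T, G.Solves α (f i) (r i)) :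
    G.Solves α (fun v => ∑ i ∈ T, f i v) (fun v => ∑ i ∈ T, r i v) := by
  intro v
  have : ∑ u, G.w v u * ∑ i ∈ T, r i u = ∑ i ∈ T, ∑ u, G.w v u * r i u := by
    rw [Finset.sum_comm]
    exact Finset.sum_congr rfl fun u _ => Finset.mul_sum _ _ _
  simp only
  rw [this, Finset.mul_sum, ← Finset.sum_add_distrib, Finset.mul_sum, ← Finset.sum_add_distrib]
  exact Finset.sum_congr rfl fun i hi => h i hi v

lemma Solves.sub {α : ℝ} {f g r t : V → ℝ} (h : G.Solves α f r) (h' : G.Solves α g t) :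
    G.Solves α (f - g) (r - t) := by
  intro v
  have h1 := h v
  have h2 := h' v
  simp only [Pi.sub_apply, mul_sub, Finset.sum_sub_distrib] at *
  linarith

/-- Maximum principle. -/
lemma Solves.le_of_le {α M : ℝ} (hα : 0 < α) (hα1 : α ≤ 1) {f r : V → ℝ} (h : G.Solves α f r)
    (hf : ∀ v, f v ≤ M) (v : V) : r v ≤ M := by
  obtain ⟨x, -, hx⟩ := Finset.exists_max_image Finset.univ r ⟨v, Finset.mem_univ v⟩
  refine (hx v (Finset.mem_univ v)).trans ?_
  have h1 : ∑ u, G.w x u * r u ≤ r x := by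
    calc ∑ u, G.w x u * r u ≤ ∑ u, G.w x u * r x :=
          Finset.sum_le_sum fun u _ => mul_le_mul_of_nonneg_left (hx u (Finset.mem_univ u))
            (G.nonneg x u)
      _ = r x := by rw [← Finset.sum_mul, G.sum_eq_one, one_mul]
  have h2 := h x
  have h3 : (1 - α) / 2 * (r x + ∑ u, G.w x u * r u) ≤ (1 - α) / 2 * (r x + r x) :=
    mul_le_mul_of_nonneg_left (by linarith) (by linarith)
  have h4 : α * r x ≤ α * M := by nlinarith [mul_le_mul_of_nonneg_left (hf x) hα.le]
  exact le_of_mul_le_mul_left h4 hα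

lemma Solves.nonneg {α : ℝ} (hα : 0 < α) (hα1 : α ≤ 1) {f r : V → ℝ} (h : G.Solves α f r)
    (hf : ∀ v, 0 ≤ f v) (v : V) : 0 ≤ r v := by
  have h' : G.Solves α (0 - f) (0 - r) := Solves.sub (fun v => by simp) h
  have := h'.le_of_le (M := 0) hα hα1 (fun v => by simpa using hf v) v
  simpa using this

-- The maximum principle, from above and from below, leaves only the zero solution of the
-- homogeneous equation; an injective linear map in finite dimension is onto.
variable (G) in
lemma exists_solves {α : ℝ} (hα : 0 < α) (hα1 : α ≤ 1) (f : V → ℝ) : ∃ r, G.Solves α f r := by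
  let T : (V → ℝ) →ₗ[ℝ] (V → ℝ) :=
    { toFun := fun r v => r v - (1 - α) / 2 * (r v + ∑ u, G.w v u * r u)
      map_add' := fun r t => by
        ext v; simp only [Pi.add_apply, mul_add, Finset.sum_add_distrib]; ring
      map_smul' := fun a r => by
        ext v
        have : ∑ u, G.w v u * (a * r u) = a * ∑ u, G.w v u * r u := by
          rw [Finset.mul_sum]; exact Finset.sum_congr rfl fun u _ => by ring
        simp only [Pi.smul_apply, smul_eq_mul, RingHom.id_apply, this]; ring }
  have hT : ∀ r v, T r v = r v - (1 - α) / 2 * (r v + ∑ u, G.w v u * r u) := fun _ _ => rfl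
  have hinj : Function.Injective T := by
    rw [← LinearMap.ker_eq_bot, LinearMap.ker_eq_bot']
    intro r hr
    have hs : G.Solves α 0 r := fun v => by
      have := congrFun hr v
      rw [hT] at this
      simp only [Pi.zero_apply] at this ⊢
      linarith
    ext v
    exact le_antisymm (hs.le_of_le hα hα1 (fun v => le_rfl) v) (hs.nonneg hα hα1 (fun v => le_rfl) v)
  obtain ⟨r, hr⟩ := LinearMap.injective_iff_surjective.1 hinj (α • f)
  refine ⟨r, fun v => ?_⟩
  have := congrFun hr v
  rw [hT] at this
  simp only [Pi.smul_apply, smul_eq_mul] at this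
  linarith

/-! ## Flow across a vertex set -/

variable (G) in
/-- Net flow `∑ w(u,v) (r u - r v)` over the edges leaving `S`. -/
def flow (r : V → ℝ) (S : Finset V) : ℝ := ∑ u ∈ S, ∑ v ∈ Sᶜ, G.w u v * (r u - r v)

/-- Summing the equation over `S`, the edges inside `S` cancel by antisymmetry of `r u - r v`. This
balance controls both the mass that escapes from the target set and the flow out of level sets. -/
lemma Solves.sum_add_flow {α : ℝ} {f r : V → ℝ} (h : G.Solves α f r) (S : Finset V) :
    α * ∑ u ∈ S, r u + (1 - α) / 2 * G.flow r S = α * ∑ u ∈ S, f u := by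
  have hz : ∑ u ∈ S, ∑ v ∈ S, G.w u v * (r u - r v) = 0 := by
    have : ∑ u ∈ S, ∑ v ∈ S, G.w u v * (r u - r v)
        = -∑ u ∈ S, ∑ v ∈ S, G.w u v * (r u - r v) := by
      conv_lhs => rw [Finset.sum_comm]
      rw [← Finset.sum_neg_distrib]
      refine Finset.sum_congr rfl fun u _ => ?_
      rw [← Finset.sum_neg_distrib]
      refine Finset.sum_congr rfl fun v _ => ?_
      rw [G.symm v u]; ring
    linarith
  have h1 : G.flow r S = ∑ u ∈ S, (r u - ∑ v, G.w u v * r v) := by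
    have : ∀ u, r u - ∑ v, G.w u v * r v
        = ∑ v ∈ S, G.w u v * (r u - r v) + ∑ v ∈ Sᶜ, G.w u v * (r u - r v) := by
      intro u
      rw [Finset.sum_add_sum_compl]
      simp only [mul_sub, Finset.sum_sub_distrib, ← Finset.sum_mul, G.sum_eq_one, one_mul]
    simp only [this, Finset.sum_add_distrib, hz, zero_add, flow]
  have h2 : ∑ u ∈ S, r u = α * ∑ u ∈ S, f u +
      (1 - α) / 2 * ∑ u ∈ S, (r u + ∑ v, G.w u v * r v) := by
    rw [Finset.mul_sum, Finset.mul_sum, ← Finset.sum_add_distrib]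
    exact Finset.sum_congr rfl fun u _ => h u
  have h3 : ∑ u ∈ S, (r u + ∑ v, G.w u v * r v) = 2 * ∑ u ∈ S, r u - G.flow r S := by
    rw [h1, Finset.sum_add_distrib, Finset.sum_sub_distrib]; ring
  rw [h3] at h2
  linarith

lemma Solves.sum_univ {α : ℝ} (hα : 0 < α) {f r : V → ℝ} (h : G.Solves α f r) :
    ∑ u, r u = ∑ u, f u := by
  have := h.sum_add_flow Finset.univ
  simp only [flow, Finset.compl_univ, Finset.sum_empty, Finset.sum_const_zero, mul_zero,
    add_zero] at this
  exact mul_left_cancel₀ hα.ne' this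

/-! ## Basic bounds for cuts -/

variable (G) in
lemma cut_nonneg (S T : Finset V) : 0 ≤ G.cut S T :=
  Finset.sum_nonneg fun u _ => Finset.sum_nonneg fun v _ => G.nonneg u v

variable (G) in
lemma cut_symm (S T : Finset V) : G.cut S T = G.cut T S := by
  unfold cut
  rw [Finset.sum_comm]
  exact Finset.sum_congr rfl fun u _ => Finset.sum_congr rfl fun v _ => G.symm _ _

variable (G) in
lemma cut_mono_right (S : Finset V) {T T' : Finset V} (h : T ⊆ T') : G.cut S T ≤ G.cut S T' :=
  Finset.sum_le_sum fun u _ =>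
    Finset.sum_le_sum_of_subset_of_nonneg h fun v _ _ => G.nonneg u v

variable (G) in
lemma cut_mono_left {S S' : Finset V} (T : Finset V) (h : S ⊆ S') : G.cut S T ≤ G.cut S' T := by
  rw [G.cut_symm S, G.cut_symm S']; exact G.cut_mono_right T h

variable (G) in
lemma cut_le_card_left (S T : Finset V) : G.cut S T ≤ S.card := by
  calc G.cut S T ≤ G.cut S Finset.univ := G.cut_mono_right S (Finset.subset_univ T)
    _ = S.card := by simp [cut, G.sum_eq_one]

variable (G) in
lemma cut_le_card_right (S T : Finset V) : G.cut S T ≤ T.card := by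
  rw [G.cut_symm]; exact G.cut_le_card_left T S

variable (G) in
lemma cut_union_right (S : Finset V) {T T' : Finset V} (h : Disjoint T T') :
    G.cut S (T ∪ T') = G.cut S T + G.cut S T' := by
  unfold cut
  rw [← Finset.sum_add_distrib]
  exact Finset.sum_congr rfl fun u _ => Finset.sum_union h

variable (G) in
lemma edgeExp_nonneg (S : Finset V) : 0 ≤ G.edgeExp S :=
  div_nonneg (G.cut_nonneg _ _) (Nat.cast_nonneg _)

variable (G) in
lemma edgeExp_le_one (S : Finset V) : G.edgeExp S ≤ 1 :=
  div_le_one_of_le₀ (G.cut_le_card_left _ _) (Nat.cast_nonneg _)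

variable (G) in
lemma edgeExp_mul_card {S : Finset V} (hS : S.Nonempty) :
    G.edgeExp S * S.card = G.cut S Sᶜ :=
  div_mul_cancel₀ _ (by exact_mod_cast hS.card_pos.ne')

variable (G) in
/-- The boundary of the difference of two nested sets. -/
lemma cut_sdiff_le {S T : Finset V} (h : S ⊆ T) :
    G.cut (T \ S) (T \ S)ᶜ ≤ G.cut S Sᶜ + G.cut T Tᶜ := by
  have hd : Disjoint S Tᶜ := by
    rw [Finset.disjoint_left]; intro x hx; simp [h hx]
  have he : (T \ S)ᶜ = S ∪ Tᶜ := by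
    ext x; by_cases hx : x ∈ S <;> by_cases hx' : x ∈ T <;> simp [hx, hx']
  rw [he, G.cut_union_right _ hd, G.cut_symm (T \ S) S]
  refine add_le_add (G.cut_mono_right S ?_) (G.cut_mono_left _ Finset.sdiff_subset)
  intro x hx
  simp only [Finset.mem_sdiff, Finset.mem_compl] at *
  exact hx.2

variable (G) in
lemma halfNbr_le {S T : Finset V} (hT : T ⊆ Sᶜ) (h : G.cut S Sᶜ / 2 ≤ G.cut S T) :
    G.halfNbr S ≤ T.card :=
  Nat.sInf_le ⟨T, hT, h, rfl⟩

variable (G) in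
lemma vertexExp_nonneg (S : Finset V) : 0 ≤ G.vertexExp S := by unfold vertexExp; positivity

variable (G) in
lemma graphVertexExp_nonneg : 0 ≤ G.graphVertexExp := by
  refine Real.sInf_nonneg ?_
  rintro x ⟨S, -, -, rfl⟩
  exact G.vertexExp_nonneg S

variable (G) in
lemma graphVertexExp_le {S : Finset V} (hS : S.Nonempty) (h : 2 * S.card ≤ Fintype.card V) :
    G.graphVertexExp ≤ G.vertexExp S := by
  refine csInf_le ⟨0, ?_⟩ ⟨S, hS, h, rfl⟩
  rintro x ⟨S, -, -, rfl⟩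
  exact G.vertexExp_nonneg S

-- A set of ⌊n/2⌋ vertices has a complement at most twice as large once n ≥ 2. The bound later turns
-- the factor `1 + x` into a constant.
variable (G) in
lemma graphVertexExp_le_two (hV : 2 ≤ Fintype.card V) : G.graphVertexExp ≤ 2 := by
  obtain ⟨S, -, hS⟩ := Finset.exists_subset_card_eq (s := (Finset.univ : Finset V))
    (n := Fintype.card V / 2) (by rw [Finset.card_univ]; omega)
  have hne : S.Nonempty := by rw [← Finset.card_pos]; omega
  refine (G.graphVertexExp_le hne (by omega)).trans ?_
  have h1 : G.halfNbr S ≤ Sᶜ.card :=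
    G.halfNbr_le subset_rfl (by linarith [G.cut_nonneg S Sᶜ])
  have h2 : G.halfNbr S ≤ 2 * S.card := by
    rw [Finset.card_compl] at h1; omega
  unfold vertexExp
  rw [div_le_iff₀ (by exact_mod_cast hne.card_pos)]
  exact_mod_cast h2

variable (G) in
lemma kWayExp_nonneg (k : ℕ) : 0 ≤ G.kWayExp k := by
  refine Real.sInf_nonneg ?_
  rintro x ⟨F, -, -, rfl⟩
  exact Real.iSup_nonneg fun i => G.edgeExp_nonneg _

variable (G) in
lemma kWayExp_le {k : ℕ} (hk : 0 < k) {F : Fin k → Finset V} (hF : ∀ i, (F i).Nonempty)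
    (hd : ∀ i j, i ≠ j → Disjoint (F i) (F j)) {b : ℝ} (hb : ∀ i, G.edgeExp (F i) ≤ b) :
    G.kWayExp k ≤ b := by
  have : Nonempty (Fin k) := ⟨⟨0, hk⟩⟩
  have hle : G.kWayExp k ≤ ⨆ i, G.edgeExp (F i) := by
    refine csInf_le ⟨0, ?_⟩ ⟨F, hF, hd, rfl⟩
    rintro x ⟨F, -, -, rfl⟩
    exact Real.iSup_nonneg fun i => G.edgeExp_nonneg _
  exact hle.trans (ciSup_le hb)

variable (G) in
lemma kWayExp_le_one {k : ℕ} (hk : 0 < k) (hkV : k ≤ Fintype.card V) : G.kWayExp k ≤ 1 := by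
  obtain ⟨e⟩ : Nonempty (Fin k ↪ V) :=
    Function.Embedding.nonempty_of_card_le (by simpa using hkV)
  refine G.kWayExp_le hk (F := fun i => {e i}) (fun i => by simp) (fun i j hij => ?_)
    (fun i => G.edgeExp_le_one _)
  simpa using fun h => hij (e.injective h)

/-! ## Escape probability from a set -/

/-- For at least half of the starting points in `S` the pagerank vector leaves little mass outside
of `S`. -/
lemma card_le_two_mul_card_mass {α c : ℝ} (hα : 0 < α) (hα1 : α ≤ 1) (hc : 0 < c) {S : Finset V}
    (hαS : α < 1 → α = c * G.edgeExp S) {r : V → V → ℝ}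
    (hr : ∀ s ∈ S, G.Solves α (Pi.single s 1) (r s)) :
    S.card ≤ 2 * (S.filter fun s => 1 - 1 / c ≤ ∑ u ∈ S, r s u).card := by
  rcases S.eq_empty_or_nonempty with rfl | hne
  · simp
  -- Summing over the starts turns the source into the indicator of `S`, so `p` is trapped between 0
  -- and 1 and a boundary edge carries at most its own weight.
  have hf : ∀ v, (∑ s ∈ S, (Pi.single s 1 : V → ℝ) v) = if v ∈ S then 1 else 0 := by
    intro v
    simp [Pi.single_apply]
  have hp := Solves.sum_right S hr
  set p : V → ℝ := fun v => ∑ s ∈ S, r s v with hpdef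
  have hp0 : ∀ v, 0 ≤ p v := hp.nonneg hα hα1 fun v => by rw [hf]; split_ifs <;> norm_num
  have hp1 : ∀ v, p v ≤ 1 := hp.le_of_le hα hα1 fun v => by rw [hf]; split_ifs <;> norm_num
  have hflow : G.flow p S ≤ G.cut S Sᶜ := by
    refine Finset.sum_le_sum fun u _ => Finset.sum_le_sum fun v _ => ?_
    have : p u - p v ≤ 1 := by linarith [hp0 v, hp1 u]
    nlinarith [G.nonneg u v]
  have hmass := hp.sum_add_flow S
  have hfS : ∑ u ∈ S, ∑ s ∈ S, (Pi.single s 1 : V → ℝ) u = S.card := by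
    simp only [hf]; simp
  rw [hfS] at hmass
  have hr0 : ∀ s ∈ S, ∀ v, 0 ≤ r s v := fun s hs => (hr s hs).nonneg hα hα1 fun v => by
    rw [Pi.single_apply]; split_ifs <;> norm_num
  have hrS : ∀ s ∈ S, ∑ u ∈ S, r s u ≤ 1 := fun s hs => by
    have h1 := (hr s hs).sum_univ hα
    have h2 : ∑ u, (Pi.single s 1 : V → ℝ) u = 1 := by simp
    rw [← h2, ← h1]
    exact Finset.sum_le_sum_of_subset_of_nonneg (Finset.subset_univ _) fun v _ _ => hr0 s hs v
  have hm0 : (0 : ℝ) < S.card := by exact_mod_cast hne.card_pos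
  -- On average at most 1/(2c) of the mass escapes. If the cap α = 1 is active, nothing escapes at
  -- all.
  have hmain : S.card * (1 - 1 / (2 * c)) ≤ ∑ s ∈ S, ∑ u ∈ S, r s u := by
    have hcomm : ∑ s ∈ S, ∑ u ∈ S, r s u = ∑ u ∈ S, p u := Finset.sum_comm
    rw [hcomm]
    rcases hα1.lt_or_eq with h | h
    · have h1 := hαS h
      have hcut := G.edgeExp_mul_card hne
      have h2 : α * (S.card - ∑ u ∈ S, p u) ≤ α * (S.card * (1 / (2 * c))) := by
        have h3 : (1 - α) / 2 * G.flow p S ≤ 1 / 2 * G.cut S Sᶜ := by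
          have h4 : (1 - α) / 2 * G.flow p S ≤ (1 - α) / 2 * G.cut S Sᶜ :=
            mul_le_mul_of_nonneg_left hflow (by linarith)
          nlinarith [G.cut_nonneg S Sᶜ]
        have h5 : α * (S.card * (1 / (2 * c))) = 1 / 2 * G.cut S Sᶜ := by
          rw [← hcut, h1]; field_simp
        rw [h5]; linarith
      have := le_of_mul_le_mul_left h2 hα
      linarith
    · subst h
      have : ∑ u ∈ S, p u = S.card := by linarith
      rw [this]
      have : 0 < 1 / (2 * c) := by positivity
      nlinarith
  -- Markov's inequality: a good start contributes at most 1, any other less than 1 - 1/c.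
  have hsplit : ∑ s ∈ S, ∑ u ∈ S, r s u ≤
      ∑ s ∈ S, (1 - 1 / c + if 1 - 1 / c ≤ ∑ u ∈ S, r s u then 1 / c else 0) := by
    refine Finset.sum_le_sum fun s hs => ?_
    split_ifs with h
    · linarith [hrS s hs]
    · push Not at h; linarith
  rw [Finset.sum_add_distrib, ← Finset.sum_filter, Finset.sum_const, Finset.sum_const,
    nsmul_eq_mul, nsmul_eq_mul] at hsplit
  set A := S.filter fun s => 1 - 1 / c ≤ ∑ u ∈ S, r s u
  have h6 : (S.card : ℝ) * (1 / (2 * c)) ≤ A.card * (1 / c) := by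
    have : (1 : ℝ) / c = 2 * (1 / (2 * c)) := by field_simp
    rw [this] at hsplit ⊢
    nlinarith
  have h7 : (S.card : ℝ) ≤ 2 * A.card := by
    have h8 : (S.card : ℝ) * (1 / (2 * c)) ≤ (2 * A.card) * (1 / (2 * c)) := by
      refine h6.trans (le_of_eq ?_); field_simp
    exact le_of_mul_le_mul_right h8 (by positivity)
  exact_mod_cast h7

/-! ## Level sets -/

/-- The level set `{v | t ≤ r v}`. -/
def level (r : V → ℝ) (t : ℝ) : Finset V := Finset.univ.filter fun v => t ≤ r v

lemma mem_level {r : V → ℝ} {t : ℝ} {v : V} : v ∈ level r t ↔ t ≤ r v := by simp [level]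

lemma level_subset (r : V → ℝ) {t t' : ℝ} (h : t' ≤ t) : level r t ⊆ level r t' := fun v hv => by
  rw [mem_level] at *; linarith

lemma mul_card_level_le {r : V → ℝ} (hr0 : ∀ v, 0 ≤ r v) (hr1 : ∑ v, r v ≤ 1) (t : ℝ) :
    t * (level r t).card ≤ 1 := by
  calc t * (level r t).card = ∑ v ∈ level r t, t := by rw [Finset.sum_const, nsmul_eq_mul, mul_comm]
    _ ≤ ∑ v ∈ level r t, r v := Finset.sum_le_sum fun v hv => mem_level.1 hv
    _ ≤ ∑ v, r v := Finset.sum_le_sum_of_subset_of_nonneg (Finset.subset_univ _) fun v _ _ => hr0 v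
    _ ≤ 1 := hr1

/-- Edges that leave a level set and lose a lot of height are few. -/
lemma mul_cut_level_le_flow (r : V → ℝ) (t : ℝ) {D : ℝ} (hD : 0 ≤ D) :
    D * G.cut (level r t) (level r (t - D))ᶜ ≤ G.flow r (level r t) := by
  unfold cut flow
  rw [Finset.mul_sum]
  refine Finset.sum_le_sum fun u hu => ?_
  rw [Finset.mul_sum]
  calc ∑ v ∈ (level r (t - D))ᶜ, D * G.w u v
      ≤ ∑ v ∈ (level r (t - D))ᶜ, G.w u v * (r u - r v) := by
        refine Finset.sum_le_sum fun v hv => ?_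
        rw [Finset.mem_compl, mem_level] at hv
        rw [mem_level] at hu
        have : D ≤ r u - r v := by linarith
        nlinarith [G.nonneg u v]
    _ ≤ ∑ v ∈ (level r t)ᶜ, G.w u v * (r u - r v) := by
        refine Finset.sum_le_sum_of_subset_of_nonneg
          (Finset.compl_subset_compl.2 (level_subset r (by linarith))) fun v hv _ => ?_
        rw [Finset.mem_compl, mem_level] at hv
        rw [mem_level] at hu
        exact mul_nonneg (G.nonneg u v) (by linarith)

/-- An edge that drops by more than `D` carries flow more than `D` times its weight. As the flow is
at most `κ`, such edges weigh at most `κ / D`, at most half of the boundary. -/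
lemma half_cut_le_cut_band {r : V → ℝ} {t D κ : ℝ} (hD : 0 ≤ D) (hD0 : 0 < D)
    (hflow : G.flow r (level r t) ≤ κ) (hκ : 2 * κ ≤ D * G.cut (level r t) (level r t)ᶜ) :
    G.cut (level r t) (level r t)ᶜ / 2 ≤ G.cut (level r t) (level r (t - D) \ level r t) := by
  have h1 := (mul_cut_level_le_flow (G := G) r t hD).trans hflow
  have h2 : D * G.cut (level r t) (level r (t - D))ᶜ
      ≤ D * (G.cut (level r t) (level r t)ᶜ / 2) := by linarith
  have h3 := le_of_mul_le_mul_left h2 hD0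
  have h4 : (level r t)ᶜ = (level r (t - D) \ level r t) ∪ (level r (t - D))ᶜ := by
    ext x
    have := level_subset r (t := t) (t' := t - D) (by linarith)
    by_cases hx : x ∈ level r t
    · simp [hx, this hx]
    · by_cases hx' : x ∈ level r (t - D) <;> simp [hx, hx']
  have h5 : G.cut (level r t) (level r t)ᶜ = G.cut (level r t) (level r (t - D) \ level r t)
      + G.cut (level r t) (level r (t - D))ᶜ := by
    conv_lhs => rw [h4]
    refine G.cut_union_right _ ?_
    rw [Finset.disjoint_left]; intro x hx
    simp only [Finset.mem_sdiff, Finset.mem_compl, not_not] at *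
    exact hx.1
  linarith

lemma card_level_add_le {r : V → ℝ} {t D : ℝ} (hD : 0 ≤ D) :
    (level r t).card + (level r (t - D) \ level r t).card = (level r (t - D)).card := by
  have := Finset.card_sdiff_add_card_eq_card (level_subset r (t := t) (t' := t - D) (by linarith))
  omega

/-- Level sets between two heights cannot all be bad: vertex expansion. -/
lemma vertexExp_drop {r : V → ℝ} {θ κ φ x : ℝ} (hκ : 0 < κ) (hφ : 0 < φ) (hx : 0 < x)
    (hflow : ∀ t, G.flow r (level r t) ≤ κ)
    (hexp : ∀ t, θ ≤ t → (level r t).Nonempty → φ * (level r t).card ≤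
      G.cut (level r t) (level r t)ᶜ)
    (hnbr : ∀ t, θ ≤ t → (level r t).Nonempty → x * (level r t).card ≤ G.halfNbr (level r t))
    {t : ℝ} (hne : (level r t).Nonempty) :
    t - 2 * κ / (φ * (level r t).card) * ((1 + x) / x) < θ := by
  by_contra hcon
  push Not at hcon
  -- Every descent strictly enlarges the level set, so the number of vertices outside it serves as
  -- measure. The assumption that the remaining drop still ends above `θ` is passed on to the larger
  -- set.
  induction h : Fintype.card V - (level r t).card using Nat.strong_induction_on generalizing t with
  | _ N ih =>
  set m : ℝ := ((level r t).card : ℝ) with hm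
  have hm0 : 0 < m := by rw [hm]; exact_mod_cast hne.card_pos
  -- The boundary is at least `φ * m`, so this `D` satisfies `D * boundary ≥ 2 * κ`.
  set D := 2 * κ / (φ * m) with hDdef
  have hD0 : 0 < D := by positivity
  have hK : 0 < (1 + x) / x := by positivity
  have ht : θ ≤ t := by nlinarith [mul_pos hD0 hK]
  have hband := half_cut_le_cut_band (G := G) hD0.le hD0 (hflow t) (by
    have := mul_le_mul_of_nonneg_left (hexp t ht hne) hD0.le
    refine le_trans (le_of_eq ?_) this
    rw [hDdef, ← hm]; field_simp)
  have hsub : level r (t - D) \ level r t ⊆ (level r t)ᶜ := fun v hv => by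
    simp only [Finset.mem_sdiff, Finset.mem_compl] at *; exact hv.2
  have h1 : x * m ≤ (level r (t - D) \ level r t).card :=
    (hnbr t ht hne).trans (by exact_mod_cast G.halfNbr_le hsub hband)
  have h2 := card_level_add_le (r := r) (t := t) hD0.le
  have h3 : (1 + x) * m ≤ (level r (t - D)).card := by
    rw [← h2]; push_cast; rw [← hm]; linarith
  have h4 : 0 < (level r (t - D) \ level r t).card := by
    have : 0 < x * m := by positivity
    exact_mod_cast this.trans_le h1
  have h5 : (level r (t - D)).card ≤ Fintype.card V := Finset.card_le_univ _
  refine ih _ ?_ (t := t - D) ?_ ?_ rfl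
  · omega
  · rw [← Finset.card_pos]; omega
  · set m' : ℝ := ((level r (t - D)).card : ℝ)
    have hm' : 0 < m' := lt_of_lt_of_le (by positivity) h3
    -- The budget `D * (1 + x) / x` is the geometric series with ratio 1/(1 + x): its first term `D`
    -- is spent now, and the tail `D / x` suffices for a set larger by the factor `1 + x`.
    have h6 : 2 * κ / (φ * m') * ((1 + x) / x) ≤ D / x := by
      calc 2 * κ / (φ * m') * ((1 + x) / x) ≤ 2 * κ / (φ * ((1 + x) * m)) * ((1 + x) / x) := by
            gcongr
        _ = D / x := by rw [hDdef]; field_simp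
    have h7 : D * ((1 + x) / x) = D + D / x := by field_simp; ring
    linarith

end WeightedGraph

/-! ## Numerical sums -/

/-- A dyadic bound for the sum of the reciprocals of numbers that are spread out over the scales. -/
lemma sum_inv_le_of_dyadic {C : ℕ → ℝ} {c M : ℝ} {N : ℕ} (hc : 0 < c) (hM : 0 ≤ M)
    (hC : ∀ i < N, c ≤ C i)
    (h : ∀ y, 0 < y → (((Finset.range N).filter fun i => y ≤ C i ∧ C i < 2 * y).card : ℝ) ≤ M) :
    ∑ i ∈ Finset.range N, 1 / C i ≤ 2 * M / c := by
  -- `a i` is the dyadic scale of `C i / c`. Each scale holds at most `M` indices, so the sum over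
  -- the scales is a geometric series.
  have hex : ∀ i, ∃ a : ℕ, i < N → 2 ^ a * c ≤ C i ∧ C i < 2 * (2 ^ a * c) := by
    intro i
    by_cases hi : i < N
    · obtain ⟨a, h1, h2⟩ := exists_nat_pow_near (x := C i / c) (y := (2 : ℝ))
        (by rw [le_div_iff₀ hc]; linarith [hC i hi]) one_lt_two
      refine ⟨a, fun _ => ⟨by rwa [le_div_iff₀ hc] at h1, ?_⟩⟩
      rw [div_lt_iff₀ hc, pow_succ] at h2
      linarith
    · exact ⟨0, fun h => absurd h hi⟩
  choose a ha using hex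
  set R := (Finset.range N).sup a + 1
  have hmaps : ∀ i ∈ Finset.range N, a i ∈ Finset.range R := fun i hi =>
    Finset.mem_range.2 (Nat.lt_succ_of_le (Finset.le_sup (f := a) hi))
  calc ∑ i ∈ Finset.range N, 1 / C i
      ≤ ∑ i ∈ Finset.range N, 1 / c * (1 / 2) ^ a i := by
        refine Finset.sum_le_sum fun i hi => ?_
        have h1 := (ha i (Finset.mem_range.1 hi)).1
        calc 1 / C i ≤ 1 / (2 ^ a i * c) := one_div_le_one_div_of_le (by positivity) h1
          _ = 1 / c * (1 / 2) ^ a i := by rw [one_div_pow]; field_simp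
    _ = ∑ b ∈ Finset.range R, ∑ i ∈ (Finset.range N).filter (fun i => a i = b),
          1 / c * (1 / 2) ^ a i := (Finset.sum_fiberwise_of_maps_to hmaps _).symm
    _ ≤ ∑ b ∈ Finset.range R, M / c * (1 / 2) ^ b := by
        refine Finset.sum_le_sum fun b _ => ?_
        have h1 : ∑ i ∈ (Finset.range N).filter (fun i => a i = b), 1 / c * (1 / 2 : ℝ) ^ a i
            = ((Finset.range N).filter (fun i => a i = b)).card * (1 / c * (1 / 2) ^ b) := by
          rw [← nsmul_eq_mul, ← Finset.sum_const]
          refine Finset.sum_congr rfl fun i hi => ?_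
          rw [(Finset.mem_filter.1 hi).2]
        have h2 : (((Finset.range N).filter (fun i => a i = b)).card : ℝ) ≤ M := by
          refine le_trans ?_ (h (2 ^ b * c) (by positivity))
          refine Nat.cast_le.2 (Finset.card_le_card fun i hi => ?_)
          rw [Finset.mem_filter] at *
          refine ⟨hi.1, ?_⟩
          have := ha i (Finset.mem_range.1 hi.1)
          rwa [hi.2] at this
        rw [h1]
        calc _ ≤ M * (1 / c * (1 / 2) ^ b) := mul_le_mul_of_nonneg_right h2 (by positivity)
          _ = _ := by ring
    _ ≤ M / c * 2 := by
        rw [← Finset.mul_sum]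
        exact mul_le_mul_of_nonneg_left (sum_geometric_two_le R) (by positivity)
    _ = 2 * M / c := by ring

/-- The sum of the inverse ranks of a finite family of reals is at most harmonic. -/
lemma sum_inv_rank_le {V : Type*} [DecidableEq V] (r : V → ℝ) (S : Finset V) :
    ∑ v ∈ S, 1 / ((S.filter fun u => r v ≤ r u).card : ℝ) ≤ (harmonic S.card : ℝ) := by
  induction S using Finset.induction_on_min_value r with
  | empty => simp
  | insert a s ha hmin ih =>
    rw [Finset.sum_insert ha, Finset.card_insert_of_notMem ha, harmonic_succ]
    -- The new element is a minimum, so its rank is the full cardinality and yields the last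
    -- harmonic term; the other ranks can only increase.
    have h1 : ((insert a s).filter fun u => r a ≤ r u) = insert a s := by
      rw [Finset.filter_eq_self]
      intro x hx
      rcases Finset.mem_insert.1 hx with rfl | hx
      · exact le_rfl
      · exact hmin x hx
    rw [h1, Finset.card_insert_of_notMem ha]
    have h2 : ∑ v ∈ s, 1 / (((insert a s).filter fun u => r v ≤ r u).card : ℝ)
        ≤ ∑ v ∈ s, 1 / ((s.filter fun u => r v ≤ r u).card : ℝ) := by
      refine Finset.sum_le_sum fun v hv => one_div_le_one_div_of_le ?_ ?_
      · exact_mod_cast Finset.card_pos.2 ⟨v, by simp [hv]⟩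
      · exact_mod_cast Finset.card_le_card
          (Finset.filter_subset_filter _ (Finset.subset_insert a s))
    push_cast
    rw [one_div]
    linarith

/-! ### A vertex that is high for its rank -/

namespace WeightedGraph

variable {V : Type*} [Fintype V] [DecidableEq V] {G : WeightedGraph V}

/-- If every vertex of `S` had a low value relative to its rank, the mass of `S` would be small. -/
lemma exists_large_value {r : V → ℝ} {S : Finset V} {a b : ℝ} (hb : 0 ≤ b)
    (h : S.card * a + b * (1 + Real.log S.card) < ∑ v ∈ S, r v) :
    ∃ v, a + b / (level r (r v)).card ≤ r v := by
  by_contra! hcon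
  have h1 : ∑ v ∈ S, r v ≤ ∑ v ∈ S, (a + b * (1 / ((S.filter fun u => r v ≤ r u).card : ℝ))) := by
    refine Finset.sum_le_sum fun v hv => (hcon v).le.trans ?_
    rw [div_eq_mul_one_div]
    -- Ranks in `V` are at least the ranks within `S`, so the harmonic bound for `S` applies.
    have : (1 : ℝ) / (level r (r v)).card ≤ 1 / ((S.filter fun u => r v ≤ r u).card : ℝ) := by
      refine one_div_le_one_div_of_le ?_ ?_
      · exact_mod_cast Finset.card_pos.2 ⟨v, by simp [hv]⟩
      · exact_mod_cast Finset.card_le_card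
          (Finset.filter_subset_filter _ (Finset.subset_univ S))
    nlinarith
  rw [Finset.sum_add_distrib, ← Finset.mul_sum, Finset.sum_const, nsmul_eq_mul] at h1
  have h2 := (sum_inv_rank_le r S).trans (harmonic_le_one_add_log S.card)
  nlinarith [mul_le_mul_of_nonneg_left h2 hb]

/-! ## The `k`-way bound -/

/-- Among nested sets whose sizes grow by half their boundary, few have boundary of a given
order of magnitude if the `k`-way expansion is large. -/
lemma card_scale_le {A : ℕ → Finset V} {N k h : ℕ} {y : ℝ} (hk : 0 < k) (hA : Monotone A)
    (hgrow : ∀ i < N, ((A i).card : ℝ) + G.cut (A i) (A i)ᶜ / 2 ≤ (A (i + 1)).card) (hy : 0 < y)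
    (hh0 : 0 < h) (hh : 8 / h < G.kWayExp k) :
    ((Finset.range N).filter fun i => y ≤ G.cut (A i) (A i)ᶜ ∧ G.cut (A i) (A i)ᶜ < 2 * y).card
      ≤ k * h := by
  set I := (Finset.range N).filter
    fun i => y ≤ G.cut (A i) (A i)ᶜ ∧ G.cut (A i) (A i)ᶜ < 2 * y with hI
  by_contra! hcon
  -- `f` enumerates `I` increasingly; the value 0 past the end is never used.
  set f : ℕ → ℕ := fun a => if ha : a < I.card then I.orderEmbOfFin rfl ⟨a, ha⟩ else 0
  have hf : ∀ a (ha : a < I.card), f a = I.orderEmbOfFin rfl ⟨a, ha⟩ := fun a ha => dif_pos ha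
  have hfmem : ∀ a, a < I.card → f a < N ∧ y ≤ G.cut (A (f a)) (A (f a))ᶜ ∧
      G.cut (A (f a)) (A (f a))ᶜ < 2 * y := by
    intro a ha
    have := Finset.orderEmbOfFin_mem I rfl ⟨a, ha⟩
    rw [← hf a ha] at this
    rw [hI, Finset.mem_filter, Finset.mem_range] at this
    exact this
  have hflt : ∀ a b, a < b → b < I.card → f a < f b := by
    intro a b hab hb
    rw [hf a (hab.trans hb), hf b hb]
    exact (I.orderEmbOfFin rfl).strictMono (by simpa using hab)
  have hfle : ∀ a b, a ≤ b → b < I.card → f a ≤ f b := by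
    intro a b hab hb
    rcases hab.lt_or_eq with h | rfl
    · exact (hflt a b h hb).le
    · exact le_rfl
  -- Each index passed brings at least y/2 new vertices, half of a boundary of size at least `y`.
  have hsize : ∀ b a, a + b < I.card →
      ((A (f a)).card : ℝ) + b * (y / 2) ≤ (A (f (a + b))).card := by
    intro b
    induction b with
    | zero => intro a _; simp
    | succ b ih =>
      intro a hab
      have h1 := ih a (by omega)
      obtain ⟨h2, h3, -⟩ := hfmem (a + b) (by omega)
      have h4 := hgrow _ h2
      have h5 : (A (f (a + b) + 1)).card ≤ (A (f (a + (b + 1)))).card :=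
        Finset.card_le_card (hA (hflt (a + b) (a + (b + 1)) (by omega) hab))
      have h6 : ((A (f (a + b) + 1)).card : ℝ) ≤ (A (f (a + (b + 1)))).card := by exact_mod_cast h5
      push_cast
      linarith
  -- More than `k * h` indices are available, so the positions 0, h, 2h, …, kh all exist.
  have hidx : ∀ g : Fin k, (g.val + 1) * h < I.card := fun g =>
    lt_of_le_of_lt (Nat.mul_le_mul_right h g.isLt) hcon
  have hsub : ∀ g : Fin k, A (f (g * h)) ⊆ A (f ((g + 1) * h)) := fun g =>
    hA (hfle _ _ (by nlinarith) (hidx g))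
  -- The differences of sets `h` positions apart have at least `h * y / 2` vertices and boundary
  -- below `4 * y`, hence expansion at most `8 / h`.
  set F : Fin k → Finset V := fun g => A (f ((g + 1) * h)) \ A (f (g * h)) with hF
  have hcard : ∀ g, (h : ℝ) * (y / 2) ≤ (F g).card := by
    intro g
    have h1 := hsize h (g * h) (by have := hidx g; rwa [add_mul, one_mul] at this)
    have h2 : g.val * h + h = (g + 1) * h := by ring
    rw [h2] at h1
    have h3 := Finset.card_sdiff_add_card_eq_card (hsub g)
    have h4 : ((F g).card : ℝ) + (A (f (g * h))).card = (A (f ((g + 1) * h))).card := by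
      exact_mod_cast h3
    linarith
  have hh' : (0 : ℝ) < h := by exact_mod_cast hh0
  have hpos : ∀ g, (0 : ℝ) < (F g).card := fun g => lt_of_lt_of_le (by positivity) (hcard g)
  have hle : G.kWayExp k ≤ 8 / h := by
    refine G.kWayExp_le hk (F := F) (fun g => ?_) ?_ fun g => ?_
    · rw [← Finset.card_pos]; exact_mod_cast hpos g
    · have key : ∀ g g' : Fin k, g < g' → Disjoint (F g) (F g') := by
        intro g g' hgg
        rw [Finset.disjoint_left]
        intro x hx hx'
        refine (Finset.mem_sdiff.1 hx').2 (hA (hfle _ _ ?_ ?_) (Finset.mem_sdiff.1 hx).1)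
        · exact Nat.mul_le_mul_right h hgg
        · have := hidx g'; nlinarith
      intro g g' hgg
      rcases lt_or_gt_of_ne hgg with h | h
      · exact key g g' h
      · exact (key g' g h).symm
    · unfold edgeExp
      rw [div_le_div_iff₀ (hpos g) hh']
      have h1 := G.cut_sdiff_le (hsub g)
      have h2 := (hfmem (g * h) (by have := hidx g; nlinarith)).2.2
      have h3 := (hfmem ((g + 1) * h) (hidx g)).2.2
      have h4 : G.cut (F g) (F g)ᶜ ≤ 4 * y := by linarith
      nlinarith [hcard g]
  linarith

/-- Level sets between two heights cannot all be bad: `k`-way expansion. -/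
lemma kWayExp_drop {r : V → ℝ} {θ κ φ : ℝ} {k h : ℕ} (hκ : 0 < κ) (hφ : 0 < φ) (hk : 0 < k)
    (hh0 : 0 < h) (hh : 8 / h < G.kWayExp k)
    (hflow : ∀ t, G.flow r (level r t) ≤ κ)
    (hexp : ∀ t, θ ≤ t → (level r t).Nonempty → φ * (level r t).card ≤
      G.cut (level r t) (level r t)ᶜ)
    {t : ℝ} (hne : (level r t).Nonempty) :
    t - 2 * κ * (2 * (k * h) / (φ * (level r t).card)) < θ := by
  by_contra hcon
  push Not at hcon
  have hm0 : (0 : ℝ) < (level r t).card := by exact_mod_cast hne.card_pos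
  let C : ℝ → ℝ := fun x => G.cut (level r x) (level r x)ᶜ
  -- Each drop is just large enough for the band to catch half of the boundary. A zero boundary
  -- would give drop 0, but it does not occur above `θ`.
  let τ : ℕ → ℝ := fun i => Nat.rec t (fun _ x => x - 2 * κ / C x) i
  have hτ : ∀ i, τ (i + 1) = τ i - 2 * κ / C (τ i) := fun _ => rfl
  have hC0 : ∀ x, 0 ≤ C x := fun x => G.cut_nonneg _ _
  have hanti : Antitone τ := antitone_nat_of_succ_le fun i => by
    rw [hτ]
    have : 0 ≤ 2 * κ / C (τ i) := div_nonneg (by positivity) (hC0 _)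
    linarith
  have hmono : Monotone fun i => level r (τ i) := fun i j hij => level_subset r (hanti hij)
  have hne' : ∀ i, (level r (τ i)).Nonempty := fun i => hne.mono (hmono (Nat.zero_le i))
  have hcard : ∀ i, ((level r t).card : ℝ) ≤ (level r (τ i)).card := fun i => by
    exact_mod_cast Finset.card_le_card (hmono (Nat.zero_le i))
  have hCle : ∀ i, θ ≤ τ i → φ * (level r t).card ≤ C (τ i) := fun i hi =>
    (mul_le_mul_of_nonneg_left (hcard i) hφ.le).trans (hexp _ hi (hne' i))
  have hCpos : ∀ i, θ ≤ τ i → 0 < C (τ i) := fun i hi => lt_of_lt_of_le (by positivity) (hCle i hi)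
  have hgrow : ∀ i, θ ≤ τ i →
      ((level r (τ i)).card : ℝ) + C (τ i) / 2 ≤ (level r (τ (i + 1))).card := by
    intro i hi
    have hD : 0 < 2 * κ / C (τ i) := div_pos (by positivity) (hCpos i hi)
    have h1 := half_cut_le_cut_band (G := G) hD.le hD (hflow (τ i)) (by
      change 2 * κ ≤ 2 * κ / C (τ i) * C (τ i)
      rw [div_mul_cancel₀ _ (hCpos i hi).ne'])
    have h2 := G.cut_le_card_right (level r (τ i)) (level r (τ i - 2 * κ / C (τ i)) \ level r (τ i))
    have h3 := card_level_add_le (r := r) (t := τ i) hD.le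
    rw [hτ, ← h3]
    push_cast
    change C (τ i) / 2 ≤ _ at h1
    linarith
  have hsum : ∀ N, τ N = t - 2 * κ * ∑ i ∈ Finset.range N, 1 / C (τ i) := by
    intro N
    induction N with
    | zero =>
      rw [Finset.sum_range_zero, mul_zero, sub_zero]
      rfl
    | succ N ih => rw [Finset.sum_range_succ, hτ, mul_add, ← sub_sub, ← ih]; ring
  -- While the earlier heights are above `θ`, the scale count applies to them and bounds the drop so
  -- far; by `hcon` the next height is above `θ` too.
  have hθ : ∀ N, ∀ i < N, θ ≤ τ i := by
    intro N
    induction N with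
    | zero => intro i hi; omega
    | succ N ih =>
      intro i hi
      rcases Nat.lt_succ_iff_lt_or_eq.1 hi with hi | rfl
      · exact ih i hi
      · have h1 := sum_inv_le_of_dyadic (C := fun j => C (τ j)) (c := φ * (level r t).card)
          (M := (k : ℝ) * h) (N := i) (mul_pos hφ hm0) (by positivity) (fun j hj => hCle j (ih j hj))
          fun y hy => by
            have := card_scale_le (G := G) hk hmono (fun j hj => hgrow j (ih j hj)) hy hh0 hh
            rw [← Nat.cast_mul]
            exact Nat.cast_le.2 this
        rw [hsum]
        have := mul_le_mul_of_nonneg_left h1 (by positivity : 0 ≤ 2 * κ)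
        linarith
  have hθ' : ∀ i, θ ≤ τ i := fun i => hθ (i + 1) i (Nat.lt_succ_self i)
  -- The descent thus never reaches `θ`, yet the sets grow strictly at each step, which is
  -- impossible in a finite graph.
  have hstrict : ∀ i, i ≤ (level r (τ i)).card := by
    intro i
    induction i with
    | zero => exact Nat.zero_le _
    | succ i ih =>
      have h1 := hgrow i (hθ' i)
      have h2 : (level r (τ i)).card < (level r (τ (i + 1))).card := by
        have := hCpos i (hθ' i)
        have h3 : ((level r (τ i)).card : ℝ) < (level r (τ (i + 1))).card := by linarith
        exact_mod_cast h3
      omega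
  have h1 := hstrict (Fintype.card V + 1)
  have h2 := Finset.card_le_univ (level r (τ (Fintype.card V + 1)))
  omega

/-- The available height `δ / m` is less than the total drop of the descent. Both are proportional
to 1/m, so the size cancels, and `1 + x ≤ 3` gives the constant 6. -/
lemma mul_vertexExp_le_of_height {r : V → ℝ} {θ κ φ x δ : ℝ} (hκ : 0 < κ) (hφ : 0 < φ) (hx : 0 < x)
    (hx2 : x ≤ 2) (hδ : 0 < δ) (hflow : ∀ t, G.flow r (level r t) ≤ κ)
    (hexp : ∀ t, θ ≤ t → (level r t).Nonempty → φ * (level r t).card ≤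
      G.cut (level r t) (level r t)ᶜ)
    (hnbr : ∀ t, θ ≤ t → (level r t).Nonempty → x * (level r t).card ≤ G.halfNbr (level r t))
    {t : ℝ} (hne : (level r t).Nonempty) (ht : θ + δ / (level r t).card ≤ t) :
    φ * x ≤ 6 * κ / δ := by
  have h1 := vertexExp_drop hκ hφ hx hflow hexp hnbr hne
  have hm : (0 : ℝ) < (level r t).card := by exact_mod_cast hne.card_pos
  generalize ((level r t).card : ℝ) = m at *
  have h2 : δ / m < 2 * κ * (1 + x) / (φ * x) / m := by
    have : 2 * κ / (φ * m) * ((1 + x) / x) = 2 * κ * (1 + x) / (φ * x) / m := by field_simp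
    linarith
  have h3 := (div_lt_div_iff_of_pos_right hm).1 h2
  rw [lt_div_iff₀ (by positivity)] at h3
  rw [le_div_iff₀ hδ]
  nlinarith

/-- The size cancels as for vertex expansion. The spacing `h` is ⌊8/ψ⌋ + 1 with ψ the k-way
expansion; it is at most 9/ψ since ψ ≤ 1, and 4 · 9 = 36. -/
lemma mul_kWayExp_le_of_height {r : V → ℝ} {θ κ φ δ : ℝ} {k : ℕ} (hκ : 0 < κ) (hφ : 0 < φ)
    (hk : 0 < k) (hψ : 0 < G.kWayExp k) (hψ1 : G.kWayExp k ≤ 1) (hδ : 0 < δ)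
    (hflow : ∀ t, G.flow r (level r t) ≤ κ)
    (hexp : ∀ t, θ ≤ t → (level r t).Nonempty → φ * (level r t).card ≤
      G.cut (level r t) (level r t)ᶜ)
    {t : ℝ} (hne : (level r t).Nonempty) (ht : θ + δ / (level r t).card ≤ t) :
    φ * G.kWayExp k ≤ 36 * κ * k / δ := by
  have hfl : ∃ h : ℕ, 8 / G.kWayExp k < h ∧ (h : ℝ) ≤ 9 / G.kWayExp k := by
    refine ⟨⌊8 / G.kWayExp k⌋₊ + 1, by push_cast; exact Nat.lt_floor_add_one _, ?_⟩
    have h1 : (⌊8 / G.kWayExp k⌋₊ : ℝ) ≤ 8 / G.kWayExp k := Nat.floor_le (by positivity)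
    have h2 : 1 ≤ 1 / G.kWayExp k := by rw [le_div_iff₀ hψ]; linarith
    have h3 : 9 / G.kWayExp k = 8 / G.kWayExp k + 1 / G.kWayExp k := by ring
    rw [h3]; push_cast; linarith
  obtain ⟨h, hh1, hh2⟩ := hfl
  have hh0 : (0 : ℝ) < h := lt_trans (by positivity) hh1
  have h1 := kWayExp_drop (G := G) (k := k) (h := h) hκ hφ hk (by exact_mod_cast hh0)
    (by rw [div_lt_iff₀ hψ] at hh1; rw [div_lt_iff₀ hh0]; linarith) hflow hexp hne
  have hm : (0 : ℝ) < (level r t).card := by exact_mod_cast hne.card_pos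
  have hk' : (0 : ℝ) < k := by exact_mod_cast hk
  generalize ((level r t).card : ℝ) = m at *
  generalize G.kWayExp k = ψ at *
  generalize (k : ℝ) = k' at *
  generalize (h : ℝ) = h' at *
  have h2 : δ / m < 4 * κ * k' * h' / φ / m := by
    have : 2 * κ * (2 * (k' * h') / (φ * m)) = 4 * κ * k' * h' / φ / m := by field_simp; ring
    linarith
  have h3 := (div_lt_div_iff_of_pos_right hm).1 h2
  rw [lt_div_iff₀ hφ] at h3
  have h4 : 4 * κ * k' * h' ≤ 4 * κ * k' * (9 / ψ) := by gcongr
  have h5 : 4 * κ * k' * (9 / ψ) = 36 * κ * k' / ψ := by ring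
  have h6 : δ * φ ≤ 36 * κ * k' / ψ := by linarith
  rw [le_div_iff₀ hψ] at h6
  rw [le_div_iff₀ hδ]
  linarith

/-! ## The guarantee for the best level set -/

lemma log_ge_of_two_le {m : ℕ} (hm : 2 ≤ m) : 0.693 < Real.log m := by
  have h1 : Real.log 2 ≤ Real.log m := Real.log_le_log (by norm_num) (by exact_mod_cast hm)
  linarith [Real.log_two_gt_d9]

/-- The best level set among those with at most `l |S| log |S|` vertices satisfies the guarantee,
as soon as the (approximate) pagerank vector has enough mass in `S`. -/
lemma guarantee_of_best {s : V} {α l : ℝ} {q r : V → ℝ} {S S' : Finset V} (hS : 2 ≤ S.card)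
    (hφ : 0 < G.edgeExp S) (hα : α = min 1 (100 * G.edgeExp S)) (hl : 0 < l)
    (hn : 2 * (l * (S.card * Real.log S.card)) ≤ Fintype.card V)
    (hq : ∀ v, 0 ≤ q v) (hr : G.Solves α (Pi.single s 1 - q) r)
    (hr0 : ∀ v, 0 ≤ r v) (hr1 : ∑ v, r v ≤ 1)
    (hmass : 1 / (l * Real.log S.card) + 0.01 * (1 / Real.log S.card + 1) < ∑ v ∈ S, r v)
    (hbest : ∀ t, (level r t).Nonempty → (level r t).card ≤ l * (S.card * Real.log S.card) →
      S'.Nonempty ∧ G.edgeExp S' ≤ G.edgeExp (level r t))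
    (hcard : (S'.card : ℝ) ≤ 3 * (S.card * Real.log S.card)) (hcard' : 2 * S'.card ≤ Fintype.card V) :
    Guarantee G 10000000 S S' := by
  set m := S.card with hm
  have hlog := log_ge_of_two_le hS
  set Λ := Real.log m with hΛ
  have hm0 : (0 : ℝ) < m := by exact_mod_cast (by omega : 0 < m)
  have hΛ0 : 0 < Λ := by linarith
  have hα0 : 0 < α := by rw [hα]; positivity
  have hα1 : α ≤ 1 := by rw [hα]; exact min_le_left _ _
  -- A total mass of at most 1 leaves room for at most `l * m * Λ` vertices at height `θ`, while `m
  -- * θ` is the first term of `hmass`.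
  set θ := 1 / (l * (m * Λ)) with hθ
  have hθ0 : 0 < θ := by positivity
  obtain ⟨v, hv⟩ := exists_large_value (r := r) (a := θ) (b := 0.01 / Λ) (by positivity) (by
    refine lt_of_le_of_lt (le_of_eq ?_) hmass
    rw [← hm, ← hΛ, hθ]; field_simp)
  set t := r v
  have hne : (level r t).Nonempty := ⟨v, by rw [mem_level]⟩
  set m₀ : ℝ := ((level r t).card : ℝ) with hm₀def
  have hm₀ : 0 < m₀ := by rw [hm₀def]; exact_mod_cast hne.card_pos
  have hsmall : ∀ x, θ ≤ x → (level r x).card ≤ l * (m * Λ) := by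
    intro x hx
    have h1 := mul_card_level_le hr0 hr1 x
    have h2 : θ * (level r x).card ≤ 1 :=
      (mul_le_mul_of_nonneg_right hx (Nat.cast_nonneg _)).trans h1
    rw [hθ, div_mul_eq_mul_div, div_le_iff₀ (by positivity)] at h2
    linarith
  have hθt : θ ≤ t := by
    have : 0 ≤ 0.01 / Λ / m₀ := by positivity
    linarith
  obtain ⟨hS'ne, -⟩ := hbest t hne (hsmall t hθt)
  have hV : 2 ≤ Fintype.card V := by have := hS'ne.card_pos; omega
  refine ⟨hS'ne, hcard', ?_, ?_⟩
  · have : 0 ≤ m * Λ := by positivity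
    linarith
  set φ := G.edgeExp S' with hφ'
  have hφ0 : 0 ≤ φ := G.edgeExp_nonneg _
  have hφ1 : φ ≤ 1 := G.edgeExp_le_one _
  have hx0 := G.graphVertexExp_nonneg
  have hx2 := G.graphVertexExp_le_two hV
  -- If φ(S) is at least 1/200, the right hand sides exceed the trivial bounds φ(S') ≤ 1, φ^V ≤ 2
  -- and φ_k ≤ 1. Otherwise α < 1/2.
  by_cases hbig : 1 / 200 ≤ G.edgeExp S
  · have h1 : 0.0034 ≤ G.edgeExp S * Λ := by nlinarith
    refine ⟨by nlinarith, fun k hk2 hkn => ?_⟩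
    have h2 := G.kWayExp_le_one (by omega : 0 < k) hkn
    have h3 := G.kWayExp_nonneg k
    have h4 : (2 : ℝ) ≤ k := by exact_mod_cast hk2
    have h5 : 1 ≤ (k : ℝ) * G.edgeExp S * Λ * 10000000 := by
      have : (2 : ℝ) * 0.0034 ≤ k * (G.edgeExp S * Λ) := by gcongr
      nlinarith
    nlinarith
  push Not at hbig
  have hαeq : α = 100 * G.edgeExp S := by rw [hα]; exact min_eq_right (by linarith)
  have hαhalf : α < 1 / 2 := by linarith
  -- This is 4α, which dominates the flow bound 2α/(1 - α) as α < 1/2.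
  set κ := 400 * G.edgeExp S with hκdef
  have hκ : 0 < κ := by positivity
  have hflow : ∀ t, G.flow r (level r t) ≤ κ := by
    intro t
    have h1 := hr.sum_add_flow (level r t)
    have h2 : ∑ u ∈ level r t, ((Pi.single s 1 : V → ℝ) - q) u ≤ 1 := by
      calc ∑ u ∈ level r t, ((Pi.single s 1 : V → ℝ) - q) u
          ≤ ∑ u ∈ level r t, (Pi.single s 1 : V → ℝ) u :=
            Finset.sum_le_sum fun u _ => by simpa using hq u
        _ ≤ ∑ u, (Pi.single s 1 : V → ℝ) u :=
            Finset.sum_le_sum_of_subset_of_nonneg (Finset.subset_univ _) fun u _ _ => by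
              rw [Pi.single_apply]; split_ifs <;> norm_num
        _ = 1 := by simp
    have h3 : 0 ≤ ∑ u ∈ level r t, r u := Finset.sum_nonneg fun u _ => hr0 u
    have h4 : (1 - α) / 2 * G.flow r (level r t) ≤ α := by nlinarith
    by_contra! h5
    have h6 : 1 / 4 * κ < (1 - α) / 2 * G.flow r (level r t) := by nlinarith
    rw [hκdef] at h6
    linarith
  have hexp : ∀ t, θ ≤ t → (level r t).Nonempty → φ * (level r t).card ≤
      G.cut (level r t) (level r t)ᶜ := by
    intro x hx hxne
    rw [← G.edgeExp_mul_card hxne]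
    exact mul_le_mul_of_nonneg_right (hbest x hxne (hsmall x hx)).2 (Nat.cast_nonneg _)
  -- The descent divides by φ(S'); the bounds are immediate if it is zero.
  rcases hφ0.eq_or_lt with h0 | hφpos
  · rw [← h0]
    refine ⟨by rw [zero_mul]; positivity, fun k _ _ => by rw [zero_mul]; positivity⟩
  constructor
  · rcases hx0.eq_or_lt with h0 | hxpos
    · rw [← h0, mul_zero]; positivity
    have h1 := mul_vertexExp_le_of_height (G := G) hκ hφpos hxpos hx2 (δ := 0.01 / Λ) (by positivity)
      hflow hexp
      (fun x hx hxne => by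
        have h2 : 2 * (level r x).card ≤ Fintype.card V := by
          have := hsmall x hx
          have h3 : (2 : ℝ) * (level r x).card ≤ Fintype.card V := by linarith
          exact_mod_cast h3
        have h4 := G.graphVertexExp_le hxne h2
        unfold vertexExp at h4
        rwa [le_div_iff₀ (by exact_mod_cast hxne.card_pos)] at h4) hne hv
    have h2 : 6 * κ / (0.01 / Λ) = 240000 * (G.edgeExp S * Λ) := by
      rw [hκdef]; field_simp; norm_num
    have h3 : 0 < G.edgeExp S * Λ := by positivity
    linarith
  · intro k hk2 hkn
    rcases (G.kWayExp_nonneg k).eq_or_lt with h0 | hψ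
    · rw [← h0, mul_zero]; positivity
    have hk0 : (0 : ℝ) < k := by exact_mod_cast (by omega : 0 < k)
    have h1 := mul_kWayExp_le_of_height (G := G) hκ hφpos (by omega) hψ
      (G.kWayExp_le_one (by omega) hkn) (δ := 0.01 / Λ) (by positivity) hflow hexp hne hv
    have h2 : 36 * κ * k / (0.01 / Λ) = 1440000 * (k * G.edgeExp S * Λ) := by
      rw [hκdef]; field_simp; norm_num
    have h3 : 0 < k * G.edgeExp S * Λ := by positivity
    linarith

end WeightedGraph

/-! ## Updates of the memory -/

namespace Store

/-- Overwrite an integer register. -/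
def setI (σ : Store) (x y : ℕ) : Store := { σ with ireg := Function.update σ.ireg x y }

/-- Overwrite a real register. -/
def setR (σ : Store) (x : ℕ) (y : ℝ) : Store := { σ with rreg := Function.update σ.rreg x y }

/-- Overwrite an entry of an integer array. -/
def putI (σ : Store) (a i j y : ℕ) : Store := { σ with iarr := put σ.iarr a i j y }

/-- Overwrite an entry of a real array. -/
def putR (σ : Store) (a i j : ℕ) (y : ℝ) : Store := { σ with rarr := put σ.rarr a i j y }

variable (σ : Store) (a b i i' j j' x y z : ℕ) (t : ℝ)

@[simp] lemma setI_ireg : (σ.setI x y).ireg z = if z = x then y else σ.ireg z := by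
  simp [setI, Function.update_apply]
@[simp] lemma setI_rreg : (σ.setI x y).rreg = σ.rreg := rfl
@[simp] lemma setI_iarr : (σ.setI x y).iarr = σ.iarr := rfl
@[simp] lemma setI_rarr : (σ.setI x y).rarr = σ.rarr := rfl
@[simp] lemma setR_rreg : (σ.setR x t).rreg z = if z = x then t else σ.rreg z := by
  simp [setR, Function.update_apply]
@[simp] lemma setR_ireg : (σ.setR x t).ireg = σ.ireg := rfl
@[simp] lemma setR_iarr : (σ.setR x t).iarr = σ.iarr := rfl
@[simp] lemma setR_rarr : (σ.setR x t).rarr = σ.rarr := rfl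
@[simp] lemma putI_iarr : (σ.putI a i j y).iarr b i' j' =
    if b = a ∧ i' = i ∧ j' = j then y else σ.iarr b i' j' := rfl
@[simp] lemma putI_ireg : (σ.putI a i j y).ireg = σ.ireg := rfl
@[simp] lemma putI_rreg : (σ.putI a i j y).rreg = σ.rreg := rfl
@[simp] lemma putI_rarr : (σ.putI a i j y).rarr = σ.rarr := rfl
@[simp] lemma putR_rarr : (σ.putR a i j t).rarr b i' j' =
    if b = a ∧ i' = i ∧ j' = j then t else σ.rarr b i' j' := rfl
@[simp] lemma putR_ireg : (σ.putR a i j t).ireg = σ.ireg := rfl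
@[simp] lemma putR_rreg : (σ.putR a i j t).rreg = σ.rreg := rfl
@[simp] lemma putR_iarr : (σ.putR a i j t).iarr = σ.iarr := rfl

end Store

/-- Names of the registers and arrays that a program may change. -/
structure Footprint where
  ireg : List ℕ
  rreg : List ℕ
  iarr : List ℕ
  rarr : List ℕ

/-- `τ` agrees with `σ` outside of the footprint `M`. -/
structure Agree (M : Footprint) (σ τ : Store) : Prop where
  ireg : ∀ x, x ∉ M.ireg → τ.ireg x = σ.ireg x
  rreg : ∀ x, x ∉ M.rreg → τ.rreg x = σ.rreg x
  iarr : ∀ a, a ∉ M.iarr → ∀ i j, τ.iarr a i j = σ.iarr a i j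
  rarr : ∀ a, a ∉ M.rarr → ∀ i j, τ.rarr a i j = σ.rarr a i j

namespace Agree

variable {M : Footprint} {σ τ υ : Store}

lemma refl (M : Footprint) (σ : Store) : Agree M σ σ :=
  ⟨fun _ _ => rfl, fun _ _ => rfl, fun _ _ _ _ => rfl, fun _ _ _ _ => rfl⟩

lemma trans (h : Agree M σ τ) (h' : Agree M τ υ) : Agree M σ υ :=
  ⟨fun x hx => (h'.ireg x hx).trans (h.ireg x hx), fun x hx => (h'.rreg x hx).trans (h.rreg x hx),
    fun a ha i j => (h'.iarr a ha i j).trans (h.iarr a ha i j),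
    fun a ha i j => (h'.rarr a ha i j).trans (h.rarr a ha i j)⟩

lemma mono {M' : Footprint} (h : Agree M σ τ) (h1 : M.ireg ⊆ M'.ireg) (h2 : M.rreg ⊆ M'.rreg)
    (h3 : M.iarr ⊆ M'.iarr) (h4 : M.rarr ⊆ M'.rarr) : Agree M' σ τ :=
  ⟨fun x hx => h.ireg x fun h => hx (h1 h), fun x hx => h.rreg x fun h => hx (h2 h),
    fun a ha => h.iarr a fun h => ha (h3 h), fun a ha => h.rarr a fun h => ha (h4 h)⟩

lemma setI (h : Agree M σ τ) {x y : ℕ} (hx : x ∈ M.ireg) : Agree M σ (τ.setI x y) :=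
  ⟨fun z hz => by
    rw [Store.setI_ireg, if_neg (by rintro rfl; exact hz hx), h.ireg z hz], h.rreg, h.iarr, h.rarr⟩

lemma setR (h : Agree M σ τ) {x : ℕ} {y : ℝ} (hx : x ∈ M.rreg) : Agree M σ (τ.setR x y) :=
  ⟨h.ireg, fun z hz => by
    rw [Store.setR_rreg, if_neg (by rintro rfl; exact hz hx), h.rreg z hz], h.iarr, h.rarr⟩

lemma putI (h : Agree M σ τ) {a i j y : ℕ} (hx : a ∈ M.iarr) : Agree M σ (τ.putI a i j y) :=
  ⟨h.ireg, h.rreg, fun z hz i' j' => by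
    rw [Store.putI_iarr, if_neg (by rintro ⟨rfl, -⟩; exact hz hx), h.iarr z hz], h.rarr⟩

lemma putR (h : Agree M σ τ) {a i j : ℕ} {y : ℝ} (hx : a ∈ M.rarr) : Agree M σ (τ.putR a i j y) :=
  ⟨h.ireg, h.rreg, h.iarr, fun z hz i' j' => by
    rw [Store.putR_rarr, if_neg (by rintro ⟨rfl, -⟩; exact hz hx), h.rarr z hz]⟩

end Agree

/-! ## Total correctness with time bounds -/

/-- Started on `σ`, the program `p` halts within `T` steps on a memory that satisfies `Q`. -/
def Runs (p : Program) (σ : Store) (T : ℕ) (Q : Store → Prop) : Prop :=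
  ∃ t τ, Exec p σ t τ ∧ t ≤ T ∧ Q τ

namespace Runs

variable {p q : Program} {b : Test} {σ : Store} {T T' : ℕ} {Q Q' : Store → Prop}

lemma mono (h : Runs p σ T Q) (hT : T ≤ T') (hQ : ∀ τ, Q τ → Q' τ) : Runs p σ T' Q' := by
  obtain ⟨t, τ, h1, h2, h3⟩ := h
  exact ⟨t, τ, h1, h2.trans hT, hQ τ h3⟩

lemma skip (h : Q σ) : Runs .skip σ 1 Q := ⟨1, σ, .skip σ, le_rfl, h⟩

lemma setI {x : ℕ} {e : IExpr} (h : Q (σ.setI x (e.eval σ))) : Runs (.setI x e) σ 1 Q :=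
  ⟨1, _, .setI x e σ, le_rfl, h⟩

lemma setR {x : ℕ} {e : RExpr} (h : Q (σ.setR x (e.eval σ))) : Runs (.setR x e) σ 1 Q :=
  ⟨1, _, .setR x e σ, le_rfl, h⟩

lemma putI {a : ℕ} {i j e : IExpr} (h : Q (σ.putI a (i.eval σ) (j.eval σ) (e.eval σ))) :
    Runs (.putI a i j e) σ 1 Q :=
  ⟨1, _, .putI a i j e σ, le_rfl, h⟩

lemma putR {a : ℕ} {i j : IExpr} {e : RExpr}
    (h : Q (σ.putR a (i.eval σ) (j.eval σ) (e.eval σ))) : Runs (.putR a i j e) σ 1 Q :=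
  ⟨1, _, .putR a i j e σ, le_rfl, h⟩

lemma seq (h : Runs p σ T fun τ => Runs q τ T' Q) : Runs (.seq p q) σ (T + T') Q := by
  obtain ⟨t, τ, h1, h2, t', υ, h3, h4, h5⟩ := h
  exact ⟨t + t', υ, .seq h1 h3, add_le_add h2 h4, h5⟩

lemma ite (h : b.holds σ → Runs p σ T Q) (h' : ¬ b.holds σ → Runs q σ T Q) :
    Runs (.ite b p q) σ (T + 1) Q := by
  by_cases hb : b.holds σ
  · obtain ⟨t, τ, h1, h2, h3⟩ := h hb
    exact ⟨t + 1, τ, .ite_true hb h1, by omega, h3⟩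
  · obtain ⟨t, τ, h1, h2, h3⟩ := h' hb
    exact ⟨t + 1, τ, .ite_false hb h1, by omega, h3⟩

/-- Loops with an invariant `I` and a potential `f` that pays for the steps. -/
lemma loop (I : Store → Prop) (f : Store → ℕ)
    (h : ∀ σ, I σ → b.holds σ → ∃ T, Runs p σ T fun τ => I τ ∧ f τ + T + 1 ≤ f σ) (hσ : I σ) :
    Runs (.loop b p) σ (f σ + 1) fun τ => I τ ∧ ¬ b.holds τ := by
  induction hN : f σ using Nat.strong_induction_on generalizing σ with
  | _ N ih =>
  by_cases hb : b.holds σ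
  · obtain ⟨T, t, τ, h1, h2, h3, h4⟩ := h σ hσ hb
    obtain ⟨t', υ, h5, h6, h7⟩ := ih (f τ) (by omega) h3 rfl
    exact ⟨t + t' + 1, υ, .loop_true hb h1 h5, by omega, h7⟩
  · exact ⟨1, σ, .loop_false hb, by omega, hσ, hb⟩

end Runs

/-- `for x = 0, …, e - 1 do p`. -/
def Program.for (x : ℕ) (e : IExpr) (p : Program) : Program :=
  .seq (.setI x (.const 0))
    (.loop (.ltI (.reg x) e) (.seq p (.setI x (.add (.reg x) (.const 1)))))

/-- Counting loops: `I i` holds before the round with number `i`. -/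
lemma Runs.for {x : ℕ} {e : IExpr} {p : Program} {σ : Store} {T N : ℕ} (I : ℕ → Store → Prop)
    (h0 : I 0 (σ.setI x 0)) (hN : ∀ i τ, I i τ → e.eval τ = N) (hx : ∀ i τ, I i τ → τ.ireg x = i)
    (hstep : ∀ i < N, ∀ τ, I i τ →
      Runs p τ T fun υ => υ.ireg x = i ∧ I (i + 1) (υ.setI x (i + 1))) :
    Runs (.for x e p) σ (N * (T + 2) + 2) (I N) := by
  refine Runs.mono (Runs.seq (T := 1) (T' := N * (T + 2) + 1) (Runs.setI ?_)) (by omega)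
    fun τ h => h
  -- Each remaining round is paid for in advance: `T` steps for the body, one for the increment, one
  -- for the test.
  have key := Runs.loop (b := .ltI (.reg x) e) (p := .seq p (.setI x (.add (.reg x) (.const 1))))
    (σ := σ.setI x 0) (fun τ => ∃ i ≤ N, I i τ) (fun τ => (N - τ.ireg x) * (T + 2)) ?_
    ⟨0, Nat.zero_le _, h0⟩
  · refine key.mono ?_ ?_
    · simp
    · rintro τ ⟨⟨i, hi, hI⟩, hb⟩
      have h1 : ¬ τ.ireg x < e.eval τ := hb
      rw [hx i τ hI, hN i τ hI] at h1
      rwa [show i = N by omega] at hI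
  · rintro τ ⟨i, hi, hI⟩ hb
    have h1 : τ.ireg x < e.eval τ := hb
    rw [hx i τ hI, hN i τ hI] at h1
    refine ⟨T + 1, Runs.seq ((hstep i h1 τ hI).mono le_rfl ?_)⟩
    rintro υ ⟨h2, h3⟩
    refine Runs.setI ?_
    simp only [IExpr.eval, h2]
    refine ⟨⟨i + 1, h1, h3⟩, ?_⟩
    rw [hx i τ hI]
    simp only [Store.setI_ireg, if_true]
    obtain ⟨k, rfl⟩ : ∃ k, N = i + 1 + k := ⟨N - (i + 1), by omega⟩
    have e1 : i + 1 + k - (i + 1) = k := by omega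
    have e2 : i + 1 + k - i = k + 1 := by omega
    rw [e1, e2]
    ring_nf
    omega

lemma Runs.outputs {n : ℕ} {p : Program} {σ : Store} {T : ℕ} {X : ℝ} {S : Finset (Fin n)}
    (h : Runs p σ T fun τ => τ.Holds S) (hX : (T : ℝ) ≤ X) : p.Outputs σ X S := by
  obtain ⟨t, τ, h1, h2, h3⟩ := h
  exact ⟨t, τ, h1, le_trans (by exact_mod_cast h2) hX, h3⟩

/-! ## The parameters `α` and `L` -/

/-- `rreg 1 := min 1 (100 φ)`. -/
def alphaProgram : Program :=
  .ite (.ltR (.mul (.ofInt (.const 100)) (.reg 0)) (.ofInt (.const 1)))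
    (.setR 1 (.mul (.ofInt (.const 100)) (.reg 0))) (.setR 1 (.ofInt (.const 1)))

lemma alphaProgram_runs (σ : Store) :
    Runs alphaProgram σ 2 fun τ => τ = σ.setR 1 (min 1 (100 * σ.rreg 0)) := by
  refine Runs.ite (fun h => Runs.setR ?_) (fun h => Runs.setR ?_)
  · simp only [Test.holds, RExpr.eval, IExpr.eval] at h
    simp only [RExpr.eval, IExpr.eval]
    push_cast at *
    rw [min_eq_right h.le]
  · simp only [Test.holds, RExpr.eval, IExpr.eval] at h
    simp only [RExpr.eval, IExpr.eval]
    push_cast at *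
    rw [min_eq_left (not_lt.1 h)]

/-- A rational approximation of `log m` from below. -/
def logApprox (m : ℕ) : ℝ := ∑ i ∈ Finset.range (m - 1), 2 / (2 * (i : ℝ) + 3)

/-- The increment log(1 + 1/(j + 1)) lies between 2/(2j + 3) and 1/(j + 1), whose ratio is at most
3/2. The machine has no logarithm; with this substitute the size cap `3 * (m * logApprox m)` lies
between 2 m log m and 3 m log m. -/
lemma logApprox_bounds {m : ℕ} (hm : 1 ≤ m) :
    2 / 3 * Real.log m ≤ logApprox m ∧ logApprox m ≤ Real.log m := by
  induction m, hm using Nat.le_induction with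
  | base => simp [logApprox]
  | succ m hm ih =>
    obtain ⟨j, rfl⟩ : ∃ j, m = j + 1 := ⟨m - 1, by omega⟩
    have h1 : logApprox (j + 1 + 1) = logApprox (j + 1) + 2 / (2 * (j : ℝ) + 3) := by
      simp [logApprox, Finset.sum_range_succ]
    have hj : (0 : ℝ) ≤ j := Nat.cast_nonneg j
    have h2 : Real.log ((j + 1 + 1 : ℕ) : ℝ) = Real.log ((j + 1 : ℕ) : ℝ) +
        Real.log (1 + 1 / ((j : ℝ) + 1)) := by
      rw [← Real.log_mul (by positivity) (by positivity)]
      congr 1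
      push_cast
      field_simp
    have h3 : 2 / (2 * (j : ℝ) + 3) ≤ Real.log (1 + 1 / ((j : ℝ) + 1)) := by
      refine le_trans (le_of_eq ?_) (Real.le_log_one_add_of_nonneg (by positivity))
      field_simp
      ring
    have h4 : Real.log (1 + 1 / ((j : ℝ) + 1)) ≤ 1 / ((j : ℝ) + 1) := by
      have := Real.log_le_sub_one_of_pos (x := 1 + 1 / ((j : ℝ) + 1)) (by positivity)
      linarith
    have h5 : 2 / 3 * (1 / ((j : ℝ) + 1)) ≤ 2 / (2 * (j : ℝ) + 3) := by
      rw [div_mul_div_comm, div_le_div_iff₀ (by positivity) (by positivity)]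
      nlinarith
    rw [h1, h2]
    constructor <;> linarith [ih.1, ih.2]

/-- `rreg 2 := logApprox m`. -/
def logProgram : Program :=
  .seq (.setR 2 (.ofInt (.const 0)))
    (.for 3 (.sub (.reg 2) (.const 1))
      (.setR 2 (.add (.reg 2) (.div (.ofInt (.const 2))
        (.ofInt (.add (.add (.reg 3) (.reg 3)) (.const 3)))))))

lemma logProgram_runs (σ : Store) :
    Runs logProgram σ (3 * σ.ireg 2 + 3) fun τ =>
      Agree ⟨[3], [2], [], []⟩ σ τ ∧ τ.rreg 2 = logApprox (σ.ireg 2) := by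
  have key := Runs.for (x := 3) (e := .sub (.reg 2) (.const 1)) (T := 1) (N := σ.ireg 2 - 1)
    (p := .setR 2 (.add (.reg 2) (.div (.ofInt (.const 2))
        (.ofInt (.add (.add (.reg 3) (.reg 3)) (.const 3))))))
    (σ := σ.setR 2 ((0 : ℕ) : ℝ))
    (fun i τ => Agree ⟨[3], [2], [], []⟩ σ τ ∧ τ.ireg 3 = i ∧
      τ.rreg 2 = ∑ i ∈ Finset.range i, 2 / (2 * (i : ℝ) + 3)) ?_ ?_ ?_ ?_
  · refine (Runs.seq (T := 1) (Runs.setR key)).mono (by omega) fun τ h => ⟨h.1, h.2.2⟩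
  · refine ⟨((Agree.refl _ σ).setR (by simp)).setI (by simp), by simp, by simp⟩
  · rintro i τ ⟨h, -, -⟩
    simp [IExpr.eval, h.ireg 2 (by simp)]
  · rintro i τ ⟨-, h, -⟩; exact h
  · rintro i hi τ ⟨h1, h2, h3⟩
    refine Runs.setR ⟨by simpa using h2, (h1.setR (by simp)).setI (by simp), by simp, ?_⟩
    simp only [RExpr.eval, IExpr.eval, h2, h3, Store.setI_rreg, Store.setR_rreg, if_true,
      Finset.sum_range_succ]
    push_cast
    ring

/-! ## Solving substochastic systems by elimination -/

/-- Elimination of the variable `k` from the system `x i = A i n + ∑ j < n, A i j * x j`. -/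
def elimStep (n k : ℕ) (A : ℕ → ℕ → ℝ) : ℕ → ℕ → ℝ := fun i j =>
  if i < n ∧ j < n + 1 then
    if j = k then 0 else A i j + A i k * (1 / (1 - A k k)) * A k j
  else A i j

/-- The system `A` is substochastic, does not involve the first `k` variables on its right hand
side, and is solved by `x`. -/
structure ElimInvariant (n : ℕ) (x : ℕ → ℝ) (k : ℕ) (A : ℕ → ℕ → ℝ) : Prop where
  nonneg : ∀ i < n, ∀ j < n, 0 ≤ A i j
  eliminated : ∀ i < n, ∀ j < k, A i j = 0
  sum_lt_one : ∀ i < n, ∑ j ∈ Finset.range n, A i j < 1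
  solution : ∀ i < n, x i = A i n + ∑ j ∈ Finset.range n, A i j * x j

/-- Equation `k`, solved for `x k`, is substituted everywhere; for row `k` itself the same formula
amounts to division by `1 - A k k`. Row sums do not increase because row `k` sums to less than 1, so
later pivots stay positive. -/
lemma ElimInvariant.step {n k : ℕ} {x : ℕ → ℝ} {A : ℕ → ℕ → ℝ} (h : ElimInvariant n x k A)
    (hk : k < n) : ElimInvariant n x (k + 1) (elimStep n k A) := by
  have hkk : A k k < 1 := lt_of_le_of_lt
    (Finset.single_le_sum (f := fun j => A k j) (fun j hj => h.nonneg k hk j (Finset.mem_range.1 hj))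
      (Finset.mem_range.2 hk)) (h.sum_lt_one k hk)
  have hf : 0 < 1 - A k k := by linarith
  -- One identity for two uses: `y = 1` gives the row sums and `y = x` the solution property.
  have hstep : ∀ i < n, ∀ y : ℕ → ℝ, ∑ j ∈ Finset.range n, elimStep n k A i j * y j =
      ∑ j ∈ Finset.range n, A i j * y j +
        A i k * (1 / (1 - A k k)) * (∑ j ∈ Finset.range n, A k j * y j - y k) := by
    intro i hi y
    have h1 : ∀ j ∈ Finset.range n, elimStep n k A i j * y j =
        A i j * y j + A i k * (1 / (1 - A k k)) * (A k j * y j) -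
          if j = k then A i k * (1 / (1 - A k k)) * y k else 0 := by
      intro j hj
      rw [Finset.mem_range] at hj
      simp only [elimStep, hi, Nat.lt_succ_of_lt hj, and_self, if_true]
      split_ifs with hjk
      · subst hjk; field_simp; ring
      · ring
    rw [Finset.sum_congr rfl h1, Finset.sum_sub_distrib, Finset.sum_add_distrib, ← Finset.mul_sum,
      Finset.sum_ite_eq' (Finset.range n) k, if_pos (Finset.mem_range.2 hk)]
    ring
  refine ⟨fun i hi j hj => ?_, fun i hi j hj => ?_, fun i hi => ?_, fun i hi => ?_⟩
  · simp only [elimStep, hi, Nat.lt_succ_of_lt hj, and_self, if_true]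
    split_ifs
    · exact le_rfl
    · have h1 := h.nonneg i hi j hj
      have h2 := h.nonneg i hi k hk
      have h3 := h.nonneg k hk j hj
      positivity
  · have hjn : j < n + 1 := by omega
    simp only [elimStep, hi, hjn, and_self, if_true]
    split_ifs with hjk
    · rfl
    · rw [h.eliminated i hi j (by omega), h.eliminated k hk j (by omega)]; ring
  · have h1 := hstep i hi fun _ => 1
    simp only [mul_one] at h1
    have h2 : 0 ≤ A i k * (1 / (1 - A k k)) := mul_nonneg (h.nonneg i hi k hk) (by positivity)
    rw [h1]
    nlinarith [h.sum_lt_one i hi, h.sum_lt_one k hk]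
  · have hn : elimStep n k A i n = A i n + A i k * (1 / (1 - A k k)) * A k n := by
      simp only [elimStep, hi, Nat.lt_succ_self, and_self, if_true]
      rw [if_neg (by omega)]
    rw [hstep i hi x, hn]
    have h1 := h.solution i hi
    have h2 := h.solution k hk
    have h3 : ∑ j ∈ Finset.range n, A k j * x j - x k = -A k n := by linarith
    rw [h3]
    linarith

lemma ElimInvariant.value {n : ℕ} {x : ℕ → ℝ} {A : ℕ → ℕ → ℝ} (h : ElimInvariant n x n A) {i : ℕ}
    (hi : i < n) : A i n = x i := by
  rw [h.solution i hi, Finset.sum_eq_zero, add_zero]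
  intro j hj
  rw [h.eliminated i hi j (Finset.mem_range.1 hj), zero_mul]

/-! ## The elimination program -/

/-- Array 1 receives the system `x = β w x + γ χ_s`, with `β` in register 3 and `γ` in register 4;
the right hand side is stored in column `n`. -/
def initProgram : Program :=
  .seq (.for 4 (.reg 1) (.for 5 (.reg 1)
    (.putR 1 (.reg 4) (.reg 5) (.mul (.reg 3) (.get 0 (.reg 4) (.reg 5))))))
    (.putR 1 (.reg 0) (.reg 1) (.reg 4))

lemma initProgram_runs (σ : Store) (h0 : ∀ i j, σ.rarr 1 i j = 0) :
    Runs initProgram σ (σ.ireg 1 * (σ.ireg 1 * 3 + 4) + 3) fun τ =>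
      Agree ⟨[4, 5], [], [], [1]⟩ σ τ ∧ ∀ i j, τ.rarr 1 i j =
        if i = σ.ireg 0 ∧ j = σ.ireg 1 then σ.rreg 4
        else if i < σ.ireg 1 ∧ j < σ.ireg 1 then σ.rreg 3 * σ.rarr 0 i j else 0 := by
  set n := σ.ireg 1 with hn
  set M : Footprint := ⟨[4, 5], [], [], [1]⟩
  have key := Runs.for (x := 4) (e := .reg 1) (T := n * 3 + 2) (N := n) (σ := σ)
    (p := .for 5 (.reg 1)
      (.putR 1 (.reg 4) (.reg 5) (.mul (.reg 3) (.get 0 (.reg 4) (.reg 5)))))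
    (fun u τ => Agree M σ τ ∧ τ.ireg 4 = u ∧ ∀ i j, τ.rarr 1 i j =
      if i < u ∧ j < n then σ.rreg 3 * σ.rarr 0 i j else 0) ?_ ?_ ?_ ?_
  · refine (Runs.seq (T' := 1) (key.mono le_rfl ?_)).mono (T := n * (n * 3 + 2 + 2) + 2 + 1)
      (le_of_eq (by ring)) fun τ h => h
    rintro τ ⟨h1, h2, h3⟩
    refine Runs.putR ⟨h1.putR (by simp [M]), fun i j => ?_⟩
    have e0 := h1.ireg 0 (by simp [M])
    have e1 := h1.ireg 1 (by simp [M])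
    have e4 := h1.rreg 4 (by simp [M])
    simp only [IExpr.eval, RExpr.eval, Store.putR_rarr, true_and, e0, e1, e4, h3, ← hn]
  · exact ⟨(Agree.refl _ σ).setI (by simp [M]), by simp, by simp [h0]⟩
  · rintro i τ ⟨h, -, -⟩
    exact h.ireg 1 (by simp [M])
  · rintro i τ ⟨-, h, -⟩; exact h
  · rintro u hu τ ⟨h1, h2, h3⟩
    have key2 := Runs.for (x := 5) (e := .reg 1) (T := 1) (N := n) (σ := τ)
      (p := .putR 1 (.reg 4) (.reg 5) (.mul (.reg 3) (.get 0 (.reg 4) (.reg 5))))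
      (fun v υ => Agree M σ υ ∧ υ.ireg 4 = u ∧ υ.ireg 5 = v ∧ ∀ i j, υ.rarr 1 i j =
        if i < u ∧ j < n ∨ i = u ∧ j < v then σ.rreg 3 * σ.rarr 0 i j else 0) ?_ ?_ ?_ ?_
    · refine key2.mono le_rfl ?_
      rintro υ ⟨g1, g2, g3, g4⟩
      refine ⟨g2, g1.setI (by simp [M]), by simp, fun i j => ?_⟩
      rw [Store.setI_rarr, g4]
      congr 1
      simp only [eq_iff_iff]
      omega
    · exact ⟨h1.setI (by simp [M]), by simp [h2], by simp, by simp [h3]⟩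
    · rintro i υ ⟨h, -, -⟩
      exact h.ireg 1 (by simp [M])
    · rintro i υ ⟨-, -, h, -⟩; exact h
    · rintro v hv υ ⟨g1, g2, g3, g4⟩
      refine Runs.putR ⟨by simpa using g3, (g1.putR (by simp [M])).setI (by simp [M]),
        by simpa using g2, by simp, fun i j => ?_⟩
      have e3 := g1.rreg 3 (by simp [M])
      have e0 := g1.rarr 0 (by simp [M])
      simp only [IExpr.eval, RExpr.eval, Store.setI_rarr, Store.putR_rarr, true_and, g2, g3, e3, e0,
        g4]
      by_cases hij : i = u ∧ j = v
      · obtain ⟨rfl, rfl⟩ := hij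
        simp
      · rw [if_neg hij]
        congr 1
        simp only [eq_iff_iff]
        omega

/-- One elimination step; the index `k` is in register 3. -/
def elimProgram : Program :=
  .seq (.for 5 (.add (.reg 1) (.const 1)) (.putR 2 (.const 0) (.reg 5) (.get 1 (.reg 3) (.reg 5))))
  (.seq (.setR 3 (.div (.ofInt (.const 1)) (.sub (.ofInt (.const 1)) (.get 1 (.reg 3) (.reg 3)))))
  (.for 4 (.reg 1)
    (.seq (.setR 4 (.mul (.get 1 (.reg 4) (.reg 3)) (.reg 3)))
    (.seq (.for 5 (.add (.reg 1) (.const 1))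
      (.putR 1 (.reg 4) (.reg 5)
        (.add (.get 1 (.reg 4) (.reg 5)) (.mul (.reg 4) (.get 2 (.const 0) (.reg 5))))))
    (.putR 1 (.reg 4) (.reg 3) (.ofInt (.const 0)))))))

/-- Row `k` and the inverse pivot are saved first, since the outer loop also rewrites row `k`.
Column `k` is cleared after the inner loop, which fills it by the generic formula. -/
lemma elimProgram_runs (σ : Store) (hk : σ.ireg 3 < σ.ireg 1) :
    Runs elimProgram σ (20 * (σ.ireg 1 + 1) ^ 2) fun τ =>
      Agree ⟨[4, 5], [3, 4], [], [1, 2]⟩ σ τ ∧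
      τ.rarr 1 = elimStep (σ.ireg 1) (σ.ireg 3) (σ.rarr 1) := by
  set n := σ.ireg 1 with hn
  set k := σ.ireg 3 with hkdef
  set A := σ.rarr 1 with hA
  set M : Footprint := ⟨[4, 5], [3, 4], [], [1, 2]⟩
  have copy := Runs.for (x := 5) (e := .add (.reg 1) (.const 1)) (T := 1) (N := n + 1) (σ := σ)
    (p := .putR 2 (.const 0) (.reg 5) (.get 1 (.reg 3) (.reg 5)))
    (fun v τ => Agree M σ τ ∧ τ.ireg 5 = v ∧ (∀ i j, τ.rarr 1 i j = A i j) ∧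
      ∀ j < v, τ.rarr 2 0 j = A k j) ?_ ?_ ?_ ?_
  rotate_left
  · exact ⟨(Agree.refl _ σ).setI (by simp [M]), by simp, by simp [hA], by simp⟩
  · rintro i τ ⟨h, -⟩
    simp [IExpr.eval, h.ireg 1 (by simp [M]), hn]
  · rintro i τ ⟨-, h, -⟩; exact h
  · rintro v hv τ ⟨h1, h2, h3, h4⟩
    refine Runs.putR ⟨by simpa using h2, (h1.putR (by simp [M])).setI (by simp [M]), by simp,
      by simpa using h3, fun j hj => ?_⟩
    have e3 := h1.ireg 3 (by simp [M])
    simp only [IExpr.eval, RExpr.eval, Store.setI_rarr, Store.putR_rarr, true_and, h2, e3, h3]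
    split_ifs with hjv
    · rw [hjv]
    · exact h4 j (by omega)
  refine (Runs.seq (T' := 1 + (n * ((1 + (((n + 1) * 3 + 2) + 1)) + 2) + 2)) (copy.mono le_rfl ?_)).mono
    (by nlinarith) fun τ h => h
  rintro τ ⟨h1, h2, h3, h4⟩
  refine Runs.seq (Runs.setR ?_)
  set f := 1 / (1 - A k k) with hf
  have e3 := h1.ireg 3 (by simp [M])
  have hfe : (RExpr.div (.ofInt (.const 1)) (.sub (.ofInt (.const 1))
      (.get 1 (.reg 3) (.reg 3)))).eval τ = f := by
    simp [RExpr.eval, IExpr.eval, e3, h3, hf, hkdef]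
  rw [hfe]
  set σ' := τ.setR 3 f with hσ'
  have key := Runs.for (x := 4) (e := .reg 1) (T := 1 + (((n + 1) * 3 + 2) + 1)) (N := n) (σ := σ')
    (p := .seq (.setR 4 (.mul (.get 1 (.reg 4) (.reg 3)) (.reg 3)))
      (.seq (.for 5 (.add (.reg 1) (.const 1))
        (.putR 1 (.reg 4) (.reg 5)
          (.add (.get 1 (.reg 4) (.reg 5)) (.mul (.reg 4) (.get 2 (.const 0) (.reg 5))))))
      (.putR 1 (.reg 4) (.reg 3) (.ofInt (.const 0)))))
    (fun u υ => Agree M σ υ ∧ υ.ireg 4 = u ∧ υ.rreg 3 = f ∧ (∀ j < n + 1, υ.rarr 2 0 j = A k j) ∧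
      ∀ i j, υ.rarr 1 i j = if i < u then elimStep n k A i j else A i j) ?_ ?_ ?_ ?_
  · refine key.mono le_rfl ?_
    rintro υ ⟨g1, -, -, -, g2⟩
    refine ⟨g1, funext fun i => funext fun j => ?_⟩
    rw [g2]
    split_ifs with hi
    · rfl
    · rw [elimStep, if_neg (fun h => hi h.1)]
  · exact ⟨(h1.setR (by simp [M])).setI (by simp [M]), by simp, by simp [hσ'],
      by simpa [hσ'] using h4, by simpa [hσ'] using h3⟩
  · rintro i υ ⟨h, -⟩
    exact h.ireg 1 (by simp [M])
  · rintro i υ ⟨-, h, -⟩; exact h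
  · rintro u hu υ ⟨g1, g2, g3, g4, g5⟩
    have d3 := g1.ireg 3 (by simp [M])
    refine Runs.seq (Runs.setR ?_)
    have hge : (RExpr.mul (.get 1 (.reg 4) (.reg 3)) (.reg 3)).eval υ = A u k * f := by
      simp [RExpr.eval, IExpr.eval, d3, g2, g3, g5, hkdef]
    rw [hge]
    have row := Runs.for (x := 5) (e := .add (.reg 1) (.const 1)) (T := 1) (N := n + 1)
      (σ := υ.setR 4 (A u k * f))
      (p := .putR 1 (.reg 4) (.reg 5)
        (.add (.get 1 (.reg 4) (.reg 5)) (.mul (.reg 4) (.get 2 (.const 0) (.reg 5)))))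
      (fun v ω => Agree M σ ω ∧ ω.ireg 5 = v ∧ ω.ireg 4 = u ∧ ω.rreg 3 = f ∧ ω.rreg 4 = A u k * f ∧
        (∀ j < n + 1, ω.rarr 2 0 j = A k j) ∧
        ∀ i j, ω.rarr 1 i j = if i < u then elimStep n k A i j else
          if i = u ∧ j < v then A i j + A u k * f * A k j else A i j) ?_ ?_ ?_ ?_
    · refine Runs.seq (row.mono le_rfl ?_)
      rintro ω ⟨b1, b2, b3, b4, b5, b6, b7⟩
      refine Runs.putR ⟨by simpa using b3, (b1.putR (by simp [M])).setI (by simp [M]), by simp,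
        by simpa using b4, by simpa using b6, fun i j => ?_⟩
      have c3 := b1.ireg 3 (by simp [M])
      simp only [RExpr.eval, IExpr.eval, Store.setI_rarr, Store.putR_rarr, true_and, b3, c3, b7,
        ← hkdef]
      rcases lt_trichotomy i u with hi | rfl | hi
      · rw [if_neg (by omega), if_pos hi, if_pos (by omega)]
      · simp only [true_and, lt_irrefl, if_false, Nat.lt_succ_self, if_true, elimStep, hu,
          Nat.cast_zero]
        by_cases hj : j < n + 1
        · simp only [hj, if_true, hf]
        · have : j ≠ k := by omega
          simp only [hj, if_false, this]
      · rw [if_neg (by omega), if_neg (by omega), if_neg (by omega), if_neg (by omega)]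
    · exact ⟨(g1.setR (by simp [M])).setI (by simp [M]), by simp, by simpa using g2,
        by simpa using g3, by simp, by simpa using g4, by simpa using g5⟩
    · rintro i ω ⟨h, -⟩
      simp [IExpr.eval, h.ireg 1 (by simp [M]), hn]
    · rintro i ω ⟨-, h, -⟩; exact h
    · rintro v hv ω ⟨b1, b2, b3, b4, b5, b6, b7⟩
      refine Runs.putR ⟨by simpa using b2, (b1.putR (by simp [M])).setI (by simp [M]), by simp,
        by simpa using b3, by simpa using b4, by simpa using b5, by simpa using b6, fun i j => ?_⟩
      simp only [RExpr.eval, IExpr.eval, Store.setI_rarr, Store.putR_rarr, true_and, b2, b3, b5, b7,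
        b6 v hv, lt_irrefl, if_false, and_false]
      rcases lt_trichotomy i u with hi | rfl | hi
      · rw [if_neg (by omega), if_pos hi, if_pos hi]
      · simp only [true_and, lt_irrefl, if_false]
        rcases lt_trichotomy j v with hj | rfl | hj
        · rw [if_neg (by omega), if_pos hj, if_pos (by omega)]
        · simp
        · rw [if_neg (by omega), if_neg (by omega), if_neg (by omega)]
      · rw [if_neg (by omega), if_neg (by omega), if_neg (by omega), if_neg (by omega),
          if_neg (by omega)]

/-- Solves the linear system in array 1. -/
def solveProgram : Program := .for 3 (.reg 1) elimProgram

lemma solveProgram_runs (σ : Store) {x : ℕ → ℝ} (h : ElimInvariant (σ.ireg 1) x 0 (σ.rarr 1)) :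
    Runs solveProgram σ (25 * (σ.ireg 1 + 1) ^ 3) fun τ =>
      Agree ⟨[3, 4, 5], [3, 4], [], [1, 2]⟩ σ τ ∧ ∀ i < σ.ireg 1, τ.rarr 1 i (σ.ireg 1) = x i := by
  set n := σ.ireg 1 with hn
  set M : Footprint := ⟨[3, 4, 5], [3, 4], [], [1, 2]⟩
  have key := Runs.for (x := 3) (e := .reg 1) (T := 20 * (n + 1) ^ 2) (N := n) (σ := σ)
    (p := elimProgram)
    (fun k τ => Agree M σ τ ∧ τ.ireg 3 = k ∧ ElimInvariant n x k (τ.rarr 1)) ?_ ?_ ?_ ?_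
  · refine key.mono (by nlinarith [sq_nonneg n]) ?_
    rintro τ ⟨h1, -, h2⟩
    exact ⟨h1, fun i hi => h2.value hi⟩
  · exact ⟨(Agree.refl _ σ).setI (by simp [M]), by simp, h⟩
  · rintro i τ ⟨h, -⟩
    exact h.ireg 1 (by simp [M])
  · rintro i τ ⟨-, h, -⟩; exact h
  · rintro k hk τ ⟨h1, h2, h3⟩
    have e1 : τ.ireg 1 = n := h1.ireg 1 (by simp [M])
    refine (elimProgram_runs τ (by rw [h2, e1]; exact hk)).mono (by rw [e1]) ?_
    rintro υ ⟨g1, g2⟩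
    refine ⟨(g1.ireg 3 (by simp)).trans h2, (h1.trans (g1.mono ?_ ?_ ?_ ?_)).setI (by simp [M]),
      by simp, ?_⟩
    any_goals simp [M]
    rw [g2, h2, e1]
    exact h3.step hk

/-! ## Searching for the best candidate -/

/-- `v` is the least value among the admissible candidates with number below `k`, attained at a
candidate with the property `P`; the flag `b` is zero if there is no admissible candidate. -/
def BestBelow (adm : ℕ → Prop) (val : ℕ → ℝ) (k b : ℕ) (v : ℝ) (P : ℕ → Prop) : Prop :=
  (b = 0 ∧ ∀ j < k, ¬ adm j) ∨
    (b ≠ 0 ∧ ∃ j < k, adm j ∧ P j ∧ v = val j ∧ ∀ i < k, adm i → val j ≤ val i)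

namespace BestBelow

variable {adm : ℕ → Prop} {val : ℕ → ℝ} {k b b' : ℕ} {v : ℝ} {P P' : ℕ → Prop}

lemma zero : BestBelow adm val 0 0 v P := Or.inl ⟨rfl, fun _ hj => absurd hj (Nat.not_lt_zero _)⟩

lemma keep (h : BestBelow adm val k b v P) (hk : ¬ (adm k ∧ (b = 0 ∨ val k < v))) :
    BestBelow adm val (k + 1) b v P := by
  push Not at hk
  rcases h with ⟨h1, h2⟩ | ⟨h1, j, hj, h2, h3, h4, h5⟩
  · refine Or.inl ⟨h1, fun j hj hadm => ?_⟩
    rcases Nat.lt_succ_iff_lt_or_eq.1 hj with hj | rfl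
    · exact h2 j hj hadm
    · exact (hk hadm).1 h1
  · refine Or.inr ⟨h1, j, by omega, h2, h3, h4, fun i hi hadm => ?_⟩
    rcases Nat.lt_succ_iff_lt_or_eq.1 hi with hi | rfl
    · exact h5 i hi hadm
    · exact h4 ▸ (hk hadm).2

lemma replace (h : BestBelow adm val k b v P) (hk : adm k) (hkv : b = 0 ∨ val k < v) (hP : P' k)
    (hb' : b' ≠ 0) : BestBelow adm val (k + 1) b' (val k) P' := by
  refine Or.inr ⟨hb', k, Nat.lt_succ_self k, hk, hP, rfl, fun i hi hadm => ?_⟩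
  rcases Nat.lt_succ_iff_lt_or_eq.1 hi with hi | rfl
  · rcases h with ⟨h1, h2⟩ | ⟨h1, j, hj, h2, h3, h4, h5⟩
    · exact absurd hadm (h2 i hi)
    · have := h5 i hi hadm
      have := hkv.resolve_left h1
      linarith
  · exact le_rfl

end BestBelow

/-! ## Level sets of vectors that are indexed by natural numbers -/

/-- Size of the level set of `ρ` at height `x`. -/
def levelSize (n : ℕ) (ρ : ℕ → ℝ) (x : ℝ) : ℕ := ((Finset.range n).filter fun i => x ≤ ρ i).card

/-- Boundary of the level set of `ρ` at height `x`. -/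
def levelCut (n : ℕ) (w : ℕ → ℕ → ℝ) (ρ : ℕ → ℝ) (x : ℝ) : ℝ :=
  ∑ u ∈ Finset.range n, if x ≤ ρ u then
    ∑ v ∈ Finset.range n, if ρ v < x then w u v else 0 else 0

/-- Computes the size (register 6) and the boundary (real register 8) of the level set at the
height in real register 7. -/
def measureProgram : Program :=
  .seq (.setI 6 (.const 0)) (.seq (.setR 8 (.ofInt (.const 0)))
    (.for 4 (.reg 1)
      (.ite (.neg (.ltR (.get 1 (.reg 4) (.reg 1)) (.reg 7)))
        (.seq (.setI 6 (.add (.reg 6) (.const 1)))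
          (.for 5 (.reg 1)
            (.ite (.ltR (.get 1 (.reg 5) (.reg 1)) (.reg 7))
              (.setR 8 (.add (.reg 8) (.get 0 (.reg 4) (.reg 5)))) .skip)))
        .skip)))

lemma measureProgram_runs (σ : Store) {n : ℕ} (hn : σ.ireg 1 = n) {ρ : ℕ → ℝ}
    (hρ : ∀ i < n, σ.rarr 1 i n = ρ i) :
    Runs measureProgram σ (4 + n * (4 * n + 6)) fun τ =>
      Agree ⟨[4, 5, 6], [8], [], []⟩ σ τ ∧ τ.ireg 6 = levelSize n ρ (σ.rreg 7) ∧
      τ.rreg 8 = levelCut n (σ.rarr 0) ρ (σ.rreg 7) := by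
  set x := σ.rreg 7 with hx
  set M : Footprint := ⟨[4, 5, 6], [8], [], []⟩
  have key := Runs.for (x := 4) (e := .reg 1) (T := 4 * n + 4) (N := n)
    (σ := (σ.setI 6 0).setR 8 ((0 : ℕ) : ℝ))
    (p := .ite (.neg (.ltR (.get 1 (.reg 4) (.reg 1)) (.reg 7)))
        (.seq (.setI 6 (.add (.reg 6) (.const 1)))
          (.for 5 (.reg 1)
            (.ite (.ltR (.get 1 (.reg 5) (.reg 1)) (.reg 7))
              (.setR 8 (.add (.reg 8) (.get 0 (.reg 4) (.reg 5)))) .skip)))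
        .skip)
    (fun u τ => Agree M σ τ ∧ τ.ireg 4 = u ∧
      τ.ireg 6 = ((Finset.range u).filter fun i => x ≤ ρ i).card ∧
      τ.rreg 8 = ∑ u ∈ Finset.range u, if x ≤ ρ u then
        ∑ v ∈ Finset.range n, if ρ v < x then σ.rarr 0 u v else 0 else 0) ?_ ?_ ?_ ?_
  · refine (Runs.seq (T := 1) (Runs.setI (Runs.seq (T := 1) (Runs.setR key)))).mono ?_ ?_
    · ring_nf; omega
    · rintro τ ⟨h1, h2, h3, h4⟩; exact ⟨h1, h3, h4⟩
  · exact ⟨(((Agree.refl _ σ).setI (by simp [M])).setR (by simp [M])).setI (by simp [M]),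
      by simp, by simp, by simp⟩
  · rintro i τ ⟨h, -⟩
    exact (h.ireg 1 (by simp [M])).trans hn
  · rintro i τ ⟨-, h, -⟩; exact h
  rintro u hu τ ⟨h1, h2, h3, h4⟩
  have e1 : τ.ireg 1 = n := (h1.ireg 1 (by simp [M])).trans hn
  have e7 : τ.rreg 7 = x := h1.rreg 7 (by simp [M])
  have eρ : τ.rarr 1 u n = ρ u := (h1.rarr 1 (by simp [M]) u n).trans (hρ u hu)
  have hb : (Test.neg (.ltR (.get 1 (.reg 4) (.reg 1)) (.reg 7))).holds τ ↔ x ≤ ρ u := by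
    simp [Test.holds, RExpr.eval, IExpr.eval, e1, e7, h2, eρ]
  refine (Runs.ite (T := 1 + (n * (2 + 2) + 2)) (fun hh => ?_) (fun hh => ?_)).mono (by omega)
    fun τ h => h
  · rw [hb] at hh
    refine Runs.seq (Runs.setI ?_)
    have he : (IExpr.add (.reg 6) (.const 1)).eval τ =
        ((Finset.range u).filter fun i => x ≤ ρ i).card + 1 := by simp [IExpr.eval, h3]
    rw [he]
    set B := ∑ u ∈ Finset.range u, if x ≤ ρ u then
        ∑ v ∈ Finset.range n, if ρ v < x then σ.rarr 0 u v else 0 else 0 with hB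
    have row := Runs.for (x := 5) (e := .reg 1) (T := 2) (N := n)
      (σ := τ.setI 6 (((Finset.range u).filter fun i => x ≤ ρ i).card + 1))
      (p := .ite (.ltR (.get 1 (.reg 5) (.reg 1)) (.reg 7))
              (.setR 8 (.add (.reg 8) (.get 0 (.reg 4) (.reg 5)))) .skip)
      (fun v υ => Agree M σ υ ∧ υ.ireg 4 = u ∧ υ.ireg 5 = v ∧
        υ.ireg 6 = ((Finset.range u).filter fun i => x ≤ ρ i).card + 1 ∧
        υ.rreg 8 = B + ∑ v ∈ Finset.range v, if ρ v < x then σ.rarr 0 u v else 0) ?_ ?_ ?_ ?_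
    · refine row.mono le_rfl ?_
      rintro υ ⟨g1, g2, g3, g4, g5⟩
      refine ⟨g2, g1.setI (by simp [M]), by simp, ?_, ?_⟩
      · rw [Finset.range_add_one, Finset.filter_insert, if_pos hh, Finset.card_insert_of_notMem
          (by simp)]
        simpa using g4
      · rw [Finset.sum_range_succ, if_pos hh, ← hB]
        simpa using g5
    · exact ⟨(h1.setI (by simp [M])).setI (by simp [M]), by simpa using h2, by simp, by simp,
        by simpa using h4⟩
    · rintro i υ ⟨h, -⟩
      exact (h.ireg 1 (by simp [M])).trans hn
    · rintro i υ ⟨-, -, h, -⟩; exact h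
    · rintro v hv υ ⟨g1, g2, g3, g4, g5⟩
      have d1 : υ.ireg 1 = n := (g1.ireg 1 (by simp [M])).trans hn
      have d7 : υ.rreg 7 = x := g1.rreg 7 (by simp [M])
      have dρ : υ.rarr 1 v n = ρ v := (g1.rarr 1 (by simp [M]) v n).trans (hρ v hv)
      have d0 := g1.rarr 0 (by simp [M])
      have hb' : (Test.ltR (.get 1 (.reg 5) (.reg 1)) (.reg 7)).holds υ ↔ ρ v < x := by
        simp [Test.holds, RExpr.eval, IExpr.eval, d1, d7, g3, dρ]
      refine Runs.ite (fun hc => Runs.setR ?_) (fun hc => Runs.skip ?_)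
      · rw [hb'] at hc
        refine ⟨by simpa using g3, (g1.setR (by simp [M])).setI (by simp [M]), by simpa using g2,
          by simp, by simpa using g4, ?_⟩
        simp only [Store.setI_rreg, Store.setR_rreg, if_true, RExpr.eval, IExpr.eval, g2, g3, g5, d0,
          Finset.sum_range_succ, hc]
        ring
      · rw [hb'] at hc
        refine ⟨g3, g1.setI (by simp [M]), by simpa using g2, by simp, by simpa using g4, ?_⟩
        simp only [Store.setI_rreg, g5, Finset.sum_range_succ, hc, if_false, add_zero]
  · rw [hb] at hh
    refine (Runs.skip (Q := _) ?_).mono (by omega) fun τ h => h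
    refine ⟨h2, h1.setI (by simp [M]), by simp, ?_, ?_⟩
    · rw [Finset.range_add_one, Finset.filter_insert, if_neg hh]
      simpa using h3
    · rw [Finset.sum_range_succ, if_neg hh, add_zero]
      simpa using h4

/-- The test whether the current candidate is admissible and better than the best one so far. -/
def betterTest (cap : Test) : Test :=
  .and cap (.and (.neg (.ltR (.mul (.ofInt (.const 3)) (.mul (.ofInt (.reg 2)) (.reg 2)))
      (.ofInt (.reg 6))))
    (.neg (.and (.neg (.eqI (.reg 7) (.const 0)))
      (.neg (.ltR (.div (.reg 8) (.ofInt (.reg 6))) (.reg 5))))))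

/-- Real register 2 holds the approximate logarithm, and register 7 is zero until some candidate has
been accepted. The extra test `cap` carries the condition that depends on the number of vertices;
the local algorithm uses a trivial one. -/
lemma betterTest_holds (cap : Test) (σ : Store) : (betterTest cap).holds σ ↔
    cap.holds σ ∧ (σ.ireg 6 : ℝ) ≤ 3 * (σ.ireg 2 * σ.rreg 2) ∧
      (σ.ireg 7 = 0 ∨ σ.rreg 8 / σ.ireg 6 < σ.rreg 5) := by
  simp only [betterTest, Test.holds, RExpr.eval, IExpr.eval, not_and_or, not_not, not_lt]
  push_cast
  rw [not_le]

/-- Finds the best admissible level set; its height is stored in real register 6. -/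
def sweepProgram : Program :=
  .for 3 (.reg 1) (.seq (.setR 7 (.get 1 (.reg 3) (.reg 1))) (.seq measureProgram
    (.ite (betterTest (.neg (.ltI (.reg 1) (.add (.reg 6) (.reg 6)))))
      (.seq (.setI 7 (.const 1)) (.seq (.setR 5 (.div (.reg 8) (.ofInt (.reg 6))))
        (.setR 6 (.reg 7)))) .skip)))

lemma sweepProgram_runs (σ : Store) {n : ℕ} (hn : σ.ireg 1 = n) {ρ : ℕ → ℝ}
    (hρ : ∀ i < n, σ.rarr 1 i n = ρ i) (h7 : σ.ireg 7 = 0) :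
    Runs sweepProgram σ (20 * (n + 1) ^ 3) fun τ =>
      Agree ⟨[3, 4, 5, 6, 7], [5, 6, 7, 8], [], []⟩ σ τ ∧
      BestBelow
        (fun j => 2 * levelSize n ρ (ρ j) ≤ n ∧
          (levelSize n ρ (ρ j) : ℝ) ≤ 3 * (σ.ireg 2 * σ.rreg 2))
        (fun j => levelCut n (σ.rarr 0) ρ (ρ j) / levelSize n ρ (ρ j)) n (τ.ireg 7) (τ.rreg 5)
        (fun j => τ.rreg 6 = ρ j) := by
  set M : Footprint := ⟨[3, 4, 5, 6, 7], [5, 6, 7, 8], [], []⟩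
  set adm : ℕ → Prop := fun j => 2 * levelSize n ρ (ρ j) ≤ n ∧
          (levelSize n ρ (ρ j) : ℝ) ≤ 3 * (σ.ireg 2 * σ.rreg 2) with hadm
  set val : ℕ → ℝ := fun j => levelCut n (σ.rarr 0) ρ (ρ j) / levelSize n ρ (ρ j) with hval
  have key := Runs.for (x := 3) (e := .reg 1) (T := 1 + (4 + n * (4 * n + 6) + (3 + 1))) (N := n)
    (σ := σ)
    (p := .seq (.setR 7 (.get 1 (.reg 3) (.reg 1))) (.seq measureProgram
    (.ite (betterTest (.neg (.ltI (.reg 1) (.add (.reg 6) (.reg 6)))))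
      (.seq (.setI 7 (.const 1)) (.seq (.setR 5 (.div (.reg 8) (.ofInt (.reg 6))))
        (.setR 6 (.reg 7)))) .skip)))
    (fun k τ => Agree M σ τ ∧ τ.ireg 3 = k ∧
      BestBelow adm val k (τ.ireg 7) (τ.rreg 5) (fun j => τ.rreg 6 = ρ j)) ?_ ?_ ?_ ?_
  · refine key.mono (by nlinarith [sq_nonneg n]) ?_
    rintro τ ⟨h1, -, h2⟩
    exact ⟨h1, h2⟩
  · refine ⟨(Agree.refl _ σ).setI (by simp [M]), by simp, ?_⟩
    simp only [Store.setI_ireg, h7]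
    exact BestBelow.zero
  · rintro i τ ⟨h, -⟩
    exact (h.ireg 1 (by simp [M])).trans hn
  · rintro i τ ⟨-, h, -⟩; exact h
  rintro k hk τ ⟨h1, h2, h3⟩
  have e1 : τ.ireg 1 = n := (h1.ireg 1 (by simp [M])).trans hn
  have eρ : ∀ i < n, τ.rarr 1 i n = ρ i := fun i hi =>
    (h1.rarr 1 (by simp [M]) i n).trans (hρ i hi)
  refine Runs.seq (Runs.setR (Runs.seq ?_))
  have hx : (RExpr.get 1 (.reg 3) (.reg 1)).eval τ = ρ k := by
    simp [RExpr.eval, IExpr.eval, e1, h2, eρ k hk]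
  rw [hx]
  refine (measureProgram_runs (τ.setR 7 (ρ k)) (n := n) (ρ := ρ) e1 eρ).mono le_rfl ?_
  rintro υ ⟨g1, g2, g3⟩
  have hsame : τ.rarr 0 = σ.rarr 0 := funext fun i => funext fun j => h1.rarr 0 (by simp [M]) i j
  simp only [Store.setR_rreg, if_true, Store.setR_rarr, hsame] at g2 g3
  have d1 : υ.ireg 1 = n := (g1.ireg 1 (by simp)).trans e1
  have d2 : υ.ireg 2 = σ.ireg 2 := (g1.ireg 2 (by simp)).trans (h1.ireg 2 (by simp [M]))
  have d2r : υ.rreg 2 = σ.rreg 2 := (g1.rreg 2 (by simp)).trans (by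
    simpa using h1.rreg 2 (by simp [M]))
  have d3 : υ.ireg 3 = k := (g1.ireg 3 (by simp)).trans h2
  have d7 : υ.ireg 7 = τ.ireg 7 := g1.ireg 7 (by simp)
  have d5 : υ.rreg 5 = τ.rreg 5 := (g1.rreg 5 (by simp)).trans (by simp)
  have d6 : υ.rreg 6 = τ.rreg 6 := (g1.rreg 6 (by simp)).trans (by simp)
  have d7r : υ.rreg 7 = ρ k := (g1.rreg 7 (by simp)).trans (by simp)
  have hag : Agree M σ υ := by
    refine (h1.setR (y := ρ k) (by simp [M])).trans (g1.mono ?_ ?_ ?_ ?_) <;> simp [M]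
  have htest : (betterTest (.neg (.ltI (.reg 1) (.add (.reg 6) (.reg 6))))).holds υ ↔
      adm k ∧ (τ.ireg 7 = 0 ∨ val k < τ.rreg 5) := by
    rw [betterTest_holds]
    simp only [Test.holds, IExpr.eval, d1, d2, d2r, d7, d5, g2, g3, hadm, hval, not_lt, two_mul,
      and_assoc]
  refine Runs.ite (fun hh => ?_) (fun hh => ?_)
  · rw [htest] at hh
    refine Runs.seq (T := 1) (T' := 2) (Runs.setI (Runs.seq (T := 1) (T' := 1) (Runs.setR
      (Runs.setR ⟨?_, ?_, ?_, ?_⟩))))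
    · simpa using d3
    · exact (((hag.setI (by simp [M])).setR (by simp [M])).setR (by simp [M])).setI (by simp [M])
    · simp
    · have := h3.replace (P' := fun j => ρ k = ρ j) (b' := 1) hh.1 hh.2 rfl one_ne_zero
      simpa [IExpr.eval, RExpr.eval, g2, g3, d7r] using this
  · rw [htest] at hh
    refine (Runs.skip ⟨d3, hag.setI (by simp [M]), by simp, ?_⟩).mono (by norm_num) fun τ h => h
    have := h3.keep hh
    simpa [d7, d5, d6] using this

lemma image_range_succ {f g : ℕ → ℕ} {l x : ℕ} {A : Finset ℕ} (h : (Finset.range l).image f = A)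
    (hg : ∀ j < l, g j = f j) (hx : g l = x) : (Finset.range (l + 1)).image g = insert x A := by
  rw [Finset.range_add_one, Finset.image_insert, hx, ← h]
  congr 1
  exact Finset.image_congr fun j hj => hg j (Finset.mem_range.1 (Finset.mem_coe.1 hj))

/-- Lists the level set at the height in real register 6. -/
def listProgram : Program :=
  .seq (.setI 0 (.const 0)) (.ite (.eqI (.reg 7) (.const 0)) .skip
    (.for 4 (.reg 1) (.ite (.neg (.ltR (.get 1 (.reg 4) (.reg 1)) (.reg 6)))
      (.seq (.putI 1 (.const 0) (.reg 0) (.reg 4)) (.setI 0 (.add (.reg 0) (.const 1)))) .skip)))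

lemma listProgram_runs (σ : Store) {n : ℕ} (hn : σ.ireg 1 = n) {ρ : ℕ → ℝ}
    (hρ : ∀ i < n, σ.rarr 1 i n = ρ i) :
    Runs listProgram σ (5 * n + 4) fun τ =>
      τ.ireg 0 = (if σ.ireg 7 = 0 then 0 else levelSize n ρ (σ.rreg 6)) ∧
      (Finset.range (τ.ireg 0)).image (τ.iarr 1 0) =
        if σ.ireg 7 = 0 then ∅ else (Finset.range n).filter fun i => σ.rreg 6 ≤ ρ i := by
  set x := σ.rreg 6 with hx
  set M : Footprint := ⟨[0, 4], [], [1], []⟩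
  refine (Runs.seq (T := 1) (T' := n * (3 + 2) + 2 + 1) (Runs.setI (Runs.ite (fun h => ?_)
    (fun h => ?_)))).mono (by omega) fun τ h => h
  · have h7 : σ.ireg 7 = 0 := by simpa [Test.holds, IExpr.eval] using h
    refine (Runs.skip ?_).mono (by omega) fun τ h => h
    simp [IExpr.eval, h7]
  have h7 : σ.ireg 7 ≠ 0 := by simpa [Test.holds, IExpr.eval] using h
  have key := Runs.for (x := 4) (e := .reg 1) (T := 3) (N := n) (σ := σ.setI 0 0)
    (p := .ite (.neg (.ltR (.get 1 (.reg 4) (.reg 1)) (.reg 6)))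
      (.seq (.putI 1 (.const 0) (.reg 0) (.reg 4)) (.setI 0 (.add (.reg 0) (.const 1)))) .skip)
    (fun u τ => Agree M σ τ ∧ τ.ireg 4 = u ∧
      τ.ireg 0 = ((Finset.range u).filter fun i => x ≤ ρ i).card ∧
      (Finset.range (τ.ireg 0)).image (τ.iarr 1 0) = (Finset.range u).filter fun i => x ≤ ρ i)
    ?_ ?_ ?_ ?_
  · refine key.mono le_rfl ?_
    rintro τ ⟨-, -, h1, h2⟩
    rw [if_neg h7, if_neg h7]
    exact ⟨h1, h2⟩
  · exact ⟨((Agree.refl _ σ).setI (by simp [M])).setI (by simp [M]), by simp, by simp, by simp⟩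
  · rintro i τ ⟨h, -⟩
    exact (h.ireg 1 (by simp [M])).trans hn
  · rintro i τ ⟨-, h, -⟩; exact h
  rintro u hu τ ⟨h1, h2, h3, h4⟩
  have e1 : τ.ireg 1 = n := (h1.ireg 1 (by simp [M])).trans hn
  have e6 : τ.rreg 6 = x := h1.rreg 6 (by simp [M])
  have eρ : τ.rarr 1 u n = ρ u := (h1.rarr 1 (by simp [M]) u n).trans (hρ u hu)
  have hb : (Test.neg (.ltR (.get 1 (.reg 4) (.reg 1)) (.reg 6))).holds τ ↔ x ≤ ρ u := by
    simp [Test.holds, RExpr.eval, IExpr.eval, e1, e6, h2, eρ]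
  refine Runs.ite (fun hh => ?_) (fun hh => ?_)
  · rw [hb] at hh
    refine Runs.seq (T := 1) (T' := 1) (Runs.putI (Runs.setI ⟨by simpa using h2,
      ((h1.putI (by simp [M])).setI (by simp [M])).setI (by simp [M]), by simp, ?_, ?_⟩))
    · rw [Finset.range_add_one, Finset.filter_insert, if_pos hh, Finset.card_insert_of_notMem
          (by simp)]
      simpa [IExpr.eval] using h3
    · rw [Finset.range_add_one, Finset.filter_insert, if_pos hh, ← h4]
      refine (congrArg (fun l => (Finset.range l).image _) ?_).trans (image_range_succ
        (f := τ.iarr 1 0) (l := τ.ireg 0) rfl (fun j hj => ?_) ?_)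
      · simp [IExpr.eval]
      · simp [IExpr.eval, hj.ne]
      · simp [IExpr.eval, h2]
  · rw [hb] at hh
    refine (Runs.skip ⟨h2, h1.setI (by simp [M]), by simp, ?_, ?_⟩).mono (by norm_num) fun τ h => h
    · rw [Finset.range_add_one, Finset.filter_insert, if_neg hh]
      simpa using h3
    · rw [Finset.range_add_one, Finset.filter_insert, if_neg hh]
      simpa using h4

/-! ## The algorithm for weighted graphs -/

open WeightedGraph (level mem_level)

/-- Extension of a vector by zero. -/
def extend {n : ℕ} (r : Fin n → ℝ) : ℕ → ℝ := fun i => if h : i < n then r ⟨i, h⟩ else 0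

@[simp] lemma extend_val {n : ℕ} (r : Fin n → ℝ) (i : Fin n) : extend r i = r i := by
  simp [extend]

lemma map_level_eq {n : ℕ} (r : Fin n → ℝ) (x : ℝ) :
    (level r x).map Fin.valEmbedding = (Finset.range n).filter fun i => x ≤ extend r i := by
  ext i
  simp only [Finset.mem_map, mem_level, Fin.valEmbedding_apply, Finset.mem_filter, Finset.mem_range]
  constructor
  · rintro ⟨v, hv, rfl⟩
    exact ⟨v.isLt, by rwa [extend_val]⟩
  · rintro ⟨hi, hx⟩
    exact ⟨⟨i, hi⟩, by simpa [extend, hi] using hx, rfl⟩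

lemma levelSize_extend {n : ℕ} (r : Fin n → ℝ) (x : ℝ) :
    levelSize n (extend r) x = (level r x).card := by
  rw [levelSize, ← map_level_eq, Finset.card_map]

lemma levelCut_extend {n : ℕ} (G : WeightedGraph (Fin n)) {w : ℕ → ℕ → ℝ}
    (hw : ∀ i j : Fin n, w i j = G.w i j) (r : Fin n → ℝ) (x : ℝ) :
    levelCut n w (extend r) x = G.cut (level r x) (level r x)ᶜ := by
  have h : (level r x)ᶜ = Finset.univ.filter fun v => r v < x := by
    ext v; simp [mem_level]
  simp only [levelCut, WeightedGraph.cut, h, Finset.sum_range, extend_val, hw]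
  rw [level, Finset.sum_filter]
  refine Finset.sum_congr rfl fun u _ => ?_
  rw [Finset.sum_filter]

/-- A nonempty level set is cut out at its smallest value, so a sweep needs to test only the heights
`r v`. -/
lemma exists_level_eq {V : Type*} [Fintype V] [DecidableEq V] {r : V → ℝ} {t : ℝ} (h : (level r t).Nonempty) :
    ∃ v, level r t = level r (r v) := by
  obtain ⟨v, hv, hmin⟩ := Finset.exists_min_image _ r h
  refine ⟨v, ?_⟩
  ext u
  constructor
  · intro hu; exact mem_level.2 (hmin u hu)
  · intro hu; rw [mem_level] at *; exact hv.trans hu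

/-- The empty set is the output when no candidate is admissible; it too has to be a level set. -/
lemma exists_level_eq_empty {V : Type*} [Fintype V] [DecidableEq V] (r : V → ℝ) : ∃ t, level r t = ∅ := by
  refine ⟨∑ v, |r v| + 1, Finset.eq_empty_of_forall_notMem fun v hv => ?_⟩
  rw [mem_level] at hv
  have h1 : |r v| ≤ ∑ v, |r v| :=
    Finset.single_le_sum (f := fun v => |r v|) (fun v _ => abs_nonneg _) (Finset.mem_univ v)
  linarith [le_abs_self (r v)]

lemma isLevelSet_level {V : Type*} [Fintype V] [DecidableEq V] (r : V → ℝ) (t : ℝ) : IsLevelSet r (level r t) :=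
  ⟨t, fun _ => mem_level⟩

/-- Computes the pagerank vector by elimination and outputs its best admissible level set. -/
def pagerankProgram : Program :=
  .seq alphaProgram (.seq logProgram
  (.seq (.setR 3 (.div (.sub (.ofInt (.const 1)) (.reg 1)) (.add (.ofInt (.const 1)) (.reg 1))))
  (.seq (.setR 4 (.div (.mul (.ofInt (.const 2)) (.reg 1)) (.add (.ofInt (.const 1)) (.reg 1))))
  (.seq initProgram (.seq solveProgram (.seq sweepProgram listProgram))))))

/-- Collecting the lazy term `r v` on the left gives r = (1-α)/(1+α) w r + 2α/(1+α) χ_s, with row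
sums (1-α)/(1+α) < 1. -/
lemma elimInvariant_zero {n : ℕ} (G : WeightedGraph (Fin n)) (s : Fin n) {α : ℝ} (hα : 0 < α)
    (hα1 : α ≤ 1) {r : Fin n → ℝ} (hr : G.Solves α (Pi.single s 1) r) {A : ℕ → ℕ → ℝ}
    (hA : ∀ i j : Fin n, A i j = (1 - α) / (1 + α) * G.w i j)
    (hb : ∀ i : Fin n, A i n = if i = s then 2 * α / (1 + α) else 0) :
    ElimInvariant n (extend r) 0 A := by
  have h1 : 0 < 1 + α := by linarith
  refine ⟨fun i hi j hj => ?_, fun i hi j hj => absurd hj (Nat.not_lt_zero _), fun i hi => ?_,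
    fun i hi => ?_⟩
  · rw [hA ⟨i, hi⟩ ⟨j, hj⟩]
    exact mul_nonneg (div_nonneg (by linarith) h1.le) (G.nonneg _ _)
  · rw [Finset.sum_range]
    simp only [hA ⟨i, hi⟩]
    rw [← Finset.mul_sum, G.sum_eq_one, mul_one, div_lt_one h1]
    linarith
  · rw [Finset.sum_range]
    simp only [extend_val, hA ⟨i, hi⟩, mul_assoc]
    rw [← Finset.mul_sum, hb ⟨i, hi⟩]
    have h2 := hr ⟨i, hi⟩
    have h3 : extend r i = r ⟨i, hi⟩ := extend_val r ⟨i, hi⟩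
    rw [h3]
    rw [Pi.single_apply] at h2
    generalize ∑ u, G.w ⟨i, hi⟩ u * r u = X at *
    split_ifs at h2 ⊢
    all_goals
      field_simp
      linarith

lemma pagerankProgram_runs {n : ℕ} (G : WeightedGraph (Fin n)) (s : Fin n) {m : ℕ} (hm : 1 ≤ m)
    (hmn : m ≤ n) {φ : ℝ} (hφ : 0 < φ) {r : Fin n → ℝ}
    (hr : G.Solves (min 1 (100 * φ)) (Pi.single s 1) r) :
    ∃ S' : Finset (Fin n),
      Runs pagerankProgram (weightedInput G s m φ) (400 * n ^ 3) (fun τ => τ.Holds S') ∧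
      IsLevelSet r S' ∧ 2 * S'.card ≤ n ∧ (S'.card : ℝ) ≤ 3 * (m * logApprox m) ∧
      ∀ t, (level r t).Nonempty → 2 * (level r t).card ≤ n →
        ((level r t).card : ℝ) ≤ 3 * (m * logApprox m) →
        S'.Nonempty ∧ G.edgeExp S' ≤ G.edgeExp (level r t) := by
  set α := min 1 (100 * φ) with hα
  have hα0 : 0 < α := by rw [hα]; positivity
  have hα1 : α ≤ 1 := min_le_left _ _
  set σ := weightedInput G s m φ with hσ
  have i0 : σ.ireg 0 = s := rfl
  have i1 : σ.ireg 1 = n := rfl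
  have i2 : σ.ireg 2 = m := rfl
  have i7 : σ.ireg 7 = 0 := rfl
  have r0 : σ.rreg 0 = φ := rfl
  have hw : ∀ i j : Fin n, σ.rarr 0 i j = G.w i j := fun i j => by simp [hσ, weightedInput]
  have hz : ∀ i j, σ.rarr 1 i j = 0 := fun i j => by simp [hσ, weightedInput]
  have hL0 : 0 ≤ logApprox m := Finset.sum_nonneg fun i _ => by positivity
  set adm : ℕ → Prop := fun j => 2 * levelSize n (extend r) (extend r j) ≤ n ∧
    (levelSize n (extend r) (extend r j) : ℝ) ≤ 3 * (m * logApprox m) with hadm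
  set val : ℕ → ℝ := fun j => levelCut n (σ.rarr 0) (extend r) (extend r j) /
    levelSize n (extend r) (extend r j) with hval
  have hvalr : ∀ v : Fin n, val v = G.edgeExp (level r (r v)) := fun v => by
    simp only [hval, extend_val, levelCut_extend G hw, levelSize_extend, WeightedGraph.edgeExp]
  have hadmr : ∀ v : Fin n, adm v ↔ 2 * (level r (r v)).card ≤ n ∧
      ((level r (r v)).card : ℝ) ≤ 3 * (m * logApprox m) := fun v => by
    simp only [hadm, extend_val, levelSize_extend]
  have run : Runs pagerankProgram σ (400 * n ^ 3) fun τ => ∃ b v x,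
      BestBelow adm val n b v (fun j => x = extend r j) ∧
      τ.ireg 0 = (if b = 0 then 0 else levelSize n (extend r) x) ∧
      (Finset.range (τ.ireg 0)).image (τ.iarr 1 0) =
        if b = 0 then ∅ else (Finset.range n).filter fun i => x ≤ extend r i := by
    -- The cubic terms come from the elimination and from measuring n level sets in quadratic time
    -- each.
    have htime : 2 + (3 * m + 3 + (1 + (1 + ((n * (n * 3 + 4) + 3) + (25 * (n + 1) ^ 3 +
        (20 * (n + 1) ^ 3 + (5 * n + 4))))))) ≤ 400 * n ^ 3 := by
      have hn : 1 ≤ n := hm.trans hmn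
      obtain ⟨k, rfl⟩ : ∃ k, n = k + 1 := ⟨n - 1, by omega⟩
      ring_nf
      nlinarith [Nat.zero_le (k ^ 2), Nat.zero_le (k ^ 3)]
    refine Runs.mono (Runs.seq ((alphaProgram_runs σ).mono le_rfl ?_)) htime fun τ h => h
    rintro _ rfl
    rw [r0, ← hα]
    refine Runs.seq ((logProgram_runs (σ.setR 1 α)).mono (by rw [Store.setR_ireg, i2]) ?_)
    rintro σ2 ⟨a2, l2⟩
    simp only [Store.setR_ireg, i2] at l2
    have e1 : σ2.rreg 1 = α := (a2.rreg 1 (by simp)).trans (by simp)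
    refine Runs.seq (Runs.setR (Runs.seq (Runs.setR ?_)))
    have hβ : (RExpr.div (.sub (.ofInt (.const 1)) (.reg 1)) (.add (.ofInt (.const 1)) (.reg 1))).eval
        σ2 = (1 - α) / (1 + α) := by simp [RExpr.eval, IExpr.eval, e1]
    rw [hβ]
    have hγ : (RExpr.div (.mul (.ofInt (.const 2)) (.reg 1)) (.add (.ofInt (.const 1)) (.reg 1))).eval
        (σ2.setR 3 ((1 - α) / (1 + α))) = 2 * α / (1 + α) := by simp [RExpr.eval, IExpr.eval, e1]
    rw [hγ]
    set σ3 := (σ2.setR 3 ((1 - α) / (1 + α))).setR 4 (2 * α / (1 + α)) with hσ3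
    have a3 : Agree ⟨[3], [1, 2, 3, 4], [], []⟩ σ σ3 := by
      refine Agree.setR (Agree.setR (Agree.trans ((Agree.refl _ σ).setR (x := 1) (y := α) (by simp))
        (a2.mono ?_ ?_ ?_ ?_)) (by simp)) (by simp) <;> simp
    have l3 : σ3.rreg 2 = logApprox m := by simp [hσ3, l2]
    have b3 : σ3.rreg 3 = (1 - α) / (1 + α) := by simp [hσ3]
    have c3 : σ3.rreg 4 = 2 * α / (1 + α) := by simp [hσ3]
    have n3 : σ3.ireg 1 = n := (a3.ireg 1 (by simp)).trans i1
    have s3 : σ3.ireg 0 = s := (a3.ireg 0 (by simp)).trans i0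
    refine Runs.seq ((initProgram_runs σ3 fun i j => (a3.rarr 1 (by simp) i j).trans (hz i j)).mono
      (by rw [n3]) ?_)
    rintro σ4 ⟨a4, h4⟩
    rw [n3, s3, b3, c3] at h4
    have n4 : σ4.ireg 1 = n := (a4.ireg 1 (by simp)).trans n3
    have inv : ElimInvariant n (extend r) 0 (σ4.rarr 1) := by
      refine elimInvariant_zero G s hα0 hα1 hr (fun i j => ?_) fun i => ?_
      · rw [h4, if_neg (fun h => j.isLt.ne h.2), if_pos ⟨i.isLt, j.isLt⟩, a3.rarr 0 (by simp), hw]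
      · rw [h4]
        simp [Fin.ext_iff]
    refine Runs.seq ((solveProgram_runs σ4 (x := extend r) (by rw [n4]; exact inv)).mono (by rw [n4]) ?_)
    rintro σ5 ⟨a5, h5⟩
    rw [n4] at h5
    have a45 : Agree ⟨[3, 4, 5], [1, 2, 3, 4], [], [1, 2]⟩ σ σ5 := by
      refine Agree.trans (a3.mono ?_ ?_ ?_ ?_) (Agree.trans (a4.mono ?_ ?_ ?_ ?_)
        (a5.mono ?_ ?_ ?_ ?_)) <;> simp
    have n5 : σ5.ireg 1 = n := (a45.ireg 1 (by simp)).trans i1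
    have m5 : σ5.ireg 2 = m := (a45.ireg 2 (by simp)).trans i2
    have f5 : σ5.ireg 7 = 0 := (a45.ireg 7 (by simp)).trans i7
    have l5 : σ5.rreg 2 = logApprox m :=
      (a5.rreg 2 (by simp)).trans ((a4.rreg 2 (by simp)).trans l3)
    have w5 : σ5.rarr 0 = σ.rarr 0 :=
      funext fun i => funext fun j => a45.rarr 0 (by simp) i j
    refine Runs.seq ((sweepProgram_runs σ5 n5 h5 f5).mono le_rfl ?_)
    rintro σ6 ⟨a6, h6⟩
    rw [m5, l5, w5] at h6
    refine (listProgram_runs σ6 (ρ := extend r) ((a6.ireg 1 (by simp)).trans n5) fun i hi =>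
      (a6.rarr 1 (by simp) i n).trans (h5 i hi)).mono le_rfl ?_
    rintro τ ⟨h7, h8⟩
    exact ⟨σ6.ireg 7, σ6.rreg 5, σ6.rreg 6, h6, h7, h8⟩
  obtain ⟨t, τ, h1, h2, b, v, x, h3, h4, h5⟩ := run
  -- Without an admissible candidate the output is empty and optimality is vacuous.
  rcases h3 with ⟨hb, hno⟩ | ⟨hb, j, hj, hj1, rfl, -, hj2⟩
  · rw [if_pos hb] at h4 h5
    refine ⟨∅, ⟨t, τ, h1, h2, ?_, ?_⟩, ?_, by simp, ?_, fun y hy hy1 hy2 => ?_⟩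
    · simpa using h4
    · rw [h5]; simp
    · obtain ⟨y, hy⟩ := exists_level_eq_empty r
      exact hy ▸ isLevelSet_level r y
    · simp only [Finset.card_empty, Nat.cast_zero]; positivity
    · obtain ⟨u, hu⟩ := exists_level_eq hy
      rw [hu] at hy1 hy2
      exact absurd ((hadmr u).2 ⟨hy1, hy2⟩) (hno u u.isLt)
  · rw [if_neg hb] at h4 h5
    obtain ⟨u, rfl⟩ : ∃ u : Fin n, u = j := ⟨⟨j, hj⟩, rfl⟩
    rw [hadmr u] at hj1
    rw [extend_val, levelSize_extend] at h4
    rw [extend_val, ← map_level_eq] at h5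
    have hne : (level r (r u)).Nonempty := ⟨u, mem_level.2 le_rfl⟩
    refine ⟨level r (r u), ⟨t, τ, h1, h2, h4, h5.symm⟩, isLevelSet_level r _, hj1.1, hj1.2,
      fun y hy hy1 hy2 => ⟨hne, ?_⟩⟩
    obtain ⟨u', hu'⟩ := exists_level_eq hy
    rw [hu'] at hy1 hy2 ⊢
    have := hj2 u' u'.isLt ((hadmr u').2 ⟨hy1, hy2⟩)
    rwa [hvalr, hvalr] at this

/-- The guarantee of the algorithm for weighted graphs. -/
theorem weighted_algorithm {n : ℕ} (G : WeightedGraph (Fin n)) (S : Finset (Fin n))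
    (hS : 2 ≤ S.card) (hφ : 0 < G.edgeExp S) (hn : 3 * ((S.card : ℝ) * Real.log S.card) ≤ n) :
    ∃ out : Fin n → Finset (Fin n),
      (∀ s ∈ S,
        pagerankProgram.Outputs (weightedInput G s S.card (G.edgeExp S))
          (10000000 * (n : ℝ) ^ 3) (out s) ∧
        ∃ r : Fin n → ℝ, G.IsPageRank s (min 1 (100 * G.edgeExp S)) r ∧ IsLevelSet r (out s)) ∧
      S.card ≤ 2 * {s | s ∈ S ∧ Guarantee G 10000000 S (out s)}.ncard := by
  set m := S.card with hm
  have hlog := WeightedGraph.log_ge_of_two_le hS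
  have hm0 : (2 : ℝ) ≤ m := by exact_mod_cast hS
  have hmn : m ≤ n := by simpa using S.card_le_univ
  set α := min 1 (100 * G.edgeExp S) with hα
  have hα0 : 0 < α := by rw [hα]; positivity
  have hα1 : α ≤ 1 := min_le_left _ _
  obtain ⟨hL1, hL2⟩ := logApprox_bounds (by omega : 1 ≤ m)
  choose r hr using fun s => G.exists_solves hα0 hα1 (Pi.single s 1 : Fin n → ℝ)
  choose out hrun hlev hhalf hcard hbest using fun s =>
    pagerankProgram_runs G s (by omega : 1 ≤ m) hmn hφ (hr s)
  refine ⟨out, fun s _ => ⟨(hrun s).outputs ?_, r s, (G.isPageRank_iff s α (r s)).2 (hr s), hlev s⟩,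
    ?_⟩
  · push_cast
    have : (0 : ℝ) ≤ (n : ℝ) ^ 3 := by positivity
    linarith
  refine (WeightedGraph.card_le_two_mul_card_mass hα0 hα1 (c := 100) (by norm_num) (fun h => ?_)
    fun s _ => hr s).trans ?_
  · rw [hα] at h ⊢
    exact min_eq_right (not_lt.1 fun h' => by rw [min_eq_left h'.le] at h; linarith)
  rw [← Set.ncard_coe_finset]
  refine Nat.mul_le_mul_left 2 (Set.ncard_le_ncard (fun s hs => ?_) (Set.toFinite _))
  rw [Finset.mem_coe, Finset.mem_filter] at hs
  refine ⟨hs.1, ?_⟩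
  have hr0 : ∀ v, 0 ≤ r s v := (hr s).nonneg hα0 hα1 fun v => by
    rw [Pi.single_apply]; split_ifs <;> norm_num
  have hr1 : ∑ v, r s v = 1 := by rw [(hr s).sum_univ hα0]; simp
  -- For `l = 3/2` the hypothesis on `n` is exactly the size condition, and the mass required is
  -- below 0.987, against the 0.99 available.
  refine WeightedGraph.guarantee_of_best (s := s) (α := α) (l := 3 / 2) (q := 0) (r := r s) hS hφ hα
    (by norm_num) ?_ (fun v => le_rfl) (by simpa using hr s) hr0 hr1.le ?_ (fun t ht hcardt => ?_) ?_
    (by simpa using hhalf s)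
  · rw [Fintype.card_fin]; linarith
  · refine lt_of_lt_of_le ?_ hs.2
    rw [← hm]
    have h1 : 1 / Real.log m < 1.4431 := by
      rw [div_lt_iff₀ (by linarith)]; linarith
    have h2 : 1 / (3 / 2 * Real.log m) = 2 / 3 * (1 / Real.log m) := by field_simp
    rw [h2]
    linarith
  · rw [← hm] at hcardt
    have h1 : (2 : ℝ) * (level (r s) t).card ≤ n := by linarith
    refine hbest s t ht (by exact_mod_cast h1) (hcardt.trans ?_)
    -- The computed cap is at least 2 m log m, so it admits all sets with at most (3/2) m log m
    -- vertices.
    have : (m : ℝ) * (2 / 3 * Real.log m) ≤ m * logApprox m := by gcongr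
    have h2 : 0 ≤ (m : ℝ) * Real.log m := by positivity
    linarith
  · refine (hcard s).trans ?_
    gcongr

/-! ## Approximate pagerank by pushes of a fixed amount -/

/-- One push at `u`: the residual `ε` at `u` is distributed. -/
lemma WeightedGraph.Solves.push {V : Type*} [Fintype V] [DecidableEq V] {G : WeightedGraph V}
    {α ε : ℝ} {f ρ : V → ℝ} {c : V → ℕ} (u : V)
    (h : G.Solves α (f - ρ) fun v => α * ε * c v) :
    G.Solves α (f - fun v => (if v = u then ρ v - ε * (1 + α) / 2 else ρ v)
      + (1 - α) * ε / 2 * G.w u v)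
      fun v => α * ε * ((if v = u then c v + 1 else c v : ℕ) : ℝ) := by
  -- Of the residual ε at `u`, the part αε is settled and the lazy half (1-α)ε/2 of the rest stays
  -- at `u`, so `u` loses ε(1+α)/2; the other half is spread along the edges.
  intro v
  have h1 := h v
  have h2 : ∀ x, ((if x = u then c x + 1 else c x : ℕ) : ℝ) = c x + if x = u then 1 else 0 := by
    intro x; split_ifs <;> simp
  have h3 : ∑ x, G.w v x * (α * ε * (c x + if x = u then (1 : ℝ) else 0)) =
      ∑ x, G.w v x * (α * ε * c x) + G.w u v * (α * ε) := by
    rw [G.symm u v]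
    simp only [mul_add, Finset.sum_add_distrib, mul_ite, mul_one, mul_zero, Finset.sum_ite_eq',
      Finset.mem_univ, if_true]
  simp only [h2, h3]
  simp only [Pi.sub_apply] at h1 ⊢
  split_ifs <;> linarith

/-- Lists of the sets `{v | j ≤ c v}`, `j ≥ 1`: their lengths are in array 5, their entries in
array 4. -/
def HoldsLevels {n : ℕ} (σ : Store) (c : Fin n → ℕ) : Prop :=
  ∀ j, 1 ≤ j → σ.iarr 5 0 j = (Finset.univ.filter fun v => j ≤ c v).card ∧
    (Finset.range (σ.iarr 5 0 j)).image (σ.iarr 4 j) =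
      (Finset.univ.filter fun v => j ≤ c v).map Fin.valEmbedding

/-- Raising the count of `u` by one affects a single set, the one with number `c u + 1`, which gains
`u`. -/
lemma HoldsLevels.push {n : ℕ} {σ τ : Store} {c : Fin n → ℕ} (h : HoldsLevels σ c) (u : Fin n)
    (h5 : ∀ j, τ.iarr 5 0 j = if j = c u + 1 then σ.iarr 5 0 j + 1 else σ.iarr 5 0 j)
    (h4 : ∀ j a, τ.iarr 4 j a =
      if j = c u + 1 ∧ a = σ.iarr 5 0 (c u + 1) then u.val else σ.iarr 4 j a) :
    HoldsLevels τ fun v => if v = u then c v + 1 else c v := by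
  intro j hj
  obtain ⟨h1, h2⟩ := h j hj
  by_cases hju : j = c u + 1
  · have hset : (Finset.univ.filter fun v => j ≤ if v = u then c v + 1 else c v) =
        insert u (Finset.univ.filter fun v => j ≤ c v) := by
      ext v
      simp only [Finset.mem_filter, Finset.mem_univ, true_and, Finset.mem_insert]
      by_cases hv : v = u
      · subst hv; simp [hju]
      · simp [hv]
    have hu : u ∉ Finset.univ.filter fun v => j ≤ c v := by simp [hju]
    rw [hset, h5, if_pos hju, Finset.card_insert_of_notMem hu, Finset.map_insert]
    refine ⟨by rw [h1], ?_⟩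
    refine image_range_succ h2 (fun a ha => ?_) ?_
    · rw [h4, if_neg]; rintro ⟨-, rfl⟩; rw [hju] at ha; omega
    · rw [h4, if_pos ⟨hju, by rw [hju]⟩]; rfl
  · have hset : (Finset.univ.filter fun v => j ≤ if v = u then c v + 1 else c v) =
        Finset.univ.filter fun v => j ≤ c v := by
      ext v
      simp only [Finset.mem_filter, Finset.mem_univ, true_and]
      by_cases hv : v = u
      · subst hv; simp; omega
      · simp [hv]
    rw [hset, h5, if_neg hju]
    refine ⟨h1, ?_⟩
    rw [← h2]
    refine Finset.image_congr fun a _ => ?_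
    rw [h4, if_neg fun hh => hju hh.1]

/-- Adds the share of each neighbour of the vertex in register 4 and puts it on the stack. -/
def spreadProgram : Program :=
  .for 5 (.reg 1)
    (.seq (.setI 6 (.get 0 (.reg 4) (.reg 5)))
    (.seq (.putR 0 (.const 0) (.reg 6) (.add (.get 0 (.const 0) (.reg 6)) (.reg 6)))
    (.seq (.putI 2 (.const 0) (.reg 3) (.reg 6))
    (.setI 3 (.add (.reg 3) (.const 1))))))

lemma spreadProgram_runs (σ : Store) : Runs spreadProgram σ (6 * σ.ireg 1 + 2) fun τ =>
    Agree ⟨[3, 5, 6], [], [2], [0]⟩ σ τ ∧ τ.ireg 3 = σ.ireg 3 + σ.ireg 1 ∧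
    (∀ a < σ.ireg 3, τ.iarr 2 0 a = σ.iarr 2 0 a) ∧
    (∀ i < σ.ireg 1, τ.iarr 2 0 (σ.ireg 3 + i) = σ.iarr 0 (σ.ireg 4) i) ∧
    ∀ x, τ.rarr 0 0 x = σ.rarr 0 0 x + σ.rreg 6 *
      ∑ i ∈ Finset.range (σ.ireg 1), if σ.iarr 0 (σ.ireg 4) i = x then 1 else 0 := by
  set M : Footprint := ⟨[3, 5, 6], [], [2], [0]⟩
  have key := Runs.for (x := 5) (e := .reg 1) (T := 4) (N := σ.ireg 1) (σ := σ)
    (p := .seq (.setI 6 (.get 0 (.reg 4) (.reg 5)))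
    (.seq (.putR 0 (.const 0) (.reg 6) (.add (.get 0 (.const 0) (.reg 6)) (.reg 6)))
    (.seq (.putI 2 (.const 0) (.reg 3) (.reg 6))
    (.setI 3 (.add (.reg 3) (.const 1))))))
    (fun i τ => Agree M σ τ ∧ τ.ireg 5 = i ∧ τ.ireg 3 = σ.ireg 3 + i ∧
      (∀ a < σ.ireg 3, τ.iarr 2 0 a = σ.iarr 2 0 a) ∧
      (∀ k < i, τ.iarr 2 0 (σ.ireg 3 + k) = σ.iarr 0 (σ.ireg 4) k) ∧
      ∀ x, τ.rarr 0 0 x = σ.rarr 0 0 x + σ.rreg 6 *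
        ∑ k ∈ Finset.range i, if σ.iarr 0 (σ.ireg 4) k = x then 1 else 0) ?_ ?_ ?_ ?_
  · refine key.mono (by omega) ?_
    rintro τ ⟨h1, -, h2⟩
    exact ⟨h1, h2⟩
  · exact ⟨(Agree.refl _ σ).setI (by simp [M]), by simp, by simp, by simp, by simp, by simp⟩
  · rintro i τ ⟨h, -⟩
    exact h.ireg 1 (by simp [M])
  · rintro i τ ⟨-, h, -⟩; exact h
  rintro i hi τ ⟨h1, h2, h3, h4, h5, h6⟩
  have e4 : τ.ireg 4 = σ.ireg 4 := h1.ireg 4 (by simp [M])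
  have e6 : τ.rreg 6 = σ.rreg 6 := h1.rreg 6 (by simp [M])
  have e0 := h1.iarr 0 (by simp [M])
  refine Runs.seq (T := 1) (T' := 3) (Runs.setI (Runs.seq (T := 1) (T' := 2) (Runs.putR
    (Runs.seq (T := 1) (T' := 1) (Runs.putI (Runs.setI ⟨?_, ?_, ?_, ?_, ?_, ?_, ?_⟩))))))
  · simpa using h2
  · exact ((((h1.setI (by simp [M])).putR (by simp [M])).putI (by simp [M])).setI
      (by simp [M])).setI (by simp [M])
  · simp
  · simp [IExpr.eval, h3]; omega
  · intro a ha
    simp only [IExpr.eval, Store.setI_iarr, Store.putI_iarr, Store.putR_iarr, Store.putR_ireg,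
      Store.setI_ireg]
    rw [if_neg, h4 a ha]
    simp [h3]; omega
  · intro k hk
    simp only [IExpr.eval, Store.setI_iarr, Store.putI_iarr, Store.putR_iarr, Store.putR_ireg,
      Store.setI_ireg, h2, h3, e4, e0]
    by_cases hki : k = i
    · subst hki; simp
    · rw [if_neg (by simp; omega), h5 k (by omega)]
  · intro x
    simp only [IExpr.eval, RExpr.eval, Store.setI_rarr, Store.putI_rarr, Store.putR_rarr,
      Store.setI_ireg, Store.setI_rreg, if_true, true_and, e4, e6, h2, e0, h6,
      Finset.sum_range_succ]
    by_cases hx : x = σ.iarr 0 (σ.ireg 4) i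
    · rw [if_pos hx, if_pos hx.symm, hx]; ring
    · rw [if_neg hx, if_neg (fun h => hx h.symm)]; ring

/-- A push at the vertex in register 4. -/
def pushProgram : Program :=
  .seq (.setI 6 (.add (.get 3 (.const 0) (.reg 4)) (.const 1)))
  (.seq (.putI 3 (.const 0) (.reg 4) (.reg 6))
  (.seq (.putI 4 (.reg 6) (.get 5 (.const 0) (.reg 6)) (.reg 4))
  (.seq (.putI 5 (.const 0) (.reg 6) (.add (.get 5 (.const 0) (.reg 6)) (.const 1)))
  (.seq (.putR 0 (.const 0) (.reg 4) (.sub (.get 0 (.const 0) (.reg 4)) (.reg 4)))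
  (.seq spreadProgram
  (.seq (.putI 2 (.const 0) (.reg 3) (.reg 4))
  (.setI 3 (.add (.reg 3) (.const 1)))))))))

/-- All neighbours and `u` itself go on the stack unconditionally; duplicates and vertices with
small residual are sorted out when they are popped. -/
lemma pushProgram_runs (σ : Store) : Runs pushProgram σ (6 * σ.ireg 1 + 9) fun τ =>
    Agree ⟨[3, 5, 6], [], [2, 3, 4, 5], [0]⟩ σ τ ∧ τ.ireg 3 = σ.ireg 3 + σ.ireg 1 + 1 ∧
    (∀ x, τ.iarr 3 0 x = if x = σ.ireg 4 then σ.iarr 3 0 x + 1 else σ.iarr 3 0 x) ∧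
    (∀ j, τ.iarr 5 0 j =
      if j = σ.iarr 3 0 (σ.ireg 4) + 1 then σ.iarr 5 0 j + 1 else σ.iarr 5 0 j) ∧
    (∀ j a, τ.iarr 4 j a =
      if j = σ.iarr 3 0 (σ.ireg 4) + 1 ∧ a = σ.iarr 5 0 (σ.iarr 3 0 (σ.ireg 4) + 1) then σ.ireg 4
      else σ.iarr 4 j a) ∧
    (∀ a < σ.ireg 3, τ.iarr 2 0 a = σ.iarr 2 0 a) ∧
    (∀ i < σ.ireg 1, τ.iarr 2 0 (σ.ireg 3 + i) = σ.iarr 0 (σ.ireg 4) i) ∧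
    τ.iarr 2 0 (σ.ireg 3 + σ.ireg 1) = σ.ireg 4 ∧
    ∀ x, τ.rarr 0 0 x = (if x = σ.ireg 4 then σ.rarr 0 0 x - σ.rreg 4 else σ.rarr 0 0 x) +
      σ.rreg 6 * ∑ i ∈ Finset.range (σ.ireg 1), if σ.iarr 0 (σ.ireg 4) i = x then 1 else 0 := by
  set M : Footprint := ⟨[3, 5, 6], [], [2, 3, 4, 5], [0]⟩
  refine Runs.mono (T := 1 + (1 + (1 + (1 + (1 + (6 * σ.ireg 1 + 2 + (1 + 1)))))))
    ?_ (by omega) fun τ h => h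
  refine Runs.seq (Runs.setI (Runs.seq (Runs.putI (Runs.seq (Runs.putI ?_)))))
  refine Runs.seq (Runs.putI (Runs.seq (Runs.putR (Runs.seq (Runs.mono
    (spreadProgram_runs _) ?_ ?_)))))
  · simp
  rintro τ ⟨h1, h2, h3, h4, h5⟩
  have f3 := h1.iarr 3 (by simp)
  have f4 := h1.iarr 4 (by simp)
  have f5 := h1.iarr 5 (by simp)
  have e4 := h1.ireg 4 (by simp)
  simp [IExpr.eval, RExpr.eval] at h2 h3 h4 h5 f3 f4 f5 e4
  refine Runs.seq (Runs.putI (Runs.setI ⟨?_, ?_, ?_, ?_, ?_, ?_, ?_, ?_, ?_⟩))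
  · refine Agree.setI (Agree.putI (Agree.trans ?_ (h1.mono ?_ ?_ ?_ ?_)) (by simp [M])) (by simp [M])
    · exact ((((((Agree.refl M σ).setI (by simp [M])).putI (by simp [M])).putI (by simp [M])).putI
        (by simp [M])).putR (by simp [M]))
    all_goals simp [M]
  · simp [IExpr.eval, h2]
  · intro x
    simp only [IExpr.eval, Store.setI_iarr, Store.putI_iarr, f3]
    by_cases hx : x = σ.ireg 4 <;> simp [hx]
  · intro j
    simp only [IExpr.eval, Store.setI_iarr, Store.putI_iarr, f5]
    by_cases hj : j = σ.iarr 3 0 (σ.ireg 4) + 1 <;> simp [hj]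
  · intro j a
    simp only [IExpr.eval, Store.setI_iarr, Store.putI_iarr, f4]
    by_cases hj : j = σ.iarr 3 0 (σ.ireg 4) + 1 ∧ a = σ.iarr 5 0 (σ.iarr 3 0 (σ.ireg 4) + 1) <;>
      simp [hj]
  · intro a ha
    simp only [IExpr.eval, Store.setI_iarr, Store.putI_iarr, h2]
    rw [if_neg (by omega), h3 a ha]
  · intro i hi
    simp only [IExpr.eval, Store.setI_iarr, Store.putI_iarr, h2]
    rw [if_neg (by omega), h4 i hi]
  · simp [IExpr.eval, h2, e4]
  · intro x
    simp only [Store.setI_rarr, Store.putI_rarr, h5]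
    congr 1
    · by_cases hx : x = σ.ireg 4 <;> simp [hx]
    · simp

/-- Pushes until the stack is empty. -/
def pushLoopProgram : Program :=
  .loop (.ltI (.const 0) (.reg 3))
    (.seq (.setI 3 (.sub (.reg 3) (.const 1)))
    (.seq (.setI 4 (.get 2 (.const 0) (.reg 3)))
    (.ite (.neg (.ltR (.get 0 (.const 0) (.reg 4)) (.reg 3))) pushProgram .skip)))

/-- The invariant of the push loop; `σ₀` is the memory before the loop. -/
structure PushInvariant {n : ℕ} (G : WeightedGraph (Fin n)) (s : Fin n) (α ε : ℝ)
    (σ₀ σ : Store) : Prop where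
  agree : Agree ⟨[3, 4, 5, 6], [], [2, 3, 4, 5], [0]⟩ σ₀ σ
  levels : HoldsLevels σ fun v : Fin n => σ.iarr 3 0 v
  stack : ∀ a < σ.ireg 3, ∃ v : Fin n, σ.iarr 2 0 a = v
  active : ∀ v : Fin n, ε ≤ σ.rarr 0 0 v → ∃ a < σ.ireg 3, σ.iarr 2 0 a = v
  nonneg : ∀ v : Fin n, 0 ≤ σ.rarr 0 0 v
  solves : G.Solves α ((Pi.single s 1 : Fin n → ℝ) - fun v : Fin n => σ.rarr 0 0 v)
    fun v => α * ε * σ.iarr 3 0 v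

/-- Mass is conserved: αε times the number of pushes, plus the nonnegative residual, equals 1. -/
lemma PushInvariant.sum_le {n : ℕ} {G : WeightedGraph (Fin n)} {s : Fin n} {α ε : ℝ}
    {σ₀ σ : Store} (h : PushInvariant G s α ε σ₀ σ) (hα : 0 < α) (hε : 0 < ε) :
    ∑ v : Fin n, σ.iarr 3 0 v ≤ ⌊1 / (α * ε)⌋₊ := by
  have h1 := h.solves.sum_univ hα
  rw [← Finset.mul_sum] at h1
  have h2 : ∑ v : Fin n, ((Pi.single s 1 : Fin n → ℝ) - fun v : Fin n => σ.rarr 0 0 v) v ≤ 1 := by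
    simp only [Pi.sub_apply, Finset.sum_sub_distrib]
    have := Finset.sum_nonneg fun (v : Fin n) (_ : v ∈ Finset.univ) => h.nonneg v
    simp
    linarith
  refine Nat.le_floor ?_
  push_cast
  rw [le_div_iff₀ (by positivity)]
  linarith

lemma pushLoopProgram_runs {n d : ℕ} {G : WeightedGraph (Fin n)} {nbr : Fin n → Fin d → Fin n}
    (hG : ∀ u (g : Fin n → ℝ), ∑ i, g (nbr u i) = d * ∑ v, G.w u v * g v) {s : Fin n} {α ε : ℝ}
    (hα : 0 < α) (hα1 : α ≤ 1) (hε : 0 < ε) {σ : Store} (hd : σ.ireg 1 = d) (hd0 : 0 < d)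
    (hadj : ∀ (v : Fin n) (i : Fin d), σ.iarr 0 v i = nbr v i)
    (h3 : σ.rreg 3 = ε) (h4 : σ.rreg 4 = ε * (1 + α) / 2) (h6 : σ.rreg 6 = (1 - α) * ε / (2 * d))
    (hsp : σ.ireg 3 = 1) (hI : PushInvariant G s α ε σ σ) :
    Runs pushLoopProgram σ ((11 * d + 20) * ⌊1 / (α * ε)⌋₊ + 6) fun τ =>
      PushInvariant G s α ε σ τ ∧ ∀ v : Fin n, τ.rarr 0 0 v < ε := by
  set N := ⌊1 / (α * ε)⌋₊ with hN
  -- In the potential below, 5 per stack entry pays for popping it without a push. A push adds `d`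
  -- entries net and costs `6 * d + 13` steps with the loop test, covered by the `11 * d + 20`
  -- reserved for each remaining push.
  have key := Runs.loop (b := .ltI (.const 0) (.reg 3))
    (p := .seq (.setI 3 (.sub (.reg 3) (.const 1)))
      (.seq (.setI 4 (.get 2 (.const 0) (.reg 3)))
      (.ite (.neg (.ltR (.get 0 (.const 0) (.reg 4)) (.reg 3))) pushProgram .skip)))
    (PushInvariant G s α ε σ)
    (fun τ => 5 * τ.ireg 3 + (11 * d + 20) * (N - ∑ v : Fin n, τ.iarr 3 0 v)) ?_ hI
  · refine key.mono ?_ ?_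
    · rw [hsp]
      have : (11 * d + 20) * (N - ∑ v : Fin n, σ.iarr 3 0 v) ≤ (11 * d + 20) * N :=
        Nat.mul_le_mul_left _ (Nat.sub_le _ _)
      omega
    · rintro τ ⟨h1, h2⟩
      refine ⟨h1, fun v => ?_⟩
      by_contra! hv
      obtain ⟨a, ha, -⟩ := h1.active v hv
      have h2 : ¬ 0 < τ.ireg 3 := h2
      omega
  intro τ hτ hb
  have hsp0 : 0 < τ.ireg 3 := hb
  obtain ⟨k, hk⟩ : ∃ k, τ.ireg 3 = k + 1 := ⟨τ.ireg 3 - 1, by omega⟩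
  obtain ⟨u, hu⟩ := hτ.stack k (by omega)
  set τ' := (τ.setI 3 k).setI 4 u with hτ'
  have start : ∀ {T Q}, Runs (.ite (.neg (.ltR (.get 0 (.const 0) (.reg 4)) (.reg 3))) pushProgram
      .skip) τ' T Q → Runs (.seq (.setI 3 (.sub (.reg 3) (.const 1)))
      (.seq (.setI 4 (.get 2 (.const 0) (.reg 3)))
      (.ite (.neg (.ltR (.get 0 (.const 0) (.reg 4)) (.reg 3))) pushProgram .skip))) τ
      (1 + (1 + T)) Q := by
    intro T Q h
    refine Runs.seq (Runs.setI (Runs.seq (Runs.setI ?_)))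
    have e1 : (IExpr.sub (.reg 3) (.const 1)).eval τ = k := by simp [IExpr.eval, hk]
    rw [e1]
    have e2 : (IExpr.get 2 (.const 0) (.reg 3)).eval (τ.setI 3 k) = u := by simp [IExpr.eval, hu]
    rw [e2]
    exact h
  have d3 : τ.rreg 3 = ε := (hτ.agree.rreg 3 (by simp)).trans h3
  have d4 : τ.rreg 4 = ε * (1 + α) / 2 := (hτ.agree.rreg 4 (by simp)).trans h4
  have d6 : τ.rreg 6 = (1 - α) * ε / (2 * d) := (hτ.agree.rreg 6 (by simp)).trans h6
  have d1 : τ.ireg 1 = d := (hτ.agree.ireg 1 (by simp)).trans hd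
  have da : ∀ (v : Fin n) (i : Fin d), τ.iarr 0 v i = nbr v i := fun v i =>
    (hτ.agree.iarr 0 (by simp) v i).trans (hadj v i)
  have htest : (Test.neg (.ltR (.get 0 (.const 0) (.reg 4)) (.reg 3))).holds τ' ↔
      ε ≤ τ.rarr 0 0 u := by
    simp [Test.holds, RExpr.eval, IExpr.eval, hτ', d3]
  have hag : Agree ⟨[3, 4, 5, 6], [], [2, 3, 4, 5], [0]⟩ σ τ' :=
    (hτ.agree.setI (by simp)).setI (by simp)
  by_cases hpush : ε ≤ τ.rarr 0 0 u
  · refine ⟨_, start (Runs.ite (T := 6 * d + 9) (fun _ => ?_)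
      (fun h => absurd (htest.2 hpush) h))⟩
    have s1 : τ'.ireg 1 = d := by simp [hτ', d1]
    have s3 : τ'.ireg 3 = k := by simp [hτ']
    have s4 : τ'.ireg 4 = u := by simp [hτ']
    have sr4 : τ'.rreg 4 = ε * (1 + α) / 2 := d4
    have sr6 : τ'.rreg 6 = (1 - α) * ε / (2 * d) := d6
    refine (pushProgram_runs τ').mono (by rw [s1]) ?_
    rintro υ ⟨b1, b2, b3, b4, b5, b6, b7, b8, b9⟩
    rw [s4] at b3 b4 b5 b7 b8 b9
    rw [s3] at b2 b6 b7 b8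
    rw [s1] at b2 b7 b8 b9
    rw [sr4, sr6] at b9
    have c3 : ∀ x, τ'.iarr 3 0 x = τ.iarr 3 0 x := fun _ => rfl
    have c5 : ∀ x, τ'.iarr 5 0 x = τ.iarr 5 0 x := fun _ => rfl
    have c4 : ∀ j x, τ'.iarr 4 j x = τ.iarr 4 j x := fun _ _ => rfl
    have c2 : ∀ x, τ'.iarr 2 0 x = τ.iarr 2 0 x := fun _ => rfl
    have c0 : ∀ j x, τ'.iarr 0 j x = τ.iarr 0 j x := fun _ _ => rfl
    have c0r : ∀ x, τ'.rarr 0 0 x = τ.rarr 0 0 x := fun _ => rfl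
    simp only [c3] at b3 b4 b5
    simp only [c5] at b4 b5
    simp only [c4] at b5
    simp only [c2] at b6
    simp only [c0] at b7 b9
    simp only [c0r] at b9
    have hcnt : ∀ v : Fin n, υ.iarr 3 0 v = if v = u then τ.iarr 3 0 v + 1 else τ.iarr 3 0 v := by
      intro v
      rw [b3]
      simp only [Fin.ext_iff]
    have hres : ∀ v : Fin n, υ.rarr 0 0 v =
        (if v = u then τ.rarr 0 0 v - ε * (1 + α) / 2 else τ.rarr 0 0 v) +
          (1 - α) * ε / 2 * G.w u v := by
      intro v
      have h1 : ∑ i ∈ Finset.range d, (if τ.iarr 0 u i = v then (1 : ℝ) else 0) = d * G.w u v := by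
        rw [Finset.sum_range]
        have := hG u fun x => if x = v then 1 else 0
        simp only [mul_ite, mul_one, mul_zero, Finset.sum_ite_eq', Finset.mem_univ, if_true] at this
        rw [← this]
        simp only [da, Fin.ext_iff]
      rw [b9, h1]
      simp only [Fin.ext_iff]
      congr 1
      have : (d : ℝ) ≠ 0 := by exact_mod_cast hd0.ne'
      field_simp
    have hinv : PushInvariant G s α ε σ υ := by
      refine ⟨hag.trans (b1.mono ?_ ?_ ?_ ?_), ?_, fun a ha => ?_, fun v hv => ?_, fun v => ?_, ?_⟩
      any_goals simp
      · have := hτ.levels.push (τ := υ) u b4 b5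
        simpa only [hcnt] using this
      · rw [b2] at ha
        rcases lt_trichotomy a (k + d) with h | h | h
        · by_cases hak : a < k
          · rw [b6 a hak]; exact hτ.stack a (by omega)
          · obtain ⟨i, rfl⟩ := Nat.exists_eq_add_of_le (not_lt.1 hak)
            rw [b7 i (by omega)]
            exact ⟨nbr u ⟨i, by omega⟩, da u ⟨i, by omega⟩⟩
        · rw [h, b8]; exact ⟨u, rfl⟩
        · omega
      · rw [b2]
        by_cases hvu : v = u
        · exact ⟨k + d, by omega, by rw [b8, hvu]⟩
        by_cases hadjv : ∃ i, nbr u i = v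
        · obtain ⟨i, hi⟩ := hadjv
          exact ⟨k + i, by omega, by rw [b7 i i.isLt, da, hi]⟩
        -- Such a `v` receives nothing, so it was active before; its stack entry cannot be the
        -- popped one, which held `u`.
        · have h0 : (d : ℝ) * G.w u v = 0 := by
            have := hG u fun x => if x = v then 1 else 0
            simp only [mul_ite, mul_one, mul_zero, Finset.sum_ite_eq', Finset.mem_univ,
              if_true] at this
            rw [← this]
            refine Finset.sum_eq_zero fun i _ => if_neg fun h => hadjv ⟨i, h⟩
          have h0' : G.w u v = 0 := by
            rcases mul_eq_zero.1 h0 with h | h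
            · exact absurd (by exact_mod_cast h) hd0.ne'
            · exact h
          rw [hres, if_neg hvu, h0', mul_zero, add_zero] at hv
          obtain ⟨a, ha, hav⟩ := hτ.active v hv
          have hak : a < k := by
            rcases lt_or_eq_of_le (by omega : a ≤ k) with h | rfl
            · exact h
            · rw [hu] at hav
              exact absurd (Fin.ext hav.symm) hvu
          exact ⟨a, by omega, by rw [b6 a hak, hav]⟩
      · rw [hres]
        have h1 : 0 ≤ (1 - α) * ε / 2 * G.w u v :=
          mul_nonneg (div_nonneg (mul_nonneg (by linarith) hε.le) (by norm_num)) (G.nonneg _ _)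
        -- At `u` the residual was at least ε, and ε(1+α)/2 ≤ ε is removed.
        split_ifs with hvu
        · subst hvu; nlinarith
        · linarith [hτ.nonneg v]
      · have := hτ.solves.push u
        simpa only [hcnt, hres] using this
    refine ⟨hinv, ?_⟩
    have hs := hinv.sum_le hα hε
    have hs' : ∑ v : Fin n, υ.iarr 3 0 v = ∑ v : Fin n, τ.iarr 3 0 v + 1 := by
      have : ∀ v : Fin n, υ.iarr 3 0 v = τ.iarr 3 0 v + if v = u then 1 else 0 := by
        intro v; rw [hcnt]; split_ifs <;> simp
      simp only [this, Finset.sum_add_distrib, Finset.sum_ite_eq', Finset.mem_univ, if_true]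
    rw [← hN] at hs
    rw [hs'] at hs ⊢
    rw [b2, hk]
    obtain ⟨D, hD⟩ : ∃ D, N = ∑ v : Fin n, τ.iarr 3 0 v + 1 + D := Nat.exists_eq_add_of_le hs
    have e1 : N - (∑ v : Fin n, τ.iarr 3 0 v + 1) = D := by omega
    have e2 : N - ∑ v : Fin n, τ.iarr 3 0 v = D + 1 := by omega
    rw [e1, e2]
    ring_nf
    omega
  · refine ⟨_, start (Runs.ite (T := 1) (fun h => absurd (htest.1 h) hpush)
      (fun h => Runs.skip ⟨⟨hag, hτ.levels, fun a ha => ?_, fun v hv => ?_, hτ.nonneg, hτ.solves⟩,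
        ?_⟩))⟩
    · have : τ'.ireg 3 = k := by simp [hτ']
      exact hτ.stack a (by omega)
    · have h1 : τ'.ireg 3 = k := by simp [hτ']
      obtain ⟨a, ha, hav⟩ := hτ.active v hv
      refine ⟨a, ?_, hav⟩
      rw [h1]
      rcases lt_or_eq_of_le (by omega : a ≤ k) with h | rfl
      · exact h
      · rw [hu] at hav
        have : v = u := Fin.ext hav.symm
        rw [this] at hv
        exact absurd hv hpush
    · have h1 : τ'.ireg 3 = k := by simp [hτ']
      have h2 : ∀ v : Fin n, τ'.iarr 3 0 v = τ.iarr 3 0 v := fun _ => rfl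
      simp only [h2]
      rw [h1, hk]
      omega

/-! ## Sweep over the level sets of the push counts -/

/-- The boundary of the list with number `j` as it is computed by the local algorithm. -/
def scanValue (σ : Store) (j : ℕ) : ℝ :=
  (∑ a ∈ Finset.range (σ.iarr 5 0 j), ∑ i ∈ Finset.range (σ.ireg 1),
    if σ.iarr 3 0 (σ.iarr 0 (σ.iarr 4 j a) i) < j then 1 else 0) / σ.ireg 1

/-- Computes size (register 6) and boundary (real register 8) of the list with the number in
register 8. -/
def scanProgram : Program :=
  .seq (.setI 6 (.get 5 (.const 0) (.reg 8)))
  (.seq (.setR 8 (.ofInt (.const 0)))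
  (.seq (.for 9 (.reg 6)
    (.seq (.setI 4 (.get 4 (.reg 8) (.reg 9)))
    (.for 5 (.reg 1)
      (.ite (.ltI (.get 3 (.const 0) (.get 0 (.reg 4) (.reg 5))) (.reg 8))
        (.setR 8 (.add (.reg 8) (.ofInt (.const 1)))) .skip))))
  (.setR 8 (.div (.reg 8) (.ofInt (.reg 1))))))

lemma scanProgram_runs (σ : Store) :
    Runs scanProgram σ (σ.iarr 5 0 (σ.ireg 8) * (4 * σ.ireg 1 + 5) + 5) fun τ =>
      Agree ⟨[4, 5, 6, 9], [8], [], []⟩ σ τ ∧ τ.ireg 6 = σ.iarr 5 0 (σ.ireg 8) ∧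
      τ.rreg 8 = scanValue σ (σ.ireg 8) := by
  set j := σ.ireg 8 with hj
  set l := σ.iarr 5 0 j with hl
  set d := σ.ireg 1 with hd
  set M : Footprint := ⟨[4, 5, 6, 9], [8], [], []⟩
  set g : ℕ → ℝ := fun a => ∑ i ∈ Finset.range d,
    if σ.iarr 3 0 (σ.iarr 0 (σ.iarr 4 j a) i) < j then 1 else 0 with hg
  have key := Runs.for (x := 9) (e := .reg 6) (T := 1 + (d * (2 + 2) + 2)) (N := l)
    (σ := (σ.setI 6 l).setR 8 ((0 : ℕ) : ℝ))
    (p := .seq (.setI 4 (.get 4 (.reg 8) (.reg 9)))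
      (.for 5 (.reg 1)
      (.ite (.ltI (.get 3 (.const 0) (.get 0 (.reg 4) (.reg 5))) (.reg 8))
        (.setR 8 (.add (.reg 8) (.ofInt (.const 1)))) .skip)))
    (fun a τ => Agree M σ τ ∧ τ.ireg 9 = a ∧ τ.ireg 6 = l ∧
      τ.rreg 8 = ∑ a ∈ Finset.range a, g a) ?_ ?_ ?_ ?_
  · refine Runs.mono (T := 1 + (1 + (l * (1 + (d * (2 + 2) + 2) + 2) + 2 + 1))) (Runs.seq (Runs.setI
      (Runs.seq (Runs.setR (Runs.seq (key.mono le_rfl ?_)))))) ?_ fun τ h => h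
    · rintro τ ⟨h1, -, h2, h3⟩
      refine Runs.setR ⟨h1.setR (by simp [M]), h2, ?_⟩
      have e1 : τ.ireg 1 = d := h1.ireg 1 (by simp [M])
      simp only [RExpr.eval, IExpr.eval, Store.setR_rreg, if_true, h3, e1]
      rfl
    · ring_nf; omega
  · exact ⟨(((Agree.refl _ σ).setI (by simp [M])).setR (by simp [M])).setI (by simp [M]),
      by simp, by simp, by simp⟩
  · rintro a τ ⟨-, -, h, -⟩; exact h
  · rintro a τ ⟨-, h, -⟩; exact h
  rintro a ha τ ⟨h1, h2, h3, h4⟩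
  have e8 : τ.ireg 8 = j := h1.ireg 8 (by simp [M])
  refine Runs.seq (Runs.setI ?_)
  have hu : (IExpr.get 4 (.reg 8) (.reg 9)).eval τ = σ.iarr 4 j a := by
    simp [IExpr.eval, e8, h2, h1.iarr 4 (by simp [M])]
  rw [hu]
  have row := Runs.for (x := 5) (e := .reg 1) (T := 2) (N := d)
    (σ := τ.setI 4 (σ.iarr 4 j a))
    (p := .ite (.ltI (.get 3 (.const 0) (.get 0 (.reg 4) (.reg 5))) (.reg 8))
        (.setR 8 (.add (.reg 8) (.ofInt (.const 1)))) .skip)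
    (fun i υ => Agree M σ υ ∧ υ.ireg 5 = i ∧ υ.ireg 9 = a ∧ υ.ireg 6 = l ∧
      υ.ireg 4 = σ.iarr 4 j a ∧
      υ.rreg 8 = ∑ a ∈ Finset.range a, g a + ∑ i ∈ Finset.range i,
        if σ.iarr 3 0 (σ.iarr 0 (σ.iarr 4 j a) i) < j then 1 else 0) ?_ ?_ ?_ ?_
  · refine row.mono le_rfl ?_
    rintro υ ⟨g1, g2, g3, g4, g5, g6⟩
    refine ⟨g3, g1.setI (by simp [M]), by simp, by simpa using g4, ?_⟩
    rw [Finset.sum_range_succ]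
    exact g6
  · exact ⟨(h1.setI (by simp [M])).setI (by simp [M]), by simp, by simpa using h2,
      by simpa using h3, by simp, by simpa using h4⟩
  · rintro i υ ⟨h, -⟩
    exact h.ireg 1 (by simp [M])
  · rintro i υ ⟨-, h, -⟩; exact h
  rintro i hi υ ⟨g1, g2, g3, g4, g5, g6⟩
  have c8 : υ.ireg 8 = j := g1.ireg 8 (by simp [M])
  have hb : (Test.ltI (.get 3 (.const 0) (.get 0 (.reg 4) (.reg 5))) (.reg 8)).holds υ ↔
      σ.iarr 3 0 (σ.iarr 0 (σ.iarr 4 j a) i) < j := by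
    simp [Test.holds, IExpr.eval, c8, g2, g5, g1.iarr 3 (by simp [M]), g1.iarr 0 (by simp [M])]
  refine Runs.ite (fun hh => Runs.setR ?_) (fun hh => Runs.skip ?_)
  · rw [hb] at hh
    refine ⟨by simpa using g2, (g1.setR (by simp [M])).setI (by simp [M]), by simp,
      by simpa using g3, by simpa using g4, by simpa using g5, ?_⟩
    simp only [Store.setI_rreg, Store.setR_rreg, if_true, RExpr.eval, IExpr.eval, g6,
      Finset.sum_range_succ, hh, Nat.cast_one]
    ring
  · rw [hb] at hh
    refine ⟨g2, g1.setI (by simp [M]), by simp, by simpa using g3, by simpa using g4,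
      by simpa using g5, ?_⟩
    simp only [Store.setI_rreg, g6, Finset.sum_range_succ, hh, if_false, add_zero]

/-- Finds the best admissible list; its number is stored in register 7. -/
def listSweepProgram : Program :=
  .seq (.setI 8 (.const 1)) (.loop (.ltI (.const 0) (.get 5 (.const 0) (.reg 8)))
    (.seq scanProgram
    (.seq (.ite (betterTest (.eqI (.const 0) (.const 0)))
      (.seq (.setI 7 (.reg 8)) (.setR 5 (.div (.reg 8) (.ofInt (.reg 6))))) .skip)
    (.setI 8 (.add (.reg 8) (.const 1))))))

/-- The lists are nested, so the first empty one ends the sweep. As numbering starts at 1, register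
7 can hold the best number and serve as the flag. -/
lemma listSweepProgram_runs {n : ℕ} (σ : Store) {c : Fin n → ℕ} (hc : HoldsLevels σ c)
    (h7 : σ.ireg 7 = 0) :
    Runs listSweepProgram σ ((4 * σ.ireg 1 + 15) * ∑ v, c v + 2) fun τ =>
      Agree ⟨[4, 5, 6, 7, 8, 9], [5, 8], [], []⟩ σ τ ∧ ∃ k,
      (Finset.univ.filter fun v => k ≤ c v) = ∅ ∧
      BestBelow (fun j => 1 ≤ j ∧ 0 < σ.iarr 5 0 j ∧ (σ.iarr 5 0 j : ℝ) ≤ 3 * (σ.ireg 2 * σ.rreg 2))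
        (fun j => scanValue σ j / σ.iarr 5 0 j) k (τ.ireg 7) (τ.rreg 5) (fun j => τ.ireg 7 = j) := by
  set d := σ.ireg 1 with hd
  set M : Footprint := ⟨[4, 5, 6, 7, 8, 9], [5, 8], [], []⟩
  set adm : ℕ → Prop := fun j => 1 ≤ j ∧ 0 < σ.iarr 5 0 j ∧
    (σ.iarr 5 0 j : ℝ) ≤ 3 * (σ.ireg 2 * σ.rreg 2) with hadm
  set val : ℕ → ℝ := fun j => scanValue σ j / σ.iarr 5 0 j with hval
  have key := Runs.loop (b := .ltI (.const 0) (.get 5 (.const 0) (.reg 8)))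
    (p := .seq scanProgram
      (.seq (.ite (betterTest (.eqI (.const 0) (.const 0)))
      (.seq (.setI 7 (.reg 8)) (.setR 5 (.div (.reg 8) (.ofInt (.reg 6))))) .skip)
      (.setI 8 (.add (.reg 8) (.const 1)))))
    (σ := σ.setI 8 1)
    (fun τ => Agree M σ τ ∧ 1 ≤ τ.ireg 8 ∧
      BestBelow adm val (τ.ireg 8) (τ.ireg 7) (τ.rreg 5) (fun j => τ.ireg 7 = j))
    (fun τ => (4 * d + 15) * ∑ v, (c v + 1 - τ.ireg 8)) ?_ ?_
  · refine Runs.mono (Runs.seq (T := 1) (Runs.setI key)) ?_ ?_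
    · simp only [Store.setI_ireg, if_true, Nat.add_sub_cancel]
      omega
    · rintro τ ⟨⟨h1, h2, h3⟩, h4⟩
      refine ⟨h1, τ.ireg 8, ?_, h3⟩
      have h5 : ¬ 0 < τ.iarr 5 0 (τ.ireg 8) := h4
      rw [h1.iarr 5 (by simp [M]), (hc _ h2).1, Nat.pos_iff_ne_zero, not_not,
        Finset.card_eq_zero] at h5
      exact h5
  · rintro τ ⟨h1, h2, h3⟩ hb
    set k := τ.ireg 8 with hk
    have e5 := h1.iarr 5 (by simp [M])
    have e1 : τ.ireg 1 = d := h1.ireg 1 (by simp [M])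
    have hl : 0 < σ.iarr 5 0 k := by
      have : 0 < τ.iarr 5 0 (τ.ireg 8) := hb
      rwa [e5] at this
    have hscan : scanValue τ k = scanValue σ k := by
      simp only [scanValue, e5, h1.iarr 3 (by simp [M]), h1.iarr 4 (by simp [M]),
        h1.iarr 0 (by simp [M]), h1.ireg 1 (by simp [M])]
    -- Passing list `k` lowers the potential in proportion to its length, and the lengths add up to
    -- the number of pushes; the sweep never pays for untouched vertices.
    have hsum : ∑ v, (c v + 1 - k) = ∑ v, (c v + 1 - (k + 1)) + σ.iarr 5 0 k := by
      rw [(hc k h2).1, Finset.card_filter, ← Finset.sum_add_distrib]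
      refine Finset.sum_congr rfl fun v _ => ?_
      split_ifs <;> omega
    refine ⟨_, Runs.seq (T' := 3 + 1) ((scanProgram_runs τ).mono le_rfl ?_)⟩
    rw [← hk, e5, e1]
    rintro υ ⟨g1, g2, g3⟩
    rw [hscan] at g3
    have hag : Agree M σ υ := h1.trans (g1.mono (by simp [M]) (by simp [M]) (by simp [M])
      (by simp [M]))
    have d8 : υ.ireg 8 = k := g1.ireg 8 (by simp)
    have d7 : υ.ireg 7 = τ.ireg 7 := g1.ireg 7 (by simp)
    have d5 : υ.rreg 5 = τ.rreg 5 := g1.rreg 5 (by simp)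
    have d2 : υ.ireg 2 = σ.ireg 2 := hag.ireg 2 (by simp [M])
    have d2r : υ.rreg 2 = σ.rreg 2 := hag.rreg 2 (by simp [M])
    have htest : (betterTest (.eqI (.const 0) (.const 0))).holds υ ↔
        adm k ∧ (τ.ireg 7 = 0 ∨ val k < τ.rreg 5) := by
      rw [betterTest_holds]
      simp only [Test.holds, IExpr.eval, d2, d2r, d7, d5, g2, g3, hadm, hval, h2,
        hl, true_and]
    have htime : (4 * d + 15) * ∑ v, (c v + 1 - (k + 1)) +
        (σ.iarr 5 0 k * (4 * d + 5) + 5 + (3 + 1)) + 1 ≤ (4 * d + 15) * ∑ v, (c v + 1 - k) := by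
      rw [hsum]; nlinarith
    have finish : ∀ ω : Store, Agree M σ ω → ω.ireg 8 = k →
        BestBelow adm val (k + 1) (ω.ireg 7) (ω.rreg 5) (fun j => ω.ireg 7 = j) →
        Runs (.setI 8 (.add (.reg 8) (.const 1))) ω 1 fun τ' =>
          (Agree M σ τ' ∧ 1 ≤ τ'.ireg 8 ∧
            BestBelow adm val (τ'.ireg 8) (τ'.ireg 7) (τ'.rreg 5) (fun j => τ'.ireg 7 = j)) ∧
          (4 * d + 15) * ∑ v, (c v + 1 - τ'.ireg 8) +
            (σ.iarr 5 0 k * (4 * d + 5) + 5 + (3 + 1)) + 1 ≤ (4 * d + 15) * ∑ v, (c v + 1 - k) := by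
      intro ω hω hω8 hbest
      refine Runs.setI ?_
      simp only [IExpr.eval, hω8]
      refine ⟨⟨hω.setI (by simp [M]), by simp, by simpa using hbest⟩, ?_⟩
      simpa using htime
    refine Runs.seq (T := 3) (T' := 1) (Runs.ite (T := 2) (fun hh => ?_) (fun hh => ?_))
    · rw [htest] at hh
      refine Runs.seq (T := 1) (T' := 1) (Runs.setI (Runs.setR (finish _ ?_ ?_ ?_)))
      · exact (hag.setI (by simp [M])).setR (by simp [M])
      · simpa using d8
      · have := h3.replace (P' := fun j => k = j) (b' := k) hh.1 hh.2 rfl (by omega)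
        simpa [IExpr.eval, RExpr.eval, g2, g3, d8] using this
    · rw [htest] at hh
      refine (Runs.skip (finish _ hag d8 ?_)).mono (by norm_num) fun τ h => h
      have := h3.keep hh
      simpa [d7, d5] using this
  · refine ⟨(Agree.refl _ σ).setI (by simp [M]), by simp, ?_⟩
    refine Or.inl ⟨by simpa using h7, fun j hj hadmj => ?_⟩
    have h1 : 1 ≤ j := hadmj.1
    simp at hj
    omega

/-- Copies the list with the number in register 7 to the output. -/
def copyProgram : Program :=
  .seq (.setI 0 (.const 0)) (.ite (.eqI (.reg 7) (.const 0)) .skip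
    (.seq (.setI 0 (.get 5 (.const 0) (.reg 7)))
    (.for 4 (.reg 0) (.putI 1 (.const 0) (.reg 4) (.get 4 (.reg 7) (.reg 4))))))

lemma copyProgram_runs {n : ℕ} (σ : Store) {c : Fin n → ℕ} (hc : HoldsLevels σ c) :
    Runs copyProgram σ (3 * ∑ v, c v + 5) fun τ => τ.Holds
      (if σ.ireg 7 = 0 then ∅ else Finset.univ.filter fun v => σ.ireg 7 ≤ c v) := by
  set j := σ.ireg 7 with hj
  by_cases h7 : j = 0
  · rw [if_pos h7]
    refine (Runs.seq (T := 1) (T' := 1 + 1) (Runs.setI (Runs.ite (fun h => Runs.skip ?_)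
      (fun h => ?_)))).mono (by omega) fun τ h => h
    · simp [Store.Holds, IExpr.eval]
    · refine absurd ?_ h
      simpa [Test.holds, IExpr.eval] using h7
  rw [if_neg h7]
  obtain ⟨h1, h2⟩ := hc j (by omega)
  set l := σ.iarr 5 0 j with hl
  have hle : l ≤ ∑ v, c v := by
    rw [h1, Finset.card_filter]
    refine Finset.sum_le_sum fun v _ => ?_
    split_ifs <;> omega
  set M : Footprint := ⟨[0, 4], [], [1], []⟩
  refine Runs.mono (T := 1 + (1 + (l * (1 + 2) + 2) + 1)) ?_ (by omega) fun τ h => h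
  refine Runs.seq (Runs.setI (Runs.ite (fun h => ?_) (fun h => Runs.seq (Runs.setI ?_))))
  · exact absurd (by simpa [Test.holds, IExpr.eval] using h) h7
  have he : (IExpr.get 5 (.const 0) (.reg 7)).eval (σ.setI 0 ((IExpr.const 0).eval σ)) = l := by
    simp [IExpr.eval, hl, hj]
  rw [he]
  have key := Runs.for (x := 4) (e := .reg 0) (T := 1) (N := l)
    (σ := (σ.setI 0 ((IExpr.const 0).eval σ)).setI 0 l)
    (p := .putI 1 (.const 0) (.reg 4) (.get 4 (.reg 7) (.reg 4)))
    (fun a τ => Agree M σ τ ∧ τ.ireg 4 = a ∧ τ.ireg 0 = l ∧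
      ∀ b < a, τ.iarr 1 0 b = σ.iarr 4 j b) ?_ ?_ ?_ ?_
  · refine key.mono le_rfl ?_
    rintro τ ⟨-, -, g1, g2⟩
    refine ⟨g1.trans h1, ?_⟩
    rw [g1, ← h2]
    exact (Finset.image_congr fun b hb => g2 b (Finset.mem_range.1 (Finset.mem_coe.1 hb))).symm
  · exact ⟨(((Agree.refl _ σ).setI (by simp [M])).setI (by simp [M])).setI (by simp [M]), by simp,
      by simp, by simp⟩
  · rintro a τ ⟨-, -, h, -⟩; exact h
  · rintro a τ ⟨-, h, -⟩; exact h
  rintro a ha τ ⟨g1, g2, g3, g4⟩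
  refine Runs.putI ⟨by simpa using g2, (g1.putI (by simp [M])).setI (by simp [M]), by simp,
    by simpa using g3, fun b hb => ?_⟩
  simp only [IExpr.eval, Store.setI_iarr, Store.putI_iarr, true_and, g2,
    g1.ireg 7 (by simp [M]), g1.iarr 4 (by simp [M])]
  split_ifs with hba
  · rw [hba]
  · exact g4 b (by omega)

/-- A list is as long as the set it enumerates, so its entries are distinct and counting over
positions is counting over vertices; each counted edge weighs 1/d. -/
lemma scanValue_eq {n d : ℕ} {G : WeightedGraph (Fin n)} {nbr : Fin n → Fin d → Fin n}
    (hG : ∀ u (g : Fin n → ℝ), ∑ i, g (nbr u i) = d * ∑ v, G.w u v * g v) {σ : Store}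
    (hd : σ.ireg 1 = d) (hd0 : 0 < d) (hadj : ∀ (v : Fin n) (i : Fin d), σ.iarr 0 v i = nbr v i)
    (hlev : HoldsLevels σ fun v : Fin n => σ.iarr 3 0 v) {j : ℕ} (hj : 1 ≤ j) {L : Finset (Fin n)}
    (hL : ∀ v : Fin n, v ∈ L ↔ j ≤ σ.iarr 3 0 v) :
    scanValue σ j / σ.iarr 5 0 j = G.edgeExp L := by
  obtain ⟨h1, h2⟩ := hlev j hj
  have hset : (Finset.univ.filter fun v : Fin n => j ≤ σ.iarr 3 0 v) = L := by
    ext v; simp [hL]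
  rw [hset] at h1 h2
  have hinj : Set.InjOn (σ.iarr 4 j) (Finset.range (σ.iarr 5 0 j)) := by
    rw [← Finset.card_image_iff, h2, Finset.card_map, Finset.card_range, h1]
  have hd' : (d : ℝ) ≠ 0 := by exact_mod_cast hd0.ne'
  have hcut : scanValue σ j = G.cut L Lᶜ := by
    rw [scanValue, ← Finset.sum_image (g := σ.iarr 4 j) (s := Finset.range (σ.iarr 5 0 j))
      (f := fun x => ∑ i ∈ Finset.range (σ.ireg 1),
        if σ.iarr 3 0 (σ.iarr 0 x i) < j then (1 : ℝ) else 0) hinj, h2, Finset.sum_map, hd,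
      Finset.sum_div]
    refine Finset.sum_congr rfl fun u _ => ?_
    rw [Finset.sum_range]
    have h3 := hG u fun v => if σ.iarr 3 0 v < j then 1 else 0
    simp only [Fin.valEmbedding_apply, hadj]
    rw [h3, mul_div_cancel_left₀ _ hd']
    have h4 : Lᶜ = Finset.univ.filter fun v : Fin n => σ.iarr 3 0 v < j := by
      ext v; simp [hL]
    rw [h4, Finset.sum_filter]
    refine Finset.sum_congr rfl fun v _ => ?_
    split_ifs <;> simp
  rw [hcut, h1]
  rfl

/-! ## The local algorithm for regular graphs -/

/-- The only link between adjacency lists and weights that the analysis of the local program uses.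
-/
lemma sum_nbr {n d : ℕ} {H : SimpleGraph (Fin n)} [DecidableRel H.Adj] (hd : 0 < d)
    (hreg : H.IsRegularOfDegree d) {nbr : Fin n → Fin d → Fin n} (h : IsAdjacencyList H nbr)
    (u : Fin n) (g : Fin n → ℝ) :
    ∑ i, g (nbr u i) = d * ∑ v, (ofRegular H d hd hreg).w u v * g v := by
  have hd' : (d : ℝ) ≠ 0 := by exact_mod_cast hd.ne'
  have h1 : Finset.univ.image (nbr u) = Finset.univ.filter fun v => H.Adj u v := by
    ext v
    simp [(h u).2 v]
  rw [← Finset.sum_image (g := nbr u) (f := g) fun i _ j _ hij => (h u).1 hij, h1,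
    Finset.sum_filter, Finset.mul_sum]
  refine Finset.sum_congr rfl fun v _ => ?_
  simp only [ofRegular]
  split_ifs
  · field_simp
  · simp

/-- Prepares the push loop. -/
def setupProgram : Program :=
  .seq (.setR 3 (.div (.ofInt (.const 1)) (.mul (.ofInt (.const 6)) (.ofInt (.reg 2)))))
  (.seq (.setR 4 (.div (.mul (.reg 3) (.add (.ofInt (.const 1)) (.reg 1))) (.ofInt (.const 2))))
  (.seq (.setR 6 (.div (.mul (.sub (.ofInt (.const 1)) (.reg 1)) (.reg 3))
    (.mul (.ofInt (.const 2)) (.ofInt (.reg 1)))))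
  (.seq (.putR 0 (.const 0) (.reg 0) (.ofInt (.const 1)))
  (.seq (.putI 2 (.const 0) (.const 0) (.reg 0))
  (.setI 3 (.const 1))))))

lemma setupProgram_runs (σ : Store) :
    Runs setupProgram σ 6 fun τ => Agree ⟨[3], [3, 4, 6], [2], [0]⟩ σ τ ∧
      τ.rreg 3 = 1 / (6 * σ.ireg 2) ∧
      τ.rreg 4 = 1 / (6 * σ.ireg 2) * (1 + σ.rreg 1) / 2 ∧
      τ.rreg 6 = (1 - σ.rreg 1) * (1 / (6 * σ.ireg 2)) / (2 * σ.ireg 1) ∧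
      τ.ireg 3 = 1 ∧ τ.iarr 2 0 0 = σ.ireg 0 ∧
      ∀ x, τ.rarr 0 0 x = if x = σ.ireg 0 then 1 else σ.rarr 0 0 x := by
  refine Runs.mono (T := 1 + (1 + (1 + (1 + (1 + 1))))) (Runs.seq (Runs.setR (Runs.seq (Runs.setR
    (Runs.seq (Runs.setR (Runs.seq (Runs.putR (Runs.seq (Runs.putI (Runs.setI ?_)))))))))))
    le_rfl fun τ h => h
  refine ⟨?_, ?_, ?_, ?_, ?_, ?_, fun x => ?_⟩
  · exact ((((((Agree.refl _ σ).setR (by simp)).setR (by simp)).setR (by simp)).putR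
      (by simp)).putI (by simp)).setI (by simp)
  all_goals simp [RExpr.eval, IExpr.eval]

/-- Approximates the pagerank vector by pushes and outputs its best admissible level set. -/
def localProgram : Program :=
  .seq alphaProgram (.seq logProgram (.seq setupProgram (.seq pushLoopProgram
    (.seq listSweepProgram copyProgram))))

/-- The vector is αε times the push counts, and `q` is the final residual. The whole vertex set is
excluded from the comparison because only the lists with numbers `j ≥ 1` are swept. -/
lemma localProgram_runs {n d : ℕ} {G : WeightedGraph (Fin n)} {nbr : Fin n → Fin d → Fin n}
    (hG : ∀ u (g : Fin n → ℝ), ∑ i, g (nbr u i) = d * ∑ v, G.w u v * g v) (hd0 : 0 < d)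
    (s : Fin n) {m : ℕ} (hm : 1 ≤ m) {φ : ℝ} (hφ : 0 < φ) :
    ∃ (S' : Finset (Fin n)) (q r : Fin n → ℝ),
      Runs localProgram (localInput nbr s m φ)
        (3 * m + 24 + (15 * d + 38) * ⌊1 / (min 1 (100 * φ) * (1 / (6 * m)))⌋₊)
        (fun τ => τ.Holds S') ∧
      (∀ v, 0 ≤ q v ∧ q v ≤ 1 / (6 * m)) ∧
      G.Solves (min 1 (100 * φ)) (Pi.single s 1 - q) r ∧ (∀ v, 0 ≤ r v) ∧
      IsLevelSet r S' ∧ (S'.card : ℝ) ≤ 3 * (m * logApprox m) ∧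
      ∀ t, (level r t).Nonempty → (level r t).card < n →
        ((level r t).card : ℝ) ≤ 3 * (m * logApprox m) →
        S'.Nonempty ∧ G.edgeExp S' ≤ G.edgeExp (level r t) := by
  set α := min 1 (100 * φ) with hα
  have hα0 : 0 < α := by rw [hα]; positivity
  have hα1 : α ≤ 1 := min_le_left _ _
  have hm0 : (0 : ℝ) < m := by exact_mod_cast hm
  set ε : ℝ := 1 / (6 * m) with hε
  have hε0 : 0 < ε := by positivity
  set N := ⌊1 / (α * ε)⌋₊ with hN
  set σ := localInput nbr s m φ with hσ
  have i0 : σ.ireg 0 = s := rfl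
  have i1 : σ.ireg 1 = d := rfl
  have i2 : σ.ireg 2 = m := rfl
  have i7 : σ.ireg 7 = 0 := rfl
  have r0 : σ.rreg 0 = φ := rfl
  have hadj : ∀ (v : Fin n) (i : Fin d), σ.iarr 0 v i = nbr v i := fun v i => by
    simp [hσ, localInput]
  have hz : ∀ a, a ≠ 0 → ∀ i j, σ.iarr a i j = 0 := fun a ha i j => by
    simp [hσ, localInput, ha]
  have hzr : ∀ a i j, σ.rarr a i j = 0 := fun a i j => rfl
  have hL0 : 0 ≤ logApprox m := Finset.sum_nonneg fun i _ => by positivity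
  have run : Runs localProgram σ (3 * m + 24 + (15 * d + 38) * N) fun τ =>
      ∃ (ω : Store) (ω₀ : Store) (k b : ℕ) (v : ℝ),
      PushInvariant G s α ε ω₀ ω ∧ (∀ v : Fin n, ω.rarr 0 0 v < ε) ∧ ω.ireg 1 = d ∧
      (∀ (v : Fin n) (i : Fin d), ω.iarr 0 v i = nbr v i) ∧
      (Finset.univ.filter fun v : Fin n => k ≤ ω.iarr 3 0 v) = ∅ ∧
      BestBelow (fun j => 1 ≤ j ∧ 0 < ω.iarr 5 0 j ∧ (ω.iarr 5 0 j : ℝ) ≤ 3 * (m * logApprox m))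
        (fun j => scanValue ω j / ω.iarr 5 0 j) k b v (fun j => b = j) ∧
      τ.Holds (if b = 0 then ∅ else Finset.univ.filter fun v : Fin n => b ≤ ω.iarr 3 0 v) := by
    refine Runs.mono (T := 2 + (3 * m + 3 + (6 + (((11 * d + 20) * N + 6) + (((4 * d + 15) * N + 2) +
      (3 * N + 5)))))) ?_ (by ring_nf; omega) fun τ h => h
    refine Runs.seq ((alphaProgram_runs σ).mono le_rfl ?_)
    rintro _ rfl
    rw [r0, ← hα]
    refine Runs.seq ((logProgram_runs (σ.setR 1 α)).mono (by rw [Store.setR_ireg, i2]) ?_)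
    rintro σ2 ⟨a2, l2⟩
    simp only [Store.setR_ireg, i2] at l2
    have b2 : Agree ⟨[3], [1, 2], [], []⟩ σ σ2 := by
      refine Agree.trans ((Agree.refl _ σ).setR (x := 1) (y := α) (by simp)) (a2.mono ?_ ?_ ?_ ?_)
        <;> simp
    have e1 : σ2.rreg 1 = α := (a2.rreg 1 (by simp)).trans (by simp)
    have n2 : σ2.ireg 1 = d := (b2.ireg 1 (by simp)).trans i1
    have m2 : σ2.ireg 2 = m := (b2.ireg 2 (by simp)).trans i2
    have s2 : σ2.ireg 0 = s := (b2.ireg 0 (by simp)).trans i0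
    refine Runs.seq ((setupProgram_runs σ2).mono le_rfl ?_)
    rintro σ3 ⟨a3, h1, h2, h3, h4, h5, h6⟩
    rw [e1] at h2 h3
    rw [m2, ← hε] at h1 h2 h3
    rw [n2] at h3
    rw [s2] at h5
    have b3 : Agree ⟨[3], [1, 2, 3, 4, 6], [2], [0]⟩ σ σ3 := by
      refine Agree.trans (b2.mono ?_ ?_ ?_ ?_) (a3.mono ?_ ?_ ?_ ?_) <;> simp
    have hcnt : ∀ v, σ3.iarr 3 0 v = 0 := fun v => (b3.iarr 3 (by simp) 0 v).trans (hz 3 (by simp) _ _)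
    have hlsz : ∀ j, σ3.iarr 5 0 j = 0 := fun v =>
      (b3.iarr 5 (by simp) 0 v).trans (hz 5 (by simp) _ _)
    have hres : ∀ v : Fin n, σ3.rarr 0 0 v = if v = s then 1 else 0 := by
      intro v
      rw [h6, s2, b2.rarr 0 (by simp), hzr]
      simp only [Fin.ext_iff]
    have inv : PushInvariant G s α ε σ3 σ3 := by
      refine ⟨Agree.refl _ _, fun j hj => ?_, fun a ha => ?_, fun v hv => ?_, fun v => ?_, ?_⟩
      · have : (Finset.univ.filter fun v : Fin n => j ≤ σ3.iarr 3 0 v) = ∅ := by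
          refine Finset.filter_false_of_mem fun v _ => ?_
          rw [hcnt]; omega
        rw [this, hlsz]
        simp
      · rw [h4] at ha
        obtain rfl : a = 0 := by omega
        exact ⟨s, h5⟩
      · rw [hres] at hv
        split_ifs at hv with hvs
        · exact ⟨0, by omega, by rw [h5, hvs]⟩
        · linarith
      · rw [hres]; split_ifs <;> norm_num
      · intro v
        simp only [hcnt, Pi.sub_apply, hres, Pi.single_apply]
        simp
    refine Runs.seq ((pushLoopProgram_runs hG hα0 hα1 hε0 ((b3.ireg 1 (by simp)).trans i1) hd0
      (fun v i => (b3.iarr 0 (by simp) v i).trans (hadj v i)) h1 h2 h3 h4 inv).mono le_rfl ?_)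
    rintro ω ⟨hω, hsmall⟩
    have b4 : Agree ⟨[3, 4, 5, 6], [1, 2, 3, 4, 6], [2, 3, 4, 5], [0]⟩ σ ω := by
      refine Agree.trans (b3.mono ?_ ?_ ?_ ?_) (hω.agree.mono ?_ ?_ ?_ ?_) <;> simp
    have n4 : ω.ireg 1 = d := (b4.ireg 1 (by simp)).trans i1
    have m4 : ω.ireg 2 = m := (b4.ireg 2 (by simp)).trans i2
    have l4 : ω.rreg 2 = logApprox m :=
      (hω.agree.rreg 2 (by simp)).trans ((a3.rreg 2 (by simp)).trans l2)
    have hsum := hω.sum_le hα0 hε0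
    refine Runs.seq ((listSweepProgram_runs ω hω.levels ((b4.ireg 7 (by simp)).trans i7)).mono
      (by rw [n4]; gcongr) ?_)
    rintro υ ⟨a5, k, hk, hbest⟩
    rw [m4, l4] at hbest
    have hlev : HoldsLevels υ fun v : Fin n => ω.iarr 3 0 v := by
      intro j hj
      have h7 := hω.levels j hj
      have e4 : υ.iarr 4 j = ω.iarr 4 j := funext fun a => a5.iarr 4 (by simp) j a
      rw [a5.iarr 5 (by simp), e4]
      exact h7
    refine (copyProgram_runs υ hlev).mono (by gcongr) ?_
    intro τ hτ
    exact ⟨ω, σ3, k, υ.ireg 7, υ.rreg 5, hω, hsmall, n4,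
      fun v i => (b4.iarr 0 (by simp) v i).trans (hadj v i), hk, hbest, hτ⟩
  obtain ⟨t, τ, h1, h2, ω, ω₀, k, b, v, hω, hsmall, hωd, hωadj, hk, hbest, hout⟩ := run
  set r : Fin n → ℝ := fun v => α * ε * ω.iarr 3 0 v with hr
  have hαε : 0 < α * ε := by positivity
  have hr0 : ∀ v, 0 ≤ r v := fun v => by rw [hr]; positivity
  have hmem : ∀ (j : ℕ) (v : Fin n), v ∈ level r (α * ε * j) ↔ j ≤ ω.iarr 3 0 v := by
    intro j v
    rw [mem_level, hr]
    simp only [mul_le_mul_iff_right₀ hαε, Nat.cast_le]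
  have hval : ∀ j, 1 ≤ j → scanValue ω j / ω.iarr 5 0 j = G.edgeExp (level r (α * ε * j)) :=
    fun j hj => scanValue_eq hG hωd hd0 hωadj hω.levels hj (hmem j)
  have hset : ∀ j, (Finset.univ.filter fun v : Fin n => j ≤ ω.iarr 3 0 v) = level r (α * ε * j) :=
    fun j => by ext v; rw [hmem]; simp
  have hsize : ∀ j, 1 ≤ j → ω.iarr 5 0 j = (level r (α * ε * j)).card := fun j hj => by
    rw [(hω.levels j hj).1, hset]
  -- Height 0 already gives all vertices, so a proper level set corresponds to a count of at least
  -- 1; being nonempty, it comes before the empty list `k`.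
  have hlevel : ∀ t, (level r t).Nonempty → (level r t).card < n →
      ∃ j, 1 ≤ j ∧ j < k ∧ level r t = level r (α * ε * j) := by
    intro t ht htn
    obtain ⟨u, hu⟩ := exists_level_eq ht
    refine ⟨ω.iarr 3 0 u, ?_, ?_, hu⟩
    · by_contra! h0
      have h0 : ω.iarr 3 0 u = 0 := by omega
      have : level r t = Finset.univ := by
        rw [hu, Finset.eq_univ_iff_forall]
        intro x
        have hru : r u = 0 := by simp [hr, h0]
        rw [mem_level, hru]
        exact hr0 x
      rw [this, Finset.card_univ, Fintype.card_fin] at htn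
      exact lt_irrefl _ htn
    · by_contra! h0
      have : u ∈ (Finset.univ.filter fun v : Fin n => k ≤ ω.iarr 3 0 v) := by simp [h0]
      rw [hk] at this
      simp at this
  refine ⟨_, fun v => ω.rarr 0 0 v, r, ⟨t, τ, h1, h2, hout⟩,
    fun v => ⟨hω.nonneg v, (hsmall v).le⟩, hω.solves, hr0, ?_⟩
  rcases hbest with ⟨hb, hno⟩ | ⟨hb, j, hj, hj1, rfl, -, hj2⟩
  · rw [if_pos hb]
    refine ⟨?_, ?_, fun t ht htn htc => ?_⟩
    · obtain ⟨y, hy⟩ := exists_level_eq_empty r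
      exact hy ▸ isLevelSet_level r y
    · simp only [Finset.card_empty, Nat.cast_zero]; positivity
    · obtain ⟨j, hj1, hjk, hj⟩ := hlevel t ht htn
      rw [hj, ← hsize j hj1] at htc
      rw [hj, ← Finset.card_pos, ← hsize j hj1] at ht
      exact absurd ⟨hj1, ht, htc⟩ (hno j hjk)
  · rw [if_neg hb, hset]
    refine ⟨isLevelSet_level r _, ?_, fun t ht htn htc => ?_⟩
    · rw [← hsize b hj1.1]; exact hj1.2.2
    · obtain ⟨j, hj1', hjk, hj'⟩ := hlevel t ht htn
      rw [hj', ← Finset.card_pos, ← hsize j hj1'] at ht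
      rw [hj', ← hsize j hj1'] at htc
      have h3 : scanValue ω b / ω.iarr 5 0 b ≤ scanValue ω j / ω.iarr 5 0 j :=
        hj2 j hjk ⟨hj1', ht, htc⟩
      rw [hval _ hj1.1, hval _ hj1'] at h3
      rw [hj']
      refine ⟨?_, h3⟩
      rw [← Finset.card_pos, ← hsize b hj1.1]
      exact hj1.2.1

/-- The guarantee of the local algorithm for regular graphs. -/
theorem local_algorithm {n d : ℕ} (H : SimpleGraph (Fin n)) [DecidableRel H.Adj] (hd : 0 < d)
    (hreg : H.IsRegularOfDegree d) {nbr : Fin n → Fin d → Fin n} (hnbr : IsAdjacencyList H nbr)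
    {G : WeightedGraph (Fin n)} (hGH : G = ofRegular H d hd hreg) (S : Finset (Fin n))
    (hS : 2 ≤ S.card) (hφ : 0 < G.edgeExp S) (hn : 6 * ((S.card : ℝ) * Real.log S.card) ≤ n) :
    ∃ out : Fin n → Finset (Fin n),
      (∀ s ∈ S,
        localProgram.Outputs (localInput nbr s S.card (G.edgeExp S))
          (10000000 * (d * S.card * Real.log S.card / G.edgeExp S
            + S.card * Real.log S.card ^ 2)) (out s) ∧
        ∃ r : Fin n → ℝ,
          G.IsApproxPageRank s (min 1 (100 * G.edgeExp S)) (1 / (6 * S.card)) r ∧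
          IsLevelSet r (out s)) ∧
      S.card ≤ 2 * {s | s ∈ S ∧ Guarantee G 10000000 S (out s)}.ncard := by
  have hG : ∀ u (g : Fin n → ℝ), ∑ i, g (nbr u i) = d * ∑ v, G.w u v * g v := fun u g => by
    rw [hGH]; exact sum_nbr hd hreg hnbr u g
  set m := S.card with hm
  have hlog := WeightedGraph.log_ge_of_two_le hS
  have hm0 : (2 : ℝ) ≤ m := by exact_mod_cast hS
  set φ := G.edgeExp S with hφdef
  have hφ1 : φ ≤ 1 := G.edgeExp_le_one S
  set α := min 1 (100 * φ) with hα
  have hα0 : 0 < α := by rw [hα]; positivity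
  have hα1 : α ≤ 1 := min_le_left _ _
  have hφα : φ ≤ α := le_min hφ1 (by linarith)
  obtain ⟨hL1, hL2⟩ := logApprox_bounds (by omega : 1 ≤ m)
  choose p hp using fun s => G.exists_solves hα0 hα1 (Pi.single s 1 : Fin n → ℝ)
  choose out q r hrun hq hr hr0 hlev hcard hbest using fun s =>
    localProgram_runs hG hd s (by omega : 1 ≤ m) hφ
  refine ⟨out, fun s _ => ⟨(hrun s).outputs ?_, r s,
    WeightedGraph.isApproxPageRank_of_solves G (hq s) (hr s), hlev s⟩, ?_⟩
  · rw [← hα]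
    have hd1 : (1 : ℝ) ≤ d := by exact_mod_cast hd
    set N := ⌊1 / (α * (1 / (6 * (m : ℝ))))⌋₊
    -- Since φ ≤ 1, also φ ≤ α, so there are at most 6m/φ pushes. The bound to be proved has an
    -- additional factor log m ≥ 0.693 and a second summand, neither of which is needed.
    have hN : (N : ℝ) ≤ 6 * (m / φ) := by
      refine (Nat.floor_le (by positivity)).trans ?_
      have h1 : 1 / (α * (1 / (6 * (m : ℝ)))) = 6 * (m / α) := by field_simp
      rw [h1]
      gcongr
    have hmφ : (m : ℝ) ≤ m / φ := by
      rw [le_div_iff₀ hφ]; nlinarith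
    set X := (m : ℝ) / φ with hX
    have hX0 : 2 ≤ X := hm0.trans hmφ
    have hdX : X ≤ d * X := by nlinarith
    have h2 : (d : ℝ) * m * Real.log m / φ = d * X * Real.log m := by rw [hX]; ring
    have h3 : 0.693 * (d * X) ≤ d * X * Real.log m := by nlinarith
    have h4 : 0 ≤ (m : ℝ) * Real.log m ^ 2 := by positivity
    have h5 : (15 * (d : ℝ) + 38) * N ≤ 53 * d * (6 * X) := by
      have : (15 * (d : ℝ) + 38) ≤ 53 * d := by linarith
      gcongr
    rw [h2]
    push_cast
    nlinarith
  refine (WeightedGraph.card_le_two_mul_card_mass hα0 hα1 (c := 100) (by norm_num) (fun h => ?_)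
    fun s _ => hp s).trans ?_
  · rw [hα] at h ⊢
    exact min_eq_right (not_lt.1 fun h' => by rw [min_eq_left h'.le] at h; linarith)
  rw [← Set.ncard_coe_finset]
  refine Nat.mul_le_mul_left 2 (Set.ncard_le_ncard (fun s hs => ?_) (Set.toFinite _))
  rw [Finset.mem_coe, Finset.mem_filter] at hs
  refine ⟨hs.1, ?_⟩
  have hr1 : ∑ v, r s v ≤ 1 := by
    rw [(hr s).sum_univ hα0]
    simp only [Pi.sub_apply, Finset.sum_sub_distrib]
    have := Finset.sum_nonneg fun v (_ : v ∈ Finset.univ) => (hq s v).1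
    simp
    linarith
  -- The difference from the exact vector solves the equation with source `q`, so it is at most
  -- 1/(6m) pointwise by the maximum principle, and at most 1/6 over `S`.
  have hmass : ∑ v ∈ S, p s v - 1 / 6 ≤ ∑ v ∈ S, r s v := by
    have h1 := (hp s).sub (hr s)
    rw [sub_sub_cancel] at h1
    have h2 := h1.le_of_le hα0 hα1 fun v => (hq s v).2
    have h3 : ∑ v ∈ S, (p s v - r s v) ≤ ∑ v ∈ S, 1 / (6 * (m : ℝ)) :=
      Finset.sum_le_sum fun v _ => h2 v
    rw [Finset.sum_sub_distrib, Finset.sum_const, nsmul_eq_mul, ← hm] at h3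
    have h4 : (m : ℝ) * (1 / (6 * m)) = 1 / 6 := by field_simp
    linarith
  have hmL : (m : ℝ) * logApprox m ≤ m * Real.log m := by gcongr
  have hmlog : 0 < (m : ℝ) * Real.log m := by positivity
  -- For `l = 2` the mass required is below 0.747, against 0.99 - 1/6. The output has at most 3 m
  -- log m ≤ n/2 vertices, so the program does not need to know `n`.
  refine WeightedGraph.guarantee_of_best (s := s) (α := α) (l := 2) (q := q s) (r := r s) hS hφ hα
    (by norm_num) ?_ (fun v => (hq s v).1) (hr s) (hr0 s) hr1 ?_ (fun t ht hcardt => ?_) ?_ ?_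
  · rw [Fintype.card_fin]; linarith
  · refine lt_of_lt_of_le ?_ hmass
    rw [← hm]
    have h1 : 1 / Real.log m < 1.4431 := by
      rw [div_lt_iff₀ (by linarith)]; linarith
    have h2 : 1 / (2 * Real.log m) = 1 / 2 * (1 / Real.log m) := by field_simp
    rw [h2]
    linarith [hs.2]
  · rw [← hm] at hcardt
    have h1 : ((level (r s) t).card : ℝ) < n := by linarith
    refine hbest s t ht (by exact_mod_cast h1) (hcardt.trans ?_)
    have : (m : ℝ) * (2 / 3 * Real.log m) ≤ m * logApprox m := by gcongr
    linarith
  · linarith [hcard s]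
  · rw [Fintype.card_fin]
    have : (2 : ℝ) * (out s).card ≤ n := by linarith [hcard s]
    exact_mod_cast this

end

end LocalPartition

/-! ### Both algorithms with common constants -/

theorem theorem3 :
    ∃ c C : ℝ, 0 < c ∧ 0 < C ∧
      -- weighted graphs: a polynomial time algorithm
      (∃ (P : LocalPartition.Program) (e : ℕ),
        ∀ (n : ℕ) (G : LocalPartition.WeightedGraph (Fin n)) (S : Finset (Fin n)),
          2 ≤ S.card → 0 < G.edgeExp S → 3 * ((S.card : ℝ) * Real.log S.card) ≤ n →
          ∃ out : Fin n → Finset (Fin n),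
            (∀ s ∈ S,
              P.Outputs (LocalPartition.weightedInput G s S.card (G.edgeExp S))
                (C * (n : ℝ) ^ e) (out s) ∧
              ∃ r : Fin n → ℝ, G.IsPageRank s (min 1 (c * G.edgeExp S)) r ∧
                LocalPartition.IsLevelSet r (out s)) ∧
            S.card ≤ 2 * {s | s ∈ S ∧ LocalPartition.Guarantee G C S (out s)}.ncard) ∧
      -- unweighted regular graphs: a local implementation
      (∃ Q : LocalPartition.Program,
        ∀ (n d : ℕ) (H : SimpleGraph (Fin n)) [DecidableRel H.Adj] (hd : 0 < d)
          (hreg : H.IsRegularOfDegree d) (nbr : Fin n → Fin d → Fin n)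
          (G : LocalPartition.WeightedGraph (Fin n)) (S : Finset (Fin n)),
          LocalPartition.IsAdjacencyList H nbr → G = LocalPartition.ofRegular H d hd hreg →
          2 ≤ S.card → 0 < G.edgeExp S → 6 * ((S.card : ℝ) * Real.log S.card) ≤ n →
          ∃ out : Fin n → Finset (Fin n),
            (∀ s ∈ S,
              Q.Outputs (LocalPartition.localInput nbr s S.card (G.edgeExp S))
                (C * (d * S.card * Real.log S.card / G.edgeExp S
                  + S.card * Real.log S.card ^ 2)) (out s) ∧
              ∃ r : Fin n → ℝ,
                G.IsApproxPageRank s (min 1 (c * G.edgeExp S)) (1 / (6 * S.card)) r ∧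
                LocalPartition.IsLevelSet r (out s)) ∧
            S.card ≤ 2 * {s | s ∈ S ∧ LocalPartition.Guarantee G C S (out s)}.ncard) := by
  refine ⟨100, 10000000, by norm_num, by norm_num, ⟨LocalPartition.pagerankProgram, 3, ?_⟩,
    LocalPartition.localProgram, ?_⟩
  · intro n G S hS hφ hn
    exact LocalPartition.weighted_algorithm G S hS hφ hn
  · intro n d H _ hd hreg nbr G S hnbr hG hS hφ hn
    exact LocalPartition.local_algorithm H hd hreg hnbr hG S hS hφ hn
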